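/- Let $K$ be a field. **Planar trees.** $PT_n$ ($n\ge 1$) is the set of planar rooted trees with $n$ leaves all of whose internal vertices have at least two inputs; $|$ is the trivial tree, $t_1\vee\dots\vee t_k$ ($k\ge2$) the grafting of trees on a new root, and for $p,q\ge 1$ the tree $\gamma_{pq}\in PT_{p+q}$ is the grafting of the $p$-corolla with the $q$-corolla (the $1$-corolla being $|$). **$B_\infty$-algebras.** A $B_\infty$-algebra is a $K$-vector space $R$ with linear maps $M_{pq}:R^{\otimes p}\otimes R^{\otimes q}\to R$ ($p,q\ge0$) such that $M_{00}=0$, $M_{10}=\mathrm{Id}=M_{01}$, $M_{n0}=0=M_{0n}$ for $n\ge2$, and for all $i,j,k\ge1$ $$\sum_{1\le l\le i+j} M_{lk}\circ\Big(\sum M_{i_1j_1}\cdots M_{i_lj_l}\otimes \mathrm{Id}^{\otimes k}\Big)=\sum_{1\le m\le j+k} M_{im}\circ\Big(\mathrm{Id}^{\otimes i}\otimes \sum M_{j_1k_1}\cdots M_{j_mk_m}\Big),$$ the inner sums being over all non-negative integers with $\sum i_r=i$, $\sum j_r=j$ (resp. $\sum j_r=j$, $\sum k_r=k$), and $M_{i_1j_1}\cdots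 M_{i_lj_l}$ being applied to consecutive blocks of the variables. $B_\infty(V)$ denotes the free $B_\infty$-algebra on a vector space $V$. The space $B_\infty(n)$ of $n$-ary operations is the multilinear part of the free $B_\infty$-algebra on generators $x_1,\dots,x_n$ (the span of the composites of the $M_{pq}$ in which each $x_i$ is used exactly once), with the right $S_n$-action $\mu^\tau(x_1,\dots,x_n)=\mu(x_{\tau^{-1}(1)},\dots,x_{\tau^{-1}(n)})$. **The free 2-associative algebra.** $2as(V)$ is the free vector space with two associative products $*$ and $\cdot$ having a common unit $1$, generated by $V$. Its coproduct $\Delta$ is the linear map with $\Delta(1)=1\otimes1$, $\Delta(v)=v\otimes1+1\otimes v$ for $v\in V$, $\Delta(x*y)=\Delta(x)*\Delta(y)$ and $\Delta(x\cdot y)=(x\otimes1)\cdot\Delta(y)+\Delta(x)\cdot(1\otimes y)-x\otimes y$; its counit $c$ is multiplicative for both products and vanishes on $V$. Put $J=\mathrm{Id}-1\,c(-)$ and $$e=J-J\star J+\dots+(-1)^{n-1}J^{\star n}+\cdots$$ where $f\star g=\cdot\circ(f\otimes g)\circ\Delta$. A decorated tree $(t;v_1\cdots v_n)$ with $t\in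 PT_n$, $v_i\in V$, defines elements $t^*,t^\bullet\in 2as(V)$: both equal $v$ for $(|;v)$, and $t^*=t_1^\bullet*\dots*t_k^\bullet$, $t^\bullet=t_1^*\cdot\ldots\cdot t_k^*$ for $t=t_1\vee\dots\vee t_k$ (the decorations being distributed in order). Extend $t\mapsto t^*$ to a linear map $\bigoplus_{n\ge1}K[PT_n]\otimes V^{\otimes n}\to 2as(V)$, $s\mapsto s^*$. **Theorem.** (1) There are linear isomorphisms $\Phi_n: B_\infty(n)\cong K[PT_n]\otimes K[S_n]$ that are equivariant for the right actions of $S_n$ ($S_n$ acting on $K[S_n]$ by right multiplication) and map the operation $M_{pq}\in B_\infty(p+q)$ to $\gamma_{pq}\otimes 1_{p+q}$ for all $p,q\ge1$. (2) For every $K$-vector space $V$ the map $s\mapsto s^*$ is injective, and there is a linear isomorphism $$\Psi: B_\infty(V)\;\cong\;\bigoplus_{n\ge1}K[PT_n]\otimes V^{\otimes n}$$ such that - $\Psi(v)=(|;v)$ for $v\in V$; for every $t\in PT_n$, $\sigma\in S_n$, the operation $\mu=\Phi_n^{-1}(t\otimes\sigma)$ satisfies $\Psi(\mu(v_1,\dots,v_n))=(t;v_{\sigma^{-1}(1)}\cdots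 v_{\sigma^{-1}(n)})$ for all $v_i\in V$; in particular $\Psi(M_{pq}(v_1\cdots v_p,v_{p+1}\cdots v_{p+q}))=(\gamma_{pq};v_1\cdots v_{p+q})$ for $p,q\geq 1$; - the operations on the right hand side obtained by transport along $\Psi$ are determined by the following equality in $2as(V)$: for $p,q\ge1$ and all $t_1,\dots,t_{p+q}$ in $\bigoplus_{n\ge1}K[PT_n]\otimes V^{\otimes n}$ (in particular, $V$-decorated trees), $$M_{pq}(t_1\cdots t_p,\,t_{p+1}\cdots t_{p+q})^*=\big(e(t_1^*)\cdot\ldots\cdot e(t_p^*)\big)*\big(e(t_{p+1}^*)\cdot\ldots\cdot e(t_{p+q}^*)\big).$$ -/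

import Mathlib

set_option linter.unusedSectionVars false

open scoped TensorProduct DirectSum

universe u v w

/-! ## Planar rooted trees -/

/-- Planar rooted trees all of whose internal vertices have at least two inputs: a tree is either
the trivial tree `|`, or the grafting `c 0 ∨ ⋯ ∨ c (k+1)` of an ordered family of `k + 2` trees. -/
inductive PlanarTree : Type
  | leaf : PlanarTree
  | node (k : ℕ) (c : Fin (k + 2) → PlanarTree) : PlanarTree

namespace PlanarTree

/-- The number of leaves. -/
def leaves : PlanarTree → ℕ
  | leaf => 1
  | node _ c => ∑ i, (c i).leaves

theorem one_le_leaves : ∀ t : PlanarTree, 1 ≤ t.leaves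
  | leaf => le_rfl
  | node _ c => (one_le_leaves (c 0)).trans
      (Finset.single_le_sum (f := fun i => (c i).leaves) (fun _ _ => Nat.zero_le _)
        (Finset.mem_univ 0))

/-- The corolla with `n` leaves, for `n ≥ 1`; the corolla with one leaf is the trivial tree. -/
def corolla : ℕ → PlanarTree
  | 0 => leaf
  | 1 => leaf
  | k + 2 => node k fun _ => leaf

theorem leaves_corolla : ∀ {n : ℕ}, 1 ≤ n → (corolla n).leaves = n
  | 1, _ => rfl
  | k + 2, _ => by simp [corolla, leaves]

end PlanarTree

/-- The set of planar rooted trees with `n` leaves. -/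
def PT (n : ℕ) : Type := {t : PlanarTree // t.leaves = n}

/-- There is no tree without leaves, so that sums over all `n` of modules spanned by `PT n` are in
fact sums over `n ≥ 1`. -/
instance : IsEmpty (PT 0) :=
  ⟨fun t => absurd t.1.one_le_leaves (by rw [t.2]; exact Nat.not_succ_le_zero 0)⟩

/-- The tree `γ_{pq}`: the grafting of the `p`-corolla with the `q`-corolla. -/
def gammaTree {p q : ℕ} (hp : 1 ≤ p) (hq : 1 ≤ q) : PT (p + q) :=
  ⟨PlanarTree.node 0 ![PlanarTree.corolla p, PlanarTree.corolla q], by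
    simp [PlanarTree.leaves, Fin.sum_univ_two, PlanarTree.leaves_corolla hp,
      PlanarTree.leaves_corolla hq]⟩

/-! ## `B∞`-algebras -/

/-- Given block lengths `a 0, a 1, …` and a sequence `x`, the `m`-th block of `x`, i.e. the tuple
of the `a m` consecutive entries of `x` that follow the first `a 0 + ⋯ + a (m-1)` entries. -/
def block {X : Type*} {l : ℕ} (a : Fin l → ℕ) (x : ℕ → X) (m : Fin l) : Fin (a m) → X :=
  fun s => x ((∑ r ∈ Finset.Iio m, a r) + s)

/-- A `B∞`-algebra structure on a vector space `R`: multilinear operations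
`M p q : R^{⊗p} ⊗ R^{⊗q} → R` subject to the unit conditions and to the relations `ℛ_{ijk}`.
The finset `Finset.Nat.antidiagonalTuple l n` consists of all `l`-tuples of natural numbers with
sum `n`. Only the first `i`, `j`, `k` terms of the sequences `x`, `y`, `z` occur in `ℛ_{ijk}`. -/
class BInfAlgebra (K : Type u) (R : Type v) [Field K] [AddCommGroup R] [Module K R] where
  M : ∀ p q : ℕ,
    MultilinearMap K (fun _ : Fin p => R) (MultilinearMap K (fun _ : Fin q => R) R)
  M_zero_zero : ∀ a b, M 0 0 a b = 0
  M_one_zero : ∀ a b, M 1 0 a b = a 0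
  M_zero_one : ∀ a b, M 0 1 a b = b 0
  M_left_zero : ∀ n, 2 ≤ n → ∀ a b, M n 0 a b = 0
  M_zero_right : ∀ n, 2 ≤ n → ∀ a b, M 0 n a b = 0
  relation : ∀ i j k : ℕ, 1 ≤ i → 1 ≤ j → 1 ≤ k → ∀ x y z : ℕ → R,
    ∑ l ∈ Finset.Icc 1 (i + j), ∑ a ∈ Finset.Nat.antidiagonalTuple l i,
      ∑ b ∈ Finset.Nat.antidiagonalTuple l j,
        M l k (fun m => M (a m) (b m) (block a x m) (block b y m)) (fun s => z s) =
    ∑ l ∈ Finset.Icc 1 (j + k), ∑ b ∈ Finset.Nat.antidiagonalTuple l j,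
      ∑ c ∈ Finset.Nat.antidiagonalTuple l k,
        M i l (fun s => x s) (fun m => M (b m) (c m) (block b y m) (block c z m))

/-! ## The free `B∞`-algebra -/

/-- Formal expressions in the operations of a `B∞`-algebra, with variables in `V`. -/
inductive PreBInf (K : Type u) (V : Type v) : Type (max u v)
  | of (x : V) : PreBInf K V
  | zero : PreBInf K V
  | add (s t : PreBInf K V) : PreBInf K V
  | smul (r : K) (t : PreBInf K V) : PreBInf K V
  | op (p q : ℕ) (a : Fin p → PreBInf K V) (b : Fin q → PreBInf K V) : PreBInf K V

namespace PreBInf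

/-- The formal sum of a finite family of expressions. -/
noncomputable def sum {K : Type u} {V : Type v} {ι : Type} (s : Finset ι)
    (f : ι → PreBInf K V) : PreBInf K V :=
  (s.toList.map f).foldr add zero

/-- The congruence generated by the axioms of vector spaces, the linearity of `of`, the
multilinearity of the operations and the defining relations of `B∞`-algebras. -/
inductive Rel (K : Type u) (V : Type v) [Field K] [AddCommGroup V] [Module K V] :
    PreBInf K V → PreBInf K V → Prop
  | refl (s) : Rel K V s s
  | symm {s t} : Rel K V s t → Rel K V t s
  | trans {s t r} : Rel K V s t → Rel K V t r → Rel K V s r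
  | add_congr {s s' t t'} : Rel K V s s' → Rel K V t t' → Rel K V (add s t) (add s' t')
  | smul_congr (r : K) {s s'} : Rel K V s s' → Rel K V (smul r s) (smul r s')
  | op_congr (p q : ℕ) {a a' : Fin p → PreBInf K V} {b b' : Fin q → PreBInf K V} :
      (∀ i, Rel K V (a i) (a' i)) → (∀ j, Rel K V (b j) (b' j)) →
      Rel K V (op p q a b) (op p q a' b')
  | add_assoc (s t r) : Rel K V (add (add s t) r) (add s (add t r))
  | add_comm (s t) : Rel K V (add s t) (add t s)
  | zero_add (s) : Rel K V (add zero s) s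
  | zero_smul (s) : Rel K V (smul 0 s) zero
  | one_smul (s) : Rel K V (smul 1 s) s
  | mul_smul (r r' : K) (s) : Rel K V (smul (r * r') s) (smul r (smul r' s))
  | add_smul (r r' : K) (s) : Rel K V (smul (r + r') s) (add (smul r s) (smul r' s))
  | smul_add (r : K) (s t) : Rel K V (smul r (add s t)) (add (smul r s) (smul r t))
  | of_add (x y : V) : Rel K V (of (x + y)) (add (of x) (of y))
  | of_smul (r : K) (x : V) : Rel K V (of (r • x)) (smul r (of x))
  | op_add_left (p q : ℕ) (a : Fin p → PreBInf K V) (b : Fin q → PreBInf K V) (i : Fin p) (s t) :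
      Rel K V (op p q (Function.update a i (add s t)) b)
        (add (op p q (Function.update a i s) b) (op p q (Function.update a i t) b))
  | op_smul_left (p q : ℕ) (a : Fin p → PreBInf K V) (b : Fin q → PreBInf K V) (i : Fin p)
      (r : K) (s) :
      Rel K V (op p q (Function.update a i (smul r s)) b)
        (smul r (op p q (Function.update a i s) b))
  | op_add_right (p q : ℕ) (a : Fin p → PreBInf K V) (b : Fin q → PreBInf K V) (j : Fin q) (s t) :
      Rel K V (op p q a (Function.update b j (add s t)))
        (add (op p q a (Function.update b j s)) (op p q a (Function.update b j t)))
  | op_smul_right (p q : ℕ) (a : Fin p → PreBInf K V) (b : Fin q → PreBInf K V) (j : Fin q)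
      (r : K) (s) :
      Rel K V (op p q a (Function.update b j (smul r s)))
        (smul r (op p q a (Function.update b j s)))
  | op_zero_zero (a b) : Rel K V (op 0 0 a b) zero
  | op_one_zero (a b) : Rel K V (op 1 0 a b) (a 0)
  | op_zero_one (a b) : Rel K V (op 0 1 a b) (b 0)
  | op_left_zero (n : ℕ) (hn : 2 ≤ n) (a b) : Rel K V (op n 0 a b) zero
  | op_zero_right (n : ℕ) (hn : 2 ≤ n) (a b) : Rel K V (op 0 n a b) zero
  | relation (i j k : ℕ) (hi : 1 ≤ i) (hj : 1 ≤ j) (hk : 1 ≤ k) (x y z : ℕ → PreBInf K V) :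
      Rel K V
        (sum (Finset.Icc 1 (i + j)) fun l => sum (Finset.Nat.antidiagonalTuple l i) fun a =>
          sum (Finset.Nat.antidiagonalTuple l j) fun b =>
            op l k (fun m => op (a m) (b m) (block a x m) (block b y m)) (fun s => z s))
        (sum (Finset.Icc 1 (j + k)) fun l => sum (Finset.Nat.antidiagonalTuple l j) fun b =>
          sum (Finset.Nat.antidiagonalTuple l k) fun c =>
            op i l (fun s => x s) (fun m => op (b m) (c m) (block b y m) (block c z m)))

/-- The setoid of the congruence. -/
def setoid (K : Type u) (V : Type v) [Field K] [AddCommGroup V] [Module K V] :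
    Setoid (PreBInf K V) :=
  ⟨Rel K V, ⟨Rel.refl, Rel.symm, Rel.trans⟩⟩

end PreBInf

/-- The free `B∞`-algebra on the vector space `V`: formal expressions modulo the congruence
generated by the axioms. Its universal property is `FreeBInf.existsUnique_lift`. -/
def FreeBInf (K : Type u) (V : Type v) [Field K] [AddCommGroup V] [Module K V] :
    Type (max u v) :=
  Quotient (PreBInf.setoid K V)

namespace FreeBInf

section

variable {K : Type u} {V : Type v} [Field K] [AddCommGroup V] [Module K V]

/-- The class of an expression. -/
def mk (t : PreBInf K V) : FreeBInf K V := Quotient.mk (PreBInf.setoid K V) t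

theorem mk_eq {s t : PreBInf K V} (h : PreBInf.Rel K V s t) : mk s = mk t := Quotient.sound h

theorem mk_surjective : Function.Surjective (mk : PreBInf K V → FreeBInf K V) :=
  Quotient.exists_rep

instance : Add (FreeBInf K V) where
  add := Quotient.map₂ PreBInf.add fun _ _ h _ _ h' => PreBInf.Rel.add_congr h h'

instance : Zero (FreeBInf K V) where
  zero := mk PreBInf.zero

instance : AddCommMonoid (FreeBInf K V) where
  add_assoc := by
    rintro ⟨s⟩ ⟨t⟩ ⟨r⟩
    exact mk_eq (.add_assoc s t r)
  zero_add := by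
    rintro ⟨s⟩
    exact mk_eq (.zero_add s)
  add_zero := by
    rintro ⟨s⟩
    exact mk_eq (.trans (.add_comm _ _) (.zero_add s))
  add_comm := by
    rintro ⟨s⟩ ⟨t⟩
    exact mk_eq (.add_comm s t)
  nsmul := nsmulRec

instance : SMul K (FreeBInf K V) where
  smul r := Quotient.map (PreBInf.smul r) fun _ _ h => PreBInf.Rel.smul_congr r h

theorem mk_zero : mk (PreBInf.zero : PreBInf K V) = 0 := rfl

theorem mk_add (s t : PreBInf K V) : mk (s.add t) = mk s + mk t := rfl

theorem mk_smul (r : K) (t : PreBInf K V) : mk (t.smul r) = r • mk t := rfl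

instance : Module K (FreeBInf K V) where
  one_smul := by
    rintro ⟨s⟩
    exact mk_eq (.one_smul s)
  mul_smul := by
    rintro r r' ⟨s⟩
    exact mk_eq (.mul_smul r r' s)
  smul_zero := by
    intro r
    rw [← mk_zero, ← mk_smul]
    refine mk_eq (.trans (.smul_congr r (.symm (.zero_smul .zero))) ?_)
    refine .trans (.symm (.mul_smul r 0 _)) ?_
    rw [mul_zero]
    exact .zero_smul _
  smul_add := by
    rintro r ⟨s⟩ ⟨t⟩
    exact mk_eq (.smul_add r s t)
  add_smul := by
    rintro r r' ⟨s⟩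
    exact mk_eq (.add_smul r r' s)
  zero_smul := by
    rintro ⟨s⟩
    exact mk_eq (.zero_smul s)

instance : AddCommGroup (FreeBInf K V) := Module.addCommMonoidToAddCommGroup K

theorem mk_sum {ι : Type} (s : Finset ι) (f : ι → PreBInf K V) :
    mk (PreBInf.sum s f) = ∑ i ∈ s, mk (f i) := by
  rw [← Finset.sum_map_toList, PreBInf.sum]
  induction s.toList with
  | nil => rfl
  | cons x l ih => simp [mk_add, ← ih]

/-- The operations of the free `B∞`-algebra, as functions. -/
noncomputable def opFun (p q : ℕ) (a : Fin p → FreeBInf K V) (b : Fin q → FreeBInf K V) :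
    FreeBInf K V :=
  mk (PreBInf.op p q (fun i => Quotient.out (a i)) fun j => Quotient.out (b j))

theorem mk_op (p q : ℕ) (a : Fin p → PreBInf K V) (b : Fin q → PreBInf K V) :
    mk (PreBInf.op p q a b) = opFun p q (fun i => mk (a i)) fun j => mk (b j) :=
  mk_eq (.symm (.op_congr p q (fun i => Quotient.mk_out (s := PreBInf.setoid K V) (a i))
    fun j => Quotient.mk_out (s := PreBInf.setoid K V) (b j)))

theorem exists_mk {n : ℕ} (a : Fin n → FreeBInf K V) :
    ∃ a' : Fin n → PreBInf K V, a = fun i => mk (a' i) :=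
  ⟨fun i => (mk_surjective (a i)).choose, funext fun i => (mk_surjective (a i)).choose_spec.symm⟩

theorem update_mk {n : ℕ} (a : Fin n → PreBInf K V) (i : Fin n) (s : PreBInf K V) :
    Function.update (fun i => mk (a i)) i (mk s) = fun j => mk (Function.update a i s j) :=
  (Function.comp_update mk a i s).symm

/-- The operation `M_{pq}` of the free `B∞`-algebra. -/
noncomputable def opMap (p q : ℕ) :
    MultilinearMap K (fun _ : Fin p => FreeBInf K V)
      (MultilinearMap K (fun _ : Fin q => FreeBInf K V) (FreeBInf K V)) where
  toFun a :=
    { toFun := fun b => opFun p q a b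
      map_update_add' := by
        intro inst b j s t
        obtain rfl : inst = instDecidableEqFin q := Subsingleton.elim _ _
        obtain ⟨a, rfl⟩ := exists_mk a
        obtain ⟨b, rfl⟩ := exists_mk b
        obtain ⟨s, rfl⟩ := mk_surjective s
        obtain ⟨t, rfl⟩ := mk_surjective t
        rw [← mk_add]
        simp only [update_mk, ← mk_op]
        exact mk_eq (.op_add_right p q a b j s t)
      map_update_smul' := by
        intro inst b j r s
        obtain rfl : inst = instDecidableEqFin q := Subsingleton.elim _ _
        obtain ⟨a, rfl⟩ := exists_mk a
        obtain ⟨b, rfl⟩ := exists_mk b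
        obtain ⟨s, rfl⟩ := mk_surjective s
        rw [← mk_smul]
        simp only [update_mk, ← mk_op]
        exact mk_eq (.op_smul_right p q a b j r s) }
  map_update_add' := by
    intro inst a i s t
    obtain rfl : inst = instDecidableEqFin p := Subsingleton.elim _ _
    ext b
    obtain ⟨a, rfl⟩ := exists_mk a
    obtain ⟨b, rfl⟩ := exists_mk b
    obtain ⟨s, rfl⟩ := mk_surjective s
    obtain ⟨t, rfl⟩ := mk_surjective t
    simp only [add_apply, MultilinearMap.coe_mk]
    rw [← mk_add]
    simp only [update_mk, ← mk_op]
    exact mk_eq (.op_add_left p q a b i s t)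
  map_update_smul' := by
    intro inst a i r s
    obtain rfl : inst = instDecidableEqFin p := Subsingleton.elim _ _
    ext b
    obtain ⟨a, rfl⟩ := exists_mk a
    obtain ⟨b, rfl⟩ := exists_mk b
    obtain ⟨s, rfl⟩ := mk_surjective s
    simp only [smul_apply, MultilinearMap.coe_mk]
    rw [← mk_smul]
    simp only [update_mk, ← mk_op]
    exact mk_eq (.op_smul_left p q a b i r s)

theorem opMap_apply (p q : ℕ) (a : Fin p → FreeBInf K V) (b : Fin q → FreeBInf K V) :
    opMap p q a b = opFun p q a b := rfl

noncomputable instance : BInfAlgebra K (FreeBInf K V) where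
  M := opMap
  M_zero_zero a b := by
    obtain ⟨a, rfl⟩ := exists_mk a
    obtain ⟨b, rfl⟩ := exists_mk b
    rw [opMap_apply, ← mk_op]
    exact mk_eq (.op_zero_zero a b)
  M_one_zero a b := by
    obtain ⟨a, rfl⟩ := exists_mk a
    obtain ⟨b, rfl⟩ := exists_mk b
    rw [opMap_apply, ← mk_op]
    exact mk_eq (.op_one_zero a b)
  M_zero_one a b := by
    obtain ⟨a, rfl⟩ := exists_mk a
    obtain ⟨b, rfl⟩ := exists_mk b
    rw [opMap_apply, ← mk_op]
    exact mk_eq (.op_zero_one a b)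
  M_left_zero n hn a b := by
    obtain ⟨a, rfl⟩ := exists_mk a
    obtain ⟨b, rfl⟩ := exists_mk b
    rw [opMap_apply, ← mk_op]
    exact mk_eq (.op_left_zero n hn a b)
  M_zero_right n hn a b := by
    obtain ⟨a, rfl⟩ := exists_mk a
    obtain ⟨b, rfl⟩ := exists_mk b
    rw [opMap_apply, ← mk_op]
    exact mk_eq (.op_zero_right n hn a b)
  relation i j k hi hj hk x y z := by
    have hx : ∃ x' : ℕ → PreBInf K V, x = fun n => mk (x' n) :=
      ⟨fun n => (mk_surjective (x n)).choose,
        funext fun n => (mk_surjective (x n)).choose_spec.symm⟩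
    have hy : ∃ x' : ℕ → PreBInf K V, y = fun n => mk (x' n) :=
      ⟨fun n => (mk_surjective (y n)).choose,
        funext fun n => (mk_surjective (y n)).choose_spec.symm⟩
    have hz : ∃ x' : ℕ → PreBInf K V, z = fun n => mk (x' n) :=
      ⟨fun n => (mk_surjective (z n)).choose,
        funext fun n => (mk_surjective (z n)).choose_spec.symm⟩
    obtain ⟨x, rfl⟩ := hx
    obtain ⟨y, rfl⟩ := hy
    obtain ⟨z, rfl⟩ := hz
    have h := mk_eq (PreBInf.Rel.relation i j k hi hj hk x y z)
    simp only [mk_sum, mk_op] at h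
    exact h

/-- The inclusion of generators. -/
def ι (K : Type u) {V : Type v} [Field K] [AddCommGroup V] [Module K V] :
    V →ₗ[K] FreeBInf K V where
  toFun x := mk (.of x)
  map_add' x y := mk_eq (.of_add x y)
  map_smul' r x := mk_eq (.of_smul r x)

end

end FreeBInf

/-- Evaluation of formal expressions in a `B∞`-algebra. -/
def PreBInf.eval {K : Type u} {V : Type v} [Field K] [AddCommGroup V] [Module K V]
    {R : Type w} [AddCommGroup R] [Module K R] [BInfAlgebra K R] (f : V →ₗ[K] R) :
    PreBInf K V → R
  | of x => f x
  | zero => 0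
  | add s t => s.eval f + t.eval f
  | smul r t => r • t.eval f
  | op p q a b => BInfAlgebra.M (K := K) p q (fun i => (a i).eval f) fun j => (b j).eval f

theorem PreBInf.eval_sum {K : Type u} {V : Type v} [Field K] [AddCommGroup V] [Module K V]
    {R : Type w} [AddCommGroup R] [Module K R] [BInfAlgebra K R] (f : V →ₗ[K] R)
    {ι : Type} (s : Finset ι) (g : ι → PreBInf K V) :
    (PreBInf.sum s g).eval f = ∑ i ∈ s, (g i).eval f := by
  rw [← Finset.sum_map_toList, PreBInf.sum]
  induction s.toList with
  | nil => rfl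
  | cons x l ih => simp [PreBInf.eval, ← ih]

theorem PreBInf.eval_update {K : Type u} {V : Type v} [Field K] [AddCommGroup V] [Module K V]
    {R : Type w} [AddCommGroup R] [Module K R] [BInfAlgebra K R] (f : V →ₗ[K] R)
    {n : ℕ} (a : Fin n → PreBInf K V) (i : Fin n) (s : PreBInf K V) :
    (fun j => (Function.update a i s j).eval f) =
      Function.update (fun j => (a j).eval f) i (s.eval f) :=
  Function.comp_update (PreBInf.eval f) a i s

theorem PreBInf.eval_eq {K : Type u} {V : Type v} [Field K] [AddCommGroup V] [Module K V]
    {R : Type w} [AddCommGroup R] [Module K R] [BInfAlgebra K R] (f : V →ₗ[K] R)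
    {s t : PreBInf K V} (h : PreBInf.Rel K V s t) : s.eval f = t.eval f := by
  induction h with
  | refl => rfl
  | symm _ ih => exact ih.symm
  | trans _ _ ih ih' => exact ih.trans ih'
  | add_congr _ _ ih ih' => simp only [eval, ih, ih']
  | smul_congr _ _ ih => simp only [eval, ih]
  | op_congr _ _ _ _ ih ih' => simp only [eval, ih, ih']
  | add_assoc => simp only [eval, _root_.add_assoc]
  | add_comm => simp only [eval, _root_.add_comm]
  | zero_add => simp only [eval, _root_.zero_add]
  | zero_smul => simp only [eval, _root_.zero_smul]
  | one_smul => simp only [eval, _root_.one_smul]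
  | mul_smul => simp only [eval, SemigroupAction.mul_smul]
  | add_smul => simp only [eval, _root_.add_smul]
  | smul_add => simp only [eval, _root_.smul_add]
  | of_add => simp only [eval, map_add]
  | of_smul => simp only [eval, map_smul]
  | op_add_left => simp only [eval, eval_update, MultilinearMap.map_update_add,
      add_apply]
  | op_smul_left => simp only [eval, eval_update, MultilinearMap.map_update_smul,
      smul_apply]
  | op_add_right => simp only [eval, eval_update, MultilinearMap.map_update_add]
  | op_smul_right => simp only [eval, eval_update, MultilinearMap.map_update_smul]
  | op_zero_zero => simp only [eval, BInfAlgebra.M_zero_zero]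
  | op_one_zero => simp only [eval, BInfAlgebra.M_one_zero]
  | op_zero_one => simp only [eval, BInfAlgebra.M_zero_one]
  | op_left_zero n hn => simp only [eval, BInfAlgebra.M_left_zero n hn]
  | op_zero_right n hn => simp only [eval, BInfAlgebra.M_zero_right n hn]
  | relation i j k hi hj hk x y z =>
    simp only [eval_sum, eval]
    exact BInfAlgebra.relation i j k hi hj hk (fun n => (x n).eval f) (fun n => (y n).eval f)
      (fun n => (z n).eval f)

namespace FreeBInf

section

variable {K : Type u} {V : Type v} [Field K] [AddCommGroup V] [Module K V]
variable {R : Type w} [AddCommGroup R] [Module K R] [BInfAlgebra K R]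

/-- The morphism of `B∞`-algebras on the free `B∞`-algebra that extends a linear map. -/
def lift (f : V →ₗ[K] R) : FreeBInf K V →ₗ[K] R where
  toFun := Quotient.lift (PreBInf.eval f) fun _ _ h => PreBInf.eval_eq f h
  map_add' := by
    rintro ⟨s⟩ ⟨t⟩
    rfl
  map_smul' := by
    rintro r ⟨s⟩
    rfl

theorem lift_mk (f : V →ₗ[K] R) (t : PreBInf K V) : lift f (mk t) = t.eval f := rfl

theorem lift_ι (f : V →ₗ[K] R) (x : V) : lift f (ι K x) = f x := rfl

theorem lift_M (f : V →ₗ[K] R) (p q : ℕ) (a : Fin p → FreeBInf K V) (b : Fin q → FreeBInf K V) :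
    lift f (BInfAlgebra.M (K := K) p q a b) =
      BInfAlgebra.M (K := K) p q (fun i => lift f (a i)) fun j => lift f (b j) := by
  obtain ⟨a, rfl⟩ := exists_mk a
  obtain ⟨b, rfl⟩ := exists_mk b
  exact (congrArg (lift f) (mk_op p q a b)).symm

/-- The universal property of the free `B∞`-algebra. -/
theorem existsUnique_lift (f : V →ₗ[K] R) :
    ∃! F : FreeBInf K V →ₗ[K] R,
      (∀ p q (a : Fin p → FreeBInf K V) (b : Fin q → FreeBInf K V),
        F (BInfAlgebra.M (K := K) p q a b) =
          BInfAlgebra.M (K := K) p q (fun i => F (a i)) fun j => F (b j)) ∧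
      ∀ x, F (ι K x) = f x := by
  refine ⟨lift f, ⟨lift_M f, lift_ι f⟩, ?_⟩
  rintro F ⟨h, h'⟩
  ext x
  obtain ⟨t, rfl⟩ := mk_surjective x
  rw [lift_mk]
  induction t with
  | of x => exact h' x
  | zero => exact map_zero F
  | add s t ih ih' => rw [mk_add, map_add, ih, ih', PreBInf.eval]
  | smul r t ih => rw [mk_smul, map_smul, ih, PreBInf.eval]
  | op p q a b ih ih' =>
    rw [mk_op, PreBInf.eval]
    refine (h p q _ _).trans ?_
    simp only [ih, ih']

end

end FreeBInf

/-! ## The operad `B∞` -/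

/-- `IsBInfMonomial K x d r` says that `r` is obtained from the elements `x i` by iterated
application of the operations `M_{pq}`, the multiset `d` recording how often each `x i` is used. -/
inductive IsBInfMonomial (K : Type u) {R : Type v} [Field K] [AddCommGroup R] [Module K R]
    [BInfAlgebra K R] {n : ℕ} (x : Fin n → R) : Multiset (Fin n) → R → Prop
  | var (i : Fin n) : IsBInfMonomial K x {i} (x i)
  | op (p q : ℕ) (d : Fin p → Multiset (Fin n)) (d' : Fin q → Multiset (Fin n))
      (a : Fin p → R) (b : Fin q → R) :
      (∀ i, IsBInfMonomial K x (d i) (a i)) → (∀ j, IsBInfMonomial K x (d' j) (b j)) →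
      IsBInfMonomial K x (∑ i, d i + ∑ j, d' j) (BInfAlgebra.M (K := K) p q a b)

/-- The generators `x_1, …, x_n` of the free `B∞`-algebra over `K^n`. -/
noncomputable def genericVar (K : Type u) [Field K] (n : ℕ) (i : Fin n) :
    FreeBInf K (Fin n → K) :=
  FreeBInf.ι K (Pi.single i 1)

/-- The space `B∞(n)` of `n`-ary operations of `B∞`-algebras: the multilinear part of the free
`B∞`-algebra on the generators `x_1, …, x_n`, that is, the span of the composites of the
operations `M_{pq}` in which each `x_i` is used exactly once. -/
def BInfOperad (K : Type u) [Field K] (n : ℕ) : Submodule K (FreeBInf K (Fin n → K)) :=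
  Submodule.span K {r | IsBInfMonomial K (genericVar K n) Finset.univ.val r}

namespace BInfOperad

section

variable {K : Type u} [Field K]

/-- The value `μ(r_1, …, r_n)` of an operation `μ` on elements of a `B∞`-algebra: the image of `μ`
under the morphism of `B∞`-algebras that sends `x_i` to `r_i`. -/
noncomputable def eval {n : ℕ} {R : Type v} [AddCommGroup R] [Module K R] [BInfAlgebra K R]
    (r : Fin n → R) : BInfOperad K n →ₗ[K] R :=
  FreeBInf.lift (Fintype.linearCombination K r) ∘ₗ (BInfOperad K n).subtype

theorem lift_genericVar {n : ℕ} {R : Type v} [AddCommGroup R] [Module K R] [BInfAlgebra K R]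
    (r : Fin n → R) (i : Fin n) :
    FreeBInf.lift (Fintype.linearCombination K r) (genericVar K n i) = r i := by
  rw [genericVar, FreeBInf.lift_ι, Fintype.linearCombination_apply_single, one_smul]

theorem perm_mem {n : ℕ} (τ : Equiv.Perm (Fin n)) (μ : BInfOperad K n) :
    eval (fun i => genericVar K n (τ.symm i)) μ ∈ BInfOperad K n := by
  obtain ⟨μ, hμ⟩ := μ
  have key : ∀ d r, IsBInfMonomial K (genericVar K n) d r →
      IsBInfMonomial K (genericVar K n) (d.map τ.symm)
        (FreeBInf.lift (Fintype.linearCombination K fun i => genericVar K n (τ.symm i)) r) := by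
    intro d r h
    induction h with
    | var i =>
      rw [lift_genericVar, Multiset.map_singleton]
      exact .var _
    | op p q d d' a b _ _ ih ih' =>
      rw [FreeBInf.lift_M, Multiset.map_add]
      have h1 : ∀ (m : ℕ) (d : Fin m → Multiset (Fin n)),
          (∑ i, d i).map τ.symm = ∑ i, (d i).map τ.symm := fun m d =>
        map_sum (Multiset.mapAddMonoidHom τ.symm) d Finset.univ
      rw [h1, h1]
      exact .op p q _ _ _ _ ih ih'
  have huniv : (Finset.univ.val : Multiset (Fin n)).map τ.symm = Finset.univ.val := by
    have := congrArg Finset.val (Finset.map_univ_equiv τ.symm)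
    rwa [Finset.map_val] at this
  have hle : BInfOperad K n ≤ (BInfOperad K n).comap
      (FreeBInf.lift (Fintype.linearCombination K fun i => genericVar K n (τ.symm i))) := by
    refine Submodule.span_le.2 fun r hr => Submodule.subset_span ?_
    have := key _ _ hr
    rwa [huniv] at this
  exact hle hμ

/-- The right action of the symmetric group on `B∞(n)`:
`μ^τ(x_1, …, x_n) = μ(x_{τ⁻¹(1)}, …, x_{τ⁻¹(n)})`. -/
noncomputable def perm {n : ℕ} (τ : Equiv.Perm (Fin n)) : BInfOperad K n →ₗ[K] BInfOperad K n :=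
  (eval fun i => genericVar K n (τ.symm i)).codRestrict (BInfOperad K n) (perm_mem τ)

/-- The generating operation `M_{pq}(x_1 … x_p, x_{p+1} … x_{p+q})`, as an element of
`B∞(p + q)`. -/
noncomputable def gen (K : Type u) [Field K] (p q : ℕ) : BInfOperad K (p + q) :=
  ⟨BInfAlgebra.M (K := K) p q (fun i => genericVar K (p + q) (Fin.castAdd q i))
      fun j => genericVar K (p + q) (Fin.natAdd p j), by
    refine Submodule.subset_span ?_
    have h : (Finset.univ.val : Multiset (Fin (p + q))) =
        ∑ i : Fin p, {Fin.castAdd q i} + ∑ j : Fin q, {Fin.natAdd p j} := by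
      rw [← Fin.sum_univ_add (fun i : Fin (p + q) => ({i} : Multiset (Fin (p + q))))]
      exact (Finset.sum_multiset_singleton _).symm
    rw [Set.mem_ofPred_eq, h]
    exact .op p q _ _ _ _ (fun i => .var _) fun j => .var _⟩

end

end BInfOperad

/-! ## 2-associative algebras -/

/-- A (unital) 2-associative algebra structure: two associative bilinear products with a common
unit. -/
class TwoAssocAlgebra (K : Type u) (A : Type v) [Field K] [AddCommGroup A] [Module K A] where
  one : A
  star : A →ₗ[K] A →ₗ[K] A
  dot : A →ₗ[K] A →ₗ[K] A
  star_assoc : ∀ x y z, star (star x y) z = star x (star y z)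
  dot_assoc : ∀ x y z, dot (dot x y) z = dot x (dot y z)
  one_star : ∀ x, star one x = x
  star_one : ∀ x, star x one = x
  one_dot : ∀ x, dot one x = x
  dot_one : ∀ x, dot x one = x

/-- The ground field, both products being the multiplication. -/
instance TwoAssocAlgebra.ground (K : Type u) [Field K] : TwoAssocAlgebra K K where
  one := 1
  star := LinearMap.mul K K
  dot := LinearMap.mul K K
  star_assoc := mul_assoc
  dot_assoc := mul_assoc
  one_star := one_mul
  star_one := mul_one
  one_dot := one_mul
  dot_one := mul_one

/-- Formal expressions in the operations of a 2-associative algebra, with variables in `V`. -/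
inductive PreTwoAssoc (K : Type u) (V : Type v) : Type (max u v)
  | of (x : V) : PreTwoAssoc K V
  | zero : PreTwoAssoc K V
  | one : PreTwoAssoc K V
  | add (s t : PreTwoAssoc K V) : PreTwoAssoc K V
  | smul (r : K) (t : PreTwoAssoc K V) : PreTwoAssoc K V
  | star (s t : PreTwoAssoc K V) : PreTwoAssoc K V
  | dot (s t : PreTwoAssoc K V) : PreTwoAssoc K V

namespace PreTwoAssoc

/-- The congruence generated by the axioms of vector spaces, the linearity of `of` and the axioms
of 2-associative algebras. -/
inductive Rel (K : Type u) (V : Type v) [Field K] [AddCommGroup V] [Module K V] :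
    PreTwoAssoc K V → PreTwoAssoc K V → Prop
  | refl (s) : Rel K V s s
  | symm {s t} : Rel K V s t → Rel K V t s
  | trans {s t r} : Rel K V s t → Rel K V t r → Rel K V s r
  | add_congr {s s' t t'} : Rel K V s s' → Rel K V t t' → Rel K V (add s t) (add s' t')
  | smul_congr (r : K) {s s'} : Rel K V s s' → Rel K V (smul r s) (smul r s')
  | star_congr {s s' t t'} : Rel K V s s' → Rel K V t t' → Rel K V (star s t) (star s' t')
  | dot_congr {s s' t t'} : Rel K V s s' → Rel K V t t' → Rel K V (dot s t) (dot s' t')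
  | add_assoc (s t r) : Rel K V (add (add s t) r) (add s (add t r))
  | add_comm (s t) : Rel K V (add s t) (add t s)
  | zero_add (s) : Rel K V (add zero s) s
  | zero_smul (s) : Rel K V (smul 0 s) zero
  | one_smul (s) : Rel K V (smul 1 s) s
  | mul_smul (r r' : K) (s) : Rel K V (smul (r * r') s) (smul r (smul r' s))
  | add_smul (r r' : K) (s) : Rel K V (smul (r + r') s) (add (smul r s) (smul r' s))
  | smul_add (r : K) (s t) : Rel K V (smul r (add s t)) (add (smul r s) (smul r t))
  | of_add (x y : V) : Rel K V (of (x + y)) (add (of x) (of y))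
  | of_smul (r : K) (x : V) : Rel K V (of (r • x)) (smul r (of x))
  | star_add_left (s t r) : Rel K V (star (add s t) r) (add (star s r) (star t r))
  | star_add_right (s t r) : Rel K V (star r (add s t)) (add (star r s) (star r t))
  | star_smul_left (c : K) (s t) : Rel K V (star (smul c s) t) (smul c (star s t))
  | star_smul_right (c : K) (s t) : Rel K V (star s (smul c t)) (smul c (star s t))
  | dot_add_left (s t r) : Rel K V (dot (add s t) r) (add (dot s r) (dot t r))
  | dot_add_right (s t r) : Rel K V (dot r (add s t)) (add (dot r s) (dot r t))
  | dot_smul_left (c : K) (s t) : Rel K V (dot (smul c s) t) (smul c (dot s t))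
  | dot_smul_right (c : K) (s t) : Rel K V (dot s (smul c t)) (smul c (dot s t))
  | star_assoc (s t r) : Rel K V (star (star s t) r) (star s (star t r))
  | dot_assoc (s t r) : Rel K V (dot (dot s t) r) (dot s (dot t r))
  | one_star (s) : Rel K V (star one s) s
  | star_one (s) : Rel K V (star s one) s
  | one_dot (s) : Rel K V (dot one s) s
  | dot_one (s) : Rel K V (dot s one) s

/-- The setoid of the congruence. -/
def setoid (K : Type u) (V : Type v) [Field K] [AddCommGroup V] [Module K V] :
    Setoid (PreTwoAssoc K V) :=
  ⟨Rel K V, ⟨Rel.refl, Rel.symm, Rel.trans⟩⟩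

/-- Evaluation of formal expressions in a 2-associative algebra. -/
def eval {K : Type u} {V : Type v} [Field K] [AddCommGroup V] [Module K V]
    {A : Type w} [AddCommGroup A] [Module K A] [TwoAssocAlgebra K A] (f : V →ₗ[K] A) :
    PreTwoAssoc K V → A
  | of x => f x
  | zero => 0
  | one => TwoAssocAlgebra.one K
  | add s t => s.eval f + t.eval f
  | smul r t => r • t.eval f
  | star s t => TwoAssocAlgebra.star (K := K) (s.eval f) (t.eval f)
  | dot s t => TwoAssocAlgebra.dot (K := K) (s.eval f) (t.eval f)

theorem eval_eq {K : Type u} {V : Type v} [Field K] [AddCommGroup V] [Module K V]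
    {A : Type w} [AddCommGroup A] [Module K A] [TwoAssocAlgebra K A] (f : V →ₗ[K] A)
    {s t : PreTwoAssoc K V} (h : Rel K V s t) : s.eval f = t.eval f := by
  induction h with
  | refl => rfl
  | symm _ ih => exact ih.symm
  | trans _ _ ih ih' => exact ih.trans ih'
  | add_congr _ _ ih ih' => simp only [eval, ih, ih']
  | smul_congr _ _ ih => simp only [eval, ih]
  | star_congr _ _ ih ih' => simp only [eval, ih, ih']
  | dot_congr _ _ ih ih' => simp only [eval, ih, ih']
  | add_assoc => simp only [eval, _root_.add_assoc]
  | add_comm => simp only [eval, _root_.add_comm]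
  | zero_add => simp only [eval, _root_.zero_add]
  | zero_smul => simp only [eval, _root_.zero_smul]
  | one_smul => simp only [eval, _root_.one_smul]
  | mul_smul => simp only [eval, SemigroupAction.mul_smul]
  | add_smul => simp only [eval, _root_.add_smul]
  | smul_add => simp only [eval, _root_.smul_add]
  | of_add => simp only [eval, map_add]
  | of_smul => simp only [eval, map_smul]
  | star_add_left => simp only [eval, map_add, LinearMap.add_apply]
  | star_add_right => simp only [eval, map_add]
  | star_smul_left => simp only [eval, map_smul, LinearMap.smul_apply]
  | star_smul_right => simp only [eval, map_smul]
  | dot_add_left => simp only [eval, map_add, LinearMap.add_apply]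
  | dot_add_right => simp only [eval, map_add]
  | dot_smul_left => simp only [eval, map_smul, LinearMap.smul_apply]
  | dot_smul_right => simp only [eval, map_smul]
  | star_assoc => simp only [eval, TwoAssocAlgebra.star_assoc]
  | dot_assoc => simp only [eval, TwoAssocAlgebra.dot_assoc]
  | one_star => simp only [eval, TwoAssocAlgebra.one_star]
  | star_one => simp only [eval, TwoAssocAlgebra.star_one]
  | one_dot => simp only [eval, TwoAssocAlgebra.one_dot]
  | dot_one => simp only [eval, TwoAssocAlgebra.dot_one]

end PreTwoAssoc

/-- The free 2-associative algebra `2as(V)` on the vector space `V`. Its universal property is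
`FreeTwoAssoc.existsUnique_lift`. -/
def FreeTwoAssoc (K : Type u) (V : Type v) [Field K] [AddCommGroup V] [Module K V] :
    Type (max u v) :=
  Quotient (PreTwoAssoc.setoid K V)

namespace FreeTwoAssoc

section

variable {K : Type u} {V : Type v} [Field K] [AddCommGroup V] [Module K V]

/-- The class of an expression. -/
def mk (t : PreTwoAssoc K V) : FreeTwoAssoc K V := Quotient.mk (PreTwoAssoc.setoid K V) t

theorem mk_eq {s t : PreTwoAssoc K V} (h : PreTwoAssoc.Rel K V s t) : mk s = mk t :=
  Quotient.sound h

instance : Add (FreeTwoAssoc K V) where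
  add := Quotient.map₂ PreTwoAssoc.add fun _ _ h _ _ h' => PreTwoAssoc.Rel.add_congr h h'

instance : Zero (FreeTwoAssoc K V) where
  zero := mk PreTwoAssoc.zero

instance : AddCommMonoid (FreeTwoAssoc K V) where
  add_assoc := by
    rintro ⟨s⟩ ⟨t⟩ ⟨r⟩
    exact mk_eq (.add_assoc s t r)
  zero_add := by
    rintro ⟨s⟩
    exact mk_eq (.zero_add s)
  add_zero := by
    rintro ⟨s⟩
    exact mk_eq (.trans (.add_comm _ _) (.zero_add s))
  add_comm := by
    rintro ⟨s⟩ ⟨t⟩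
    exact mk_eq (.add_comm s t)
  nsmul := nsmulRec

instance : SMul K (FreeTwoAssoc K V) where
  smul r := Quotient.map (PreTwoAssoc.smul r) fun _ _ h => PreTwoAssoc.Rel.smul_congr r h

theorem mk_zero : mk (PreTwoAssoc.zero : PreTwoAssoc K V) = 0 := rfl

theorem mk_add (s t : PreTwoAssoc K V) : mk (s.add t) = mk s + mk t := rfl

theorem mk_smul (r : K) (t : PreTwoAssoc K V) : mk (t.smul r) = r • mk t := rfl

instance : Module K (FreeTwoAssoc K V) where
  one_smul := by
    rintro ⟨s⟩
    exact mk_eq (.one_smul s)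
  mul_smul := by
    rintro r r' ⟨s⟩
    exact mk_eq (.mul_smul r r' s)
  smul_zero := by
    intro r
    rw [← mk_zero, ← mk_smul]
    refine mk_eq (.trans (.smul_congr r (.symm (.zero_smul .zero))) ?_)
    refine .trans (.symm (.mul_smul r 0 _)) ?_
    rw [mul_zero]
    exact .zero_smul _
  smul_add := by
    rintro r ⟨s⟩ ⟨t⟩
    exact mk_eq (.smul_add r s t)
  add_smul := by
    rintro r r' ⟨s⟩
    exact mk_eq (.add_smul r r' s)
  zero_smul := by
    rintro ⟨s⟩
    exact mk_eq (.zero_smul s)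

instance : AddCommGroup (FreeTwoAssoc K V) := Module.addCommMonoidToAddCommGroup K

instance : TwoAssocAlgebra K (FreeTwoAssoc K V) where
  one := mk .one
  star := LinearMap.mk₂ K
    (Quotient.map₂ PreTwoAssoc.star fun _ _ h _ _ h' => PreTwoAssoc.Rel.star_congr h h')
    (by
      rintro ⟨s⟩ ⟨t⟩ ⟨r⟩
      exact mk_eq (.star_add_left s t r))
    (by
      rintro c ⟨s⟩ ⟨t⟩
      exact mk_eq (.star_smul_left c s t))
    (by
      rintro ⟨r⟩ ⟨s⟩ ⟨t⟩
      exact mk_eq (.star_add_right s t r))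
    (by
      rintro c ⟨s⟩ ⟨t⟩
      exact mk_eq (.star_smul_right c s t))
  dot := LinearMap.mk₂ K
    (Quotient.map₂ PreTwoAssoc.dot fun _ _ h _ _ h' => PreTwoAssoc.Rel.dot_congr h h')
    (by
      rintro ⟨s⟩ ⟨t⟩ ⟨r⟩
      exact mk_eq (.dot_add_left s t r))
    (by
      rintro c ⟨s⟩ ⟨t⟩
      exact mk_eq (.dot_smul_left c s t))
    (by
      rintro ⟨r⟩ ⟨s⟩ ⟨t⟩
      exact mk_eq (.dot_add_right s t r))
    (by
      rintro c ⟨s⟩ ⟨t⟩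
      exact mk_eq (.dot_smul_right c s t))
  star_assoc := by
    rintro ⟨s⟩ ⟨t⟩ ⟨r⟩
    exact mk_eq (.star_assoc s t r)
  dot_assoc := by
    rintro ⟨s⟩ ⟨t⟩ ⟨r⟩
    exact mk_eq (.dot_assoc s t r)
  one_star := by
    rintro ⟨s⟩
    exact mk_eq (.one_star s)
  star_one := by
    rintro ⟨s⟩
    exact mk_eq (.star_one s)
  one_dot := by
    rintro ⟨s⟩
    exact mk_eq (.one_dot s)
  dot_one := by
    rintro ⟨s⟩
    exact mk_eq (.dot_one s)

/-- The inclusion of generators. -/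
def ι (K : Type u) {V : Type v} [Field K] [AddCommGroup V] [Module K V] :
    V →ₗ[K] FreeTwoAssoc K V where
  toFun x := mk (.of x)
  map_add' x y := mk_eq (.of_add x y)
  map_smul' r x := mk_eq (.of_smul r x)

variable {A : Type w} [AddCommGroup A] [Module K A] [TwoAssocAlgebra K A]

/-- The morphism of 2-associative algebras on `2as(V)` that extends a linear map. -/
def lift (f : V →ₗ[K] A) : FreeTwoAssoc K V →ₗ[K] A where
  toFun := Quotient.lift (PreTwoAssoc.eval f) fun _ _ h => PreTwoAssoc.eval_eq f h
  map_add' := by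
    rintro ⟨s⟩ ⟨t⟩
    rfl
  map_smul' := by
    rintro r ⟨s⟩
    rfl

theorem lift_ι (f : V →ₗ[K] A) (x : V) : lift f (ι K x) = f x := rfl

theorem lift_one (f : V →ₗ[K] A) :
    lift f (TwoAssocAlgebra.one K) = TwoAssocAlgebra.one K := rfl

theorem lift_star (f : V →ₗ[K] A) (x y : FreeTwoAssoc K V) :
    lift f (TwoAssocAlgebra.star (K := K) x y) =
      TwoAssocAlgebra.star (K := K) (lift f x) (lift f y) := by
  rcases x with ⟨s⟩
  rcases y with ⟨t⟩
  rfl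

theorem lift_dot (f : V →ₗ[K] A) (x y : FreeTwoAssoc K V) :
    lift f (TwoAssocAlgebra.dot (K := K) x y) =
      TwoAssocAlgebra.dot (K := K) (lift f x) (lift f y) := by
  rcases x with ⟨s⟩
  rcases y with ⟨t⟩
  rfl

/-- The universal property of the free 2-associative algebra. -/
theorem existsUnique_lift (f : V →ₗ[K] A) :
    ∃! F : FreeTwoAssoc K V →ₗ[K] A,
      F (TwoAssocAlgebra.one K) = TwoAssocAlgebra.one K ∧
      (∀ x y, F (TwoAssocAlgebra.star (K := K) x y) =
        TwoAssocAlgebra.star (K := K) (F x) (F y)) ∧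
      (∀ x y, F (TwoAssocAlgebra.dot (K := K) x y) =
        TwoAssocAlgebra.dot (K := K) (F x) (F y)) ∧
      ∀ x, F (ι K x) = f x := by
  refine ⟨lift f, ⟨lift_one f, lift_star f, lift_dot f, lift_ι f⟩, ?_⟩
  rintro F ⟨h1, hs, hd, h'⟩
  ext x
  rcases x with ⟨t⟩
  change F (mk t) = t.eval f
  induction t with
  | of x => exact h' x
  | zero => exact map_zero F
  | one => exact h1
  | add s t ih ih' => rw [mk_add, map_add, ih, ih', PreTwoAssoc.eval]
  | smul r t ih => rw [mk_smul, map_smul, ih, PreTwoAssoc.eval]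
  | star s t ih ih' =>
    rw [PreTwoAssoc.eval, ← ih, ← ih']
    exact hs (mk s) (mk t)
  | dot s t ih ih' =>
    rw [PreTwoAssoc.eval, ← ih, ← ih']
    exact hd (mk s) (mk t)

end

end FreeTwoAssoc

/-! ## The coproduct of the free 2-associative algebra -/

section

variable (K : Type u) (A : Type v) [Field K] [AddCommGroup A] [Module K A] [TwoAssocAlgebra K A]

/-- The product `*` of `A ⊗ A`: `(a ⊗ b) * (a' ⊗ b') = (a * a') ⊗ (b * b')`. -/
noncomputable def tensorStar : A ⊗[K] A →ₗ[K] A ⊗[K] A →ₗ[K] A ⊗[K] A :=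
  TensorProduct.map₂ TwoAssocAlgebra.star TwoAssocAlgebra.star

/-- The product `·` of `A ⊗ A`: `(a ⊗ b) · (a' ⊗ b') = (a · a') ⊗ (b · b')`. -/
noncomputable def tensorDot : A ⊗[K] A →ₗ[K] A ⊗[K] A →ₗ[K] A ⊗[K] A :=
  TensorProduct.map₂ TwoAssocAlgebra.dot TwoAssocAlgebra.dot

variable {K A}

theorem tensorStar_tmul (a b c d : A) :
    tensorStar K A (a ⊗ₜ b) (c ⊗ₜ d) =
      TwoAssocAlgebra.star (K := K) a c ⊗ₜ TwoAssocAlgebra.star (K := K) b d := rfl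

theorem tensorDot_tmul (a b c d : A) :
    tensorDot K A (a ⊗ₜ b) (c ⊗ₜ d) =
      TwoAssocAlgebra.dot (K := K) a c ⊗ₜ TwoAssocAlgebra.dot (K := K) b d := rfl

theorem tensorStar_assoc (X Y Z : A ⊗[K] A) :
    tensorStar K A (tensorStar K A X Y) Z = tensorStar K A X (tensorStar K A Y Z) := by
  induction X with
  | zero => simp
  | add X X' h h' => simp only [map_add, LinearMap.add_apply, h, h']
  | tmul a b =>
    induction Y with
    | zero => simp
    | add X X' h h' => simp only [map_add, LinearMap.add_apply, h, h']
    | tmul c d =>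
      induction Z with
      | zero => simp
      | add X X' h h' => simp only [map_add, h, h']
      | tmul e f => simp only [tensorStar_tmul, TwoAssocAlgebra.star_assoc]

theorem tensorDot_assoc (X Y Z : A ⊗[K] A) :
    tensorDot K A (tensorDot K A X Y) Z = tensorDot K A X (tensorDot K A Y Z) := by
  induction X with
  | zero => simp
  | add X X' h h' => simp only [map_add, LinearMap.add_apply, h, h']
  | tmul a b =>
    induction Y with
    | zero => simp
    | add X X' h h' => simp only [map_add, LinearMap.add_apply, h, h']
    | tmul c d =>
      induction Z with
      | zero => simp
      | add X X' h h' => simp only [map_add, h, h']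
      | tmul e f => simp only [tensorDot_tmul, TwoAssocAlgebra.dot_assoc]

theorem tensorStar_one_left (X : A ⊗[K] A) :
    tensorStar K A (TwoAssocAlgebra.one K ⊗ₜ TwoAssocAlgebra.one K) X = X := by
  induction X with
  | zero => simp
  | add X X' h h' => simp only [map_add, h, h']
  | tmul a b => simp only [tensorStar_tmul, TwoAssocAlgebra.one_star]

theorem tensorStar_one_right (X : A ⊗[K] A) :
    tensorStar K A X (TwoAssocAlgebra.one K ⊗ₜ TwoAssocAlgebra.one K) = X := by
  induction X with
  | zero => simp
  | add X X' h h' => simp only [map_add, LinearMap.add_apply, h, h']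
  | tmul a b => simp only [tensorStar_tmul, TwoAssocAlgebra.star_one]

theorem tensorDot_one_left (X : A ⊗[K] A) :
    tensorDot K A (TwoAssocAlgebra.one K ⊗ₜ TwoAssocAlgebra.one K) X = X := by
  induction X with
  | zero => simp
  | add X X' h h' => simp only [map_add, h, h']
  | tmul a b => simp only [tensorDot_tmul, TwoAssocAlgebra.one_dot]

theorem tensorDot_one_right (X : A ⊗[K] A) :
    tensorDot K A X (TwoAssocAlgebra.one K ⊗ₜ TwoAssocAlgebra.one K) = X := by
  induction X with
  | zero => simp
  | add X X' h h' => simp only [map_add, LinearMap.add_apply, h, h']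
  | tmul a b => simp only [tensorDot_tmul, TwoAssocAlgebra.dot_one]

variable (K A)

/-- Pairs `(x, X)` in which `X ∈ A ⊗ A` stands for a value `Δ(x)`. The two products defined on
pairs below encode the two compatibility relations between products and coproduct, so that a
coproduct on `2as(V)` is obtained from the universal property. -/
def CoproductPair : Type v := A × (A ⊗[K] A)

noncomputable instance : AddCommGroup (CoproductPair K A) :=
  inferInstanceAs (AddCommGroup (A × (A ⊗[K] A)))

noncomputable instance : Module K (CoproductPair K A) :=
  inferInstanceAs (Module K (A × (A ⊗[K] A)))

namespace CoproductPair

/-- The first component of a pair. -/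
def fst : CoproductPair K A →ₗ[K] A := LinearMap.fst K A (A ⊗[K] A)

/-- The second component of a pair. -/
def snd : CoproductPair K A →ₗ[K] A ⊗[K] A := LinearMap.snd K A (A ⊗[K] A)

variable {K A}

/-- The pair with given components. -/
def mk (x : A) (X : A ⊗[K] A) : CoproductPair K A := (x, X)

theorem fst_mk (x : A) (X : A ⊗[K] A) : fst K A (mk x X) = x := rfl

theorem snd_mk (x : A) (X : A ⊗[K] A) : snd K A (mk x X) = X := rfl

theorem ext {P Q : CoproductPair K A} (h : fst K A P = fst K A Q) (h' : snd K A P = snd K A Q) :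
    P = Q := Prod.ext h h'

/-- `(x, X) * (y, Y) = (x * y, X * Y)` and
`(x, X) · (y, Y) = (x · y, (x ⊗ 1) · Y + X · (1 ⊗ y) - x ⊗ y)`. -/
noncomputable instance : TwoAssocAlgebra K (CoproductPair K A) where
  one := mk (TwoAssocAlgebra.one K) (TwoAssocAlgebra.one K ⊗ₜ TwoAssocAlgebra.one K)
  star := LinearMap.mk₂ K
    (fun P Q => mk (TwoAssocAlgebra.star (K := K) (fst K A P) (fst K A Q))
      (tensorStar K A (snd K A P) (snd K A Q)))
    (fun P P' Q => ext (by simp [fst_mk]) (by simp [snd_mk]))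
    (fun c P Q => ext (by simp [fst_mk]) (by simp [snd_mk]))
    (fun P Q Q' => ext (by simp [fst_mk]) (by simp [snd_mk]))
    (fun c P Q => ext (by simp [fst_mk]) (by simp [snd_mk]))
  dot := LinearMap.mk₂ K
    (fun P Q => mk (TwoAssocAlgebra.dot (K := K) (fst K A P) (fst K A Q))
      (tensorDot K A (fst K A P ⊗ₜ TwoAssocAlgebra.one K) (snd K A Q) +
        tensorDot K A (snd K A P) (TwoAssocAlgebra.one K ⊗ₜ fst K A Q) -
        fst K A P ⊗ₜ fst K A Q))
    (fun P P' Q => ext (by simp [fst_mk]) (by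
      simp only [snd_mk, map_add, TensorProduct.add_tmul, LinearMap.add_apply]
      abel))
    (fun c P Q => ext (by simp [fst_mk]) (by
      simp only [snd_mk, map_smul, ← TensorProduct.smul_tmul', LinearMap.smul_apply, smul_add,
        smul_sub]))
    (fun P Q Q' => ext (by simp [fst_mk]) (by
      simp only [snd_mk, map_add, TensorProduct.tmul_add]
      abel))
    (fun c P Q => ext (by simp [fst_mk]) (by
      simp only [snd_mk, map_smul, TensorProduct.tmul_smul, smul_add, smul_sub]))
  star_assoc P Q S := ext
    (by simp only [LinearMap.mk₂_apply, fst_mk, TwoAssocAlgebra.star_assoc])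
    (by simp only [LinearMap.mk₂_apply, snd_mk, tensorStar_assoc])
  dot_assoc P Q S := ext
    (by simp only [LinearMap.mk₂_apply, fst_mk, TwoAssocAlgebra.dot_assoc])
    (by
      have h1 : ∀ (x y : A) (Z : A ⊗[K] A),
          tensorDot K A (TwoAssocAlgebra.dot (K := K) x y ⊗ₜ TwoAssocAlgebra.one K) Z =
            tensorDot K A (x ⊗ₜ TwoAssocAlgebra.one K)
              (tensorDot K A (y ⊗ₜ TwoAssocAlgebra.one K) Z) := fun x y Z => by
        rw [← tensorDot_assoc, tensorDot_tmul, TwoAssocAlgebra.dot_one]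
      simp only [LinearMap.mk₂_apply, fst_mk, snd_mk, h1, map_add, map_sub,
        LinearMap.add_apply, LinearMap.sub_apply, tensorDot_assoc, tensorDot_tmul,
        TwoAssocAlgebra.one_dot, TwoAssocAlgebra.dot_one]
      abel)
  one_star P := ext (by simp only [LinearMap.mk₂_apply, fst_mk, TwoAssocAlgebra.one_star])
    (by simp only [LinearMap.mk₂_apply, snd_mk, tensorStar_one_left])
  star_one P := ext (by simp only [LinearMap.mk₂_apply, fst_mk, TwoAssocAlgebra.star_one])
    (by simp only [LinearMap.mk₂_apply, snd_mk, tensorStar_one_right])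
  one_dot P := ext (by simp only [LinearMap.mk₂_apply, fst_mk, TwoAssocAlgebra.one_dot])
    (by
      simp only [LinearMap.mk₂_apply, fst_mk, snd_mk, tensorDot_one_left, tensorDot_tmul,
        TwoAssocAlgebra.one_dot, add_sub_cancel_right])
  dot_one P := ext (by simp only [LinearMap.mk₂_apply, fst_mk, TwoAssocAlgebra.dot_one])
    (by
      simp only [LinearMap.mk₂_apply, fst_mk, snd_mk, tensorDot_one_right,
        TwoAssocAlgebra.dot_one, add_sub_cancel_left])

end CoproductPair

end

namespace FreeTwoAssoc

section

variable {K : Type u} {V : Type v} [Field K] [AddCommGroup V] [Module K V]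

/-- The linear map `v ↦ (v, v ⊗ 1 + 1 ⊗ v)`. -/
noncomputable def primitivePair (K : Type u) (V : Type v) [Field K] [AddCommGroup V]
    [Module K V] : V →ₗ[K] CoproductPair K (FreeTwoAssoc K V) :=
  (LinearMap.prod LinearMap.id
    ((TensorProduct.mk K _ _).flip (TwoAssocAlgebra.one K) +
      TensorProduct.mk K _ _ (TwoAssocAlgebra.one K))) ∘ₗ ι K

/-- The coproduct `Δ` of `2as(V)`: the linear map determined by `Δ(1) = 1 ⊗ 1`,
`Δ(v) = v ⊗ 1 + 1 ⊗ v` for `v ∈ V`, `Δ(x * y) = Δ(x) * Δ(y)` and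
`Δ(x · y) = (x ⊗ 1) · Δ(y) + Δ(x) · (1 ⊗ y) - x ⊗ y`; see the four lemmas below. -/
noncomputable def comul (K : Type u) (V : Type v) [Field K] [AddCommGroup V] [Module K V] :
    FreeTwoAssoc K V →ₗ[K] FreeTwoAssoc K V ⊗[K] FreeTwoAssoc K V :=
  CoproductPair.snd K (FreeTwoAssoc K V) ∘ₗ lift (primitivePair K V)

theorem fst_lift_primitivePair (x : FreeTwoAssoc K V) :
    CoproductPair.fst K _ (lift (primitivePair K V) x) = x := by
  have h := (existsUnique_lift (ι K : V →ₗ[K] FreeTwoAssoc K V)).unique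
    (y₁ := CoproductPair.fst K _ ∘ₗ lift (primitivePair K V)) (y₂ := LinearMap.id)
    ⟨rfl, fun x y => by rw [LinearMap.comp_apply, lift_star]; rfl,
      fun x y => by rw [LinearMap.comp_apply, lift_dot]; rfl, fun _ => rfl⟩
    ⟨rfl, fun _ _ => rfl, fun _ _ => rfl, fun _ => rfl⟩
  exact LinearMap.congr_fun h x

theorem comul_one : comul K V (TwoAssocAlgebra.one K) =
    TwoAssocAlgebra.one K ⊗ₜ TwoAssocAlgebra.one K := rfl

theorem comul_ι (x : V) : comul K V (ι K x) =
    ι K x ⊗ₜ TwoAssocAlgebra.one K + TwoAssocAlgebra.one K ⊗ₜ ι K x := rfl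

theorem comul_star (x y : FreeTwoAssoc K V) :
    comul K V (TwoAssocAlgebra.star (K := K) x y) =
      tensorStar K _ (comul K V x) (comul K V y) := by
  rw [comul, LinearMap.comp_apply, lift_star]
  rfl

theorem comul_dot (x y : FreeTwoAssoc K V) :
    comul K V (TwoAssocAlgebra.dot (K := K) x y) =
      tensorDot K _ (x ⊗ₜ TwoAssocAlgebra.one K) (comul K V y) +
        tensorDot K _ (comul K V x) (TwoAssocAlgebra.one K ⊗ₜ y) - x ⊗ₜ y := by
  have h : comul K V (TwoAssocAlgebra.dot (K := K) x y) =
      tensorDot K _ (CoproductPair.fst K _ (lift (primitivePair K V) x) ⊗ₜ TwoAssocAlgebra.one K)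
          (comul K V y) +
        tensorDot K _ (comul K V x)
          (TwoAssocAlgebra.one K ⊗ₜ CoproductPair.fst K _ (lift (primitivePair K V) y)) -
        CoproductPair.fst K _ (lift (primitivePair K V) x) ⊗ₜ
          CoproductPair.fst K _ (lift (primitivePair K V) y) := by
    rw [comul, LinearMap.comp_apply, lift_dot]
    rfl
  rwa [fst_lift_primitivePair, fst_lift_primitivePair] at h

/-- The counit `c` of `2as(V)`: the multiplicative linear form that vanishes on `V`. -/
def counit (K : Type u) (V : Type v) [Field K] [AddCommGroup V] [Module K V] :
    FreeTwoAssoc K V →ₗ[K] K :=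
  lift 0

/-- The map `J = Id - u c`. -/
def augmentation (K : Type u) (V : Type v) [Field K] [AddCommGroup V] [Module K V] :
    FreeTwoAssoc K V →ₗ[K] FreeTwoAssoc K V :=
  LinearMap.id - (counit K V).smulRight (TwoAssocAlgebra.one K)

/-- The convolution `f ⋆ g = · ∘ (f ⊗ g) ∘ Δ` with respect to the product `·`. -/
noncomputable def conv (f g : FreeTwoAssoc K V →ₗ[K] FreeTwoAssoc K V) :
    FreeTwoAssoc K V →ₗ[K] FreeTwoAssoc K V :=
  TensorProduct.lift TwoAssocAlgebra.dot ∘ₗ TensorProduct.map f g ∘ₗ comul K V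

/-- `convPow f n` is the convolution power `f^{⋆(n+1)}`. -/
noncomputable def convPow (f : FreeTwoAssoc K V →ₗ[K] FreeTwoAssoc K V) :
    ℕ → FreeTwoAssoc K V →ₗ[K] FreeTwoAssoc K V
  | 0 => f
  | n + 1 => conv f (convPow f n)

/-- The idempotent `e = J - J ⋆ J + ⋯ + (-1)^{n-1} J^{⋆n} + ⋯` of `2as(V)`; the sum is pointwise
finite. -/
noncomputable def e (x : FreeTwoAssoc K V) : FreeTwoAssoc K V :=
  ∑ᶠ n : ℕ, (-1 : K) ^ n • convPow (augmentation K V) n x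

end

end FreeTwoAssoc

/-! ## Decorated trees -/

/-- The iterated product `(a_1, …, a_n) ↦ a_1 · ⋯ · a_n` of a bilinear product with a unit; the
value for `n = 0` is the unit. -/
def iterProd {K : Type u} {A : Type v} [Field K] [AddCommGroup A] [Module K A]
    (μ : A →ₗ[K] A →ₗ[K] A) (unit : A) : (n : ℕ) → MultilinearMap K (fun _ : Fin n => A) A
  | 0 => MultilinearMap.constOfIsEmpty K (fun _ : Fin 0 => A) unit
  | n + 1 => LinearMap.uncurryLeft (M := fun _ : Fin (n + 1) => A)
      { toFun := fun x => (μ x).compMultilinearMap (iterProd μ unit n)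
        map_add' := fun x y => by
          ext
          simp
        map_smul' := fun r x => by
          ext
          simp }

theorem iterProd_zero {K : Type u} {A : Type v} [Field K] [AddCommGroup A] [Module K A]
    (μ : A →ₗ[K] A →ₗ[K] A) (unit : A) (a : Fin 0 → A) : iterProd μ unit 0 a = unit := rfl

theorem iterProd_succ {K : Type u} {A : Type v} [Field K] [AddCommGroup A] [Module K A]
    (μ : A →ₗ[K] A →ₗ[K] A) (unit : A) (n : ℕ) (a : Fin (n + 1) → A) :
    iterProd μ unit (n + 1) a = μ (a 0) (iterProd μ unit n fun i => a i.succ) := rfl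

namespace PlanarTree

section

variable {K : Type u} {V : Type v} [Field K] [AddCommGroup V] [Module K V]

/-- The elements `t^*` (for `b = true`) and `t^•` (for `b = false`) of `2as(V)` attached to a tree
`t` with leaves decorated by elements of `V`. If `t = t_1 ∨ ⋯ ∨ t_k` then
`t^* = t_1^• * ⋯ * t_k^•` and `t^• = t_1^* · ⋯ · t_k^*`, where the leaves of `t_1`, …, `t_k`
are, in this order, the leaves of `t`; both are `v` for the trivial tree decorated by `v`. -/
noncomputable def toFree : (t : PlanarTree) → Bool →
    MultilinearMap K (fun _ : Fin t.leaves => V) (FreeTwoAssoc K V)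
  | leaf, _ => MultilinearMap.ofSubsingleton K V (FreeTwoAssoc K V) (0 : Fin 1) (FreeTwoAssoc.ι K)
  | node k c, b =>
    ((iterProd (if b then TwoAssocAlgebra.star else TwoAssocAlgebra.dot)
      (TwoAssocAlgebra.one K) (k + 2)).compMultilinearMap
        fun i => toFree (c i) (!b)).domDomCongr finSigmaFinEquiv

theorem toFree_leaf (b : Bool) (x : Fin 1 → V) :
    (leaf.toFree b : MultilinearMap K _ _) x = FreeTwoAssoc.ι K (x 0) := rfl

theorem toFree_node (k : ℕ) (c : Fin (k + 2) → PlanarTree) (b : Bool)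
    (x : Fin (∑ i, (c i).leaves) → V) :
    ((node k c).toFree b : MultilinearMap K _ _) x =
      iterProd (K := K) (if b then TwoAssocAlgebra.star else TwoAssocAlgebra.dot)
        (TwoAssocAlgebra.one K) (k + 2)
        fun i => (c i).toFree (!b) fun s => x (finSigmaFinEquiv ⟨i, s⟩) := rfl

end

end PlanarTree

/-- The space `⊕_n K[PT_n] ⊗ V^{⊗n}` spanned by `V`-decorated trees. The summand for `n = 0`
vanishes since `PT 0` is empty. -/
abbrev TreeModule (K : Type u) (V : Type v) [Field K] [AddCommGroup V] [Module K V] :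
    Type (max u v) :=
  ⨁ n : ℕ, (PT n →₀ K) ⊗[K] (⨂[K]^n V)

namespace TreeModule

section

variable {K : Type u} {V : Type v} [Field K] [AddCommGroup V] [Module K V]

/-- The decorated tree `(t; v_1 … v_n)`. -/
noncomputable def dec (K : Type u) {V : Type v} [Field K] [AddCommGroup V] [Module K V] {n : ℕ}
    (t : PT n) (x : Fin n → V) : TreeModule K V :=
  DirectSum.lof K ℕ (fun n => (PT n →₀ K) ⊗[K] (⨂[K]^n V)) n
    (Finsupp.single t 1 ⊗ₜ[K] PiTensorProduct.tprod K x)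

/-- The linear map `t ↦ t^*` from decorated trees to `2as(V)`; its image is the `*`-component
of `2as(V)`. -/
noncomputable def star (K : Type u) (V : Type v) [Field K] [AddCommGroup V] [Module K V] :
    TreeModule K V →ₗ[K] FreeTwoAssoc K V :=
  DirectSum.toModule K ℕ (FreeTwoAssoc K V) fun n =>
    TensorProduct.lift (Finsupp.linearCombination K fun t : PT n =>
      PiTensorProduct.lift ((t.1.toFree true).domDomCongr (finCongr t.2)))

end

end TreeModule

/-! The engine is a fixed point principle. If `C` is a conilpotent coalgebra and `A` an algebra, an
equation `Y = Z + φ ⋆ Y` in the convolution algebra `Hom(C, A)`, with `φ` zero on the distinguished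
element of `C`, has at most one solution (`IsConilpotent.eq_of_eq_add_mul`); for `Z = 1` the
geometric series of `φ` is a solution. Most identities between morphisms below are proved by showing
that both sides solve the same equation.

The principle is first used to invert the identity of a conilpotent unital infinitesimal bialgebra.
With `e = 1 - Id⁻¹` one has `Id = 1 + e ⋆ Id`. The values of `e` are primitive, `e` commutes with
morphisms of bialgebras, and `e(xy) = c(x) e(y)` if `c(y) = 0`; in particular `e` kills products of
two elements of the augmentation ideal.

Next, a map `φ : C → R` with `φ u = 0` extends to a unique morphism of coalgebras from `C` to the
tensor algebra `T(R)` with deconcatenation. Operations `M_{pq}` on `R` amount to a map `T(R) ⊗ T(R)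
→ R`, so they cogenerate a product `*` on `T(R)`. The relations of a `B∞`-algebra say that the two
ways to multiply three words have the same projection to `R`, that is, that `*` is associative. Thus
`T(R)` is a 2-associative algebra.

The combinatorial ingredient is a basis of `2as(V)`: lists of trees decorated by a basis of `V`,
where `*` is concatenation and `·` is concatenation conjugated by the involution `regroup`. Hence
`2as(V)` is the direct sum of the line of `1`, of the span of the `t^*`, and of the span of the
products `t_1^* · … · t_k^*` with `k ≥ 2`. The projection `π` (`part`) onto the middle summand
satisfies `π e = π`, and `e(π(x)^*) = e(x)`.

Let `E` be the algebra morphism from the tensor algebra of the space of trees to `2as(V)` with `E(s)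
= e(s^*)`. The operations on trees are `M_{pq}(a, b) = π(E(a) * E(b))`. The fixed point principle
shows that `E` carries the cogenerated product to the product `*` of `2as(V)` (`idemStar_starHom`),
whose associativity gives the `B∞`-relations. For `p, q ≥ 1` the element `E(a) * E(b)` already lies
in the middle summand, which gives the asserted formula (`star_M`).

Freeness: let `F` be the free `B∞`-algebra on `V`. Its canonical morphism to trees is onto because
the image of `T(F)` in `2as(V)` is closed under both products and contains `V`. It is injective
because the composite of `s ↦ s^*`, of `2as(V) → T(F)` and of the projection to `F` is a left
inverse.

For the operad, take `V = K^n`. The isomorphism respects the grading by multisets of labels, hence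
identifies the multilinear parts. Its naturality in `V` then gives the values of the operations on
arbitrary vectors and the equivariance. -/

open Coalgebra WithConv

/-! ## Convolution on conilpotent coalgebras -/

section Grading

variable {K : Type*} [Field K]

/-- The family of subspaces of `A ⊗ B` spanned by the products of subspaces of `A` and `B`
of complementary degrees. -/
def tensorGrading {G A B : Type*} [AddCommMonoid G] [AddCommGroup A] [Module K A]
    [AddCommGroup B] [Module K B] (C : G → Submodule K A) (D : G → Submodule K B) (g : G) :
    Submodule K (A ⊗[K] B) :=
  Submodule.span K {x | ∃ i j, i + j = g ∧ ∃ a ∈ C i, ∃ b ∈ D j, x = a ⊗ₜ[K] b}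

section

variable {G A B : Type*} [AddCommMonoid G] [AddCommGroup A] [Module K A]
  [AddCommGroup B] [Module K B] {C : G → Submodule K A} {D : G → Submodule K B}

theorem tmul_mem_tensorGrading {i j g : G} (h : i + j = g) {a : A} (ha : a ∈ C i) {b : B}
    (hb : b ∈ D j) : a ⊗ₜ[K] b ∈ tensorGrading C D g :=
  Submodule.subset_span ⟨i, j, h, a, ha, b, hb, rfl⟩

theorem tensorGrading_le {g : G} {S : Submodule K (A ⊗[K] B)}
    (h : ∀ i j, i + j = g → ∀ a ∈ C i, ∀ b ∈ D j, a ⊗ₜ[K] b ∈ S) : tensorGrading C D g ≤ S :=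
  Submodule.span_le.2 fun _ ⟨i, j, hij, a, ha, b, hb, hx⟩ => hx ▸ h i j hij a ha b hb

theorem iSup_tensorGrading (hC : ⨆ g, C g = ⊤) (hD : ⨆ g, D g = ⊤) :
    ⨆ g, tensorGrading C D g = ⊤ := by
  rw [eq_top_iff]
  rintro x -
  induction x with
  | zero => exact zero_mem _
  | add x y hx hy => exact add_mem hx hy
  | tmul a b =>
    have ha : a ∈ ⨆ g, C g := hC ▸ Submodule.mem_top
    have hb : b ∈ ⨆ g, D g := hD ▸ Submodule.mem_top
    induction ha using Submodule.iSup_induction' with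
    | zero => simp
    | add x y _ _ hx hy => rw [TensorProduct.add_tmul]; exact add_mem hx hy
    | mem i a ha =>
      induction hb using Submodule.iSup_induction' with
      | zero => simp
      | add x y _ _ hx hy => rw [TensorProduct.tmul_add]; exact add_mem hx hy
      | mem j b hb => exact Submodule.mem_iSup_of_mem _ (tmul_mem_tensorGrading rfl ha hb)

end

/-- A coalgebra is conilpotent with respect to `u` if it is the sum of subspaces `F 0, F 1, …`
compatible with the coproduct such that `F 0` is contained in the line spanned by `u`. -/
def IsConilpotent (K : Type*) {C : Type*} [Field K] [AddCommGroup C] [Module K C] [Coalgebra K C]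
    (u : C) : Prop :=
  ∃ F : ℕ → Submodule K C, ⨆ n, F n = ⊤ ∧
    (∀ n, ∀ x ∈ F n, comul (R := K) x ∈ tensorGrading F F n) ∧ F 0 ≤ K ∙ u

/-- The total degree works: degree `0` is a sum of two natural numbers only as `0 + 0`. Products on
tensor algebras are maps out of `T ⊗ T`, and their associativity concerns maps out of `(T ⊗ T) ⊗ T`,
so conilpotence is needed there too. -/
theorem IsConilpotent.tmul {C D : Type*} [AddCommGroup C] [Module K C] [Coalgebra K C]
    [AddCommGroup D] [Module K D] [Coalgebra K D] {u : C} {v : D} (hu : IsConilpotent K u)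
    (hv : IsConilpotent K v) : IsConilpotent K (u ⊗ₜ[K] v) := by
  obtain ⟨F, hF, hFc, hF0⟩ := hu
  obtain ⟨F', hF', hFc', hF0'⟩ := hv
  refine ⟨tensorGrading F F', iSup_tensorGrading hF hF', fun n => ?_, ?_⟩
  · change tensorGrading F F' n ≤ (tensorGrading (tensorGrading F F') (tensorGrading F F') n).comap
      (comul (R := K))
    refine tensorGrading_le fun i j hij a ha b hb => ?_
    rw [Submodule.mem_comap, TensorProduct.comul_tmul]
    have h1 := hFc i a ha
    have h2 := hFc' j b hb
    generalize comul (R := K) a = X at h1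
    generalize comul (R := K) b = Y at h2
    induction h1 using Submodule.span_induction with
    | zero => simp
    | add x y _ _ hx hy => rw [TensorProduct.add_tmul, map_add]; exact add_mem hx hy
    | smul c x _ hx => rw [← TensorProduct.smul_tmul', map_smul]; exact Submodule.smul_mem _ _ hx
    | mem x hx =>
      obtain ⟨i1, i2, rfl, a1, ha1, a2, ha2, rfl⟩ := hx
      induction h2 using Submodule.span_induction with
      | zero => simp
      | add x y _ _ hx hy => rw [TensorProduct.tmul_add, map_add]; exact add_mem hx hy
      | smul c x _ hx => rw [TensorProduct.tmul_smul, map_smul]; exact Submodule.smul_mem _ _ hx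
      | mem x hx =>
        obtain ⟨j1, j2, rfl, b1, hb1, b2, hb2, rfl⟩ := hx
        exact tmul_mem_tensorGrading (i := i1 + j1) (j := i2 + j2) (by omega)
          (tmul_mem_tensorGrading rfl ha1 hb1) (tmul_mem_tensorGrading rfl ha2 hb2)
  · refine tensorGrading_le fun i j hij a ha b hb => ?_
    obtain ⟨rfl, rfl⟩ : i = 0 ∧ j = 0 := by omega
    obtain ⟨c, rfl⟩ := Submodule.mem_span_singleton.1 (hF0 ha)
    obtain ⟨d, rfl⟩ := Submodule.mem_span_singleton.1 (hF0' hb)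
    rw [TensorProduct.smul_tmul_smul]
    exact Submodule.smul_mem _ _ (Submodule.mem_span_singleton_self _)

end Grading

/-! ### Geometric series and fixed point equations in convolution algebras -/

section Convolution

variable {K : Type*} [Field K] {C : Type*} [AddCommGroup C] [Module K C] [Coalgebra K C]
variable {A : Type*} [Ring A] [Algebra K A]

theorem conv_apply_of_comul_eq_tmul {f g : WithConv (C →ₗ[K] A)} {x a b : C}
    (h : comul (R := K) x = a ⊗ₜ b) : (f * g) x = f a * g b := by
  rw [LinearMap.convMul_apply, h, TensorProduct.map_tmul, LinearMap.mul'_apply]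

/-- The coproduct of `x` is a combination of tensors with degrees adding up to `n`, so only those
pairs of degrees matter. All arguments by degree below go through this comparison. -/
theorem conv_apply_eq_of_mem {G : Type*} [AddCommMonoid G] {F F' : G → Submodule K C} {n : G}
    {x : C} (hx : comul (R := K) x ∈ tensorGrading F F' n) {f g f' g' : WithConv (C →ₗ[K] A)}
    (h : ∀ i j, i + j = n → ∀ a ∈ F i, ∀ b ∈ F' j, f a * g b = f' a * g' b) :
    (f * g) x = (f' * g') x := by
  rw [LinearMap.convMul_apply, LinearMap.convMul_apply]
  have : tensorGrading F F' n ≤ LinearMap.eqLocus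
      (LinearMap.mul' K A ∘ₗ TensorProduct.map f.ofConv g.ofConv)
      (LinearMap.mul' K A ∘ₗ TensorProduct.map f'.ofConv g'.ofConv) :=
    tensorGrading_le fun i j hij a ha b hb => h i j hij a ha b hb
  exact this hx

/-- The geometric series `1 + φ + φ² + ⋯` in the convolution algebra; the sum is required to be
pointwise finite. -/
noncomputable def geomConv (φ : WithConv (C →ₗ[K] A))
    (h : ∀ x, ∃ N, ∀ n, N ≤ n → (φ ^ n) x = 0) : WithConv (C →ₗ[K] A) :=
  toConv
    { toFun := fun x => ∑ᶠ n : ℕ, (φ ^ n) x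
      map_add' := fun x y => by
        have hf : ∀ x, (Function.support fun n : ℕ => (φ ^ n) x).Finite := fun x => by
          obtain ⟨N, hN⟩ := h x
          exact (Set.finite_lt_nat N).subset fun n hn => by
            by_contra h'
            exact hn (hN n (not_lt.1 h'))
        rw [← finsum_add_distrib (hf x) (hf y)]
        exact finsum_congr fun n => map_add (φ ^ n).ofConv x y
      map_smul' := fun c x => by
        rw [RingHom.id_apply, smul_finsum]
        exact finsum_congr fun n => map_smul (φ ^ n).ofConv c x }

theorem geomConv_apply {φ : WithConv (C →ₗ[K] A)}
    {h : ∀ x, ∃ N, ∀ n, N ≤ n → (φ ^ n) x = 0} {x : C} {N : ℕ}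
    (hN : ∀ n, N ≤ n → (φ ^ n) x = 0) :
    geomConv φ h x = ∑ n ∈ Finset.range N, (φ ^ n) x :=
  finsum_eq_sum_of_support_subset _ fun n hn => by
    simp only [Finset.coe_range, Set.mem_Iio]
    by_contra h'
    exact hn (hN n (not_lt.1 h'))

section

variable {F : ℕ → Submodule K C} {φ : WithConv (C →ₗ[K] A)}

/-- A factor `φ` contributes only on parts of degree at least `1`, so an element of degree `m`
cannot feed more than `m` factors. -/
theorem conv_pow_eq_zero_of_mem
    (hc : ∀ n, ∀ x ∈ F n, comul (R := K) x ∈ tensorGrading F F n)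
    (h0 : ∀ x ∈ F 0, φ x = 0) {n m : ℕ} (hmn : m < n) {x : C} (hx : x ∈ F m) :
    (φ ^ n) x = 0 := by
  induction n generalizing m x with
  | zero => omega
  | succ n ih =>
    -- Zero is written as a convolution product so that the degreewise comparison of two products
    -- applies.
    rw [pow_succ', ← show ((0 : WithConv (C →ₗ[K] A)) * 0) x = 0 by rw [zero_mul]; rfl]
    refine conv_apply_eq_of_mem (hc m x hx) fun i j hij a ha b hb => ?_
    rcases Nat.eq_zero_or_pos i with rfl | hi
    · rw [h0 a ha, zero_mul]
      exact (zero_mul _).symm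
    · rw [ih (m := j) (by omega) hb, mul_zero]
      exact (zero_mul _).symm

/-- Iteration gives `D = φ ^ (m + 1) * D`, and `φ ^ (m + 1)` vanishes on all degrees that occur in
the coproduct of an element of degree `m`. -/
theorem eq_zero_of_eq_conv_mul
    (hc : ∀ n, ∀ x ∈ F n, comul (R := K) x ∈ tensorGrading F F n)
    (h0 : ∀ x ∈ F 0, φ x = 0) (ht : ⨆ n, F n = ⊤) {D : WithConv (C →ₗ[K] A)} (hD : D = φ * D) :
    D = 0 := by
  have key : ∀ n, D = φ ^ n * D := fun n => by
    induction n with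
    | zero => rw [pow_zero, one_mul]
    | succ n ih => rw [pow_succ, mul_assoc, ← hD]; exact ih
  refine WithConv.ext (LinearMap.ext fun x => ?_)
  have hx : x ∈ ⨆ g, F g := ht ▸ Submodule.mem_top
  induction hx using Submodule.iSup_induction' with
  | zero => simp
  | add x y _ _ hx hy => rw [map_add, hx, hy, map_add]
  | mem m x hx =>
    rw [key (m + 1)]
    refine (conv_apply_eq_of_mem (f' := 0) (g' := 0) (hc m x hx) fun i j hij a ha b hb => ?_).trans
      (by rw [zero_mul])
    rw [conv_pow_eq_zero_of_mem hc h0 (by omega) ha, zero_mul]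
    exact (zero_mul _).symm

theorem exists_pow_eq_zero
    (hc : ∀ n, ∀ x ∈ F n, comul (R := K) x ∈ tensorGrading F F n)
    (h0 : ∀ x ∈ F 0, φ x = 0) (ht : ⨆ n, F n = ⊤) (x : C) : ∃ N, ∀ n, N ≤ n → (φ ^ n) x = 0 := by
  have hx : x ∈ ⨆ g, F g := ht ▸ Submodule.mem_top
  induction hx using Submodule.iSup_induction' with
  | zero => exact ⟨0, fun n _ => map_zero _⟩
  | add x y _ _ hx hy =>
    obtain ⟨N, hN⟩ := hx
    obtain ⟨N', hN'⟩ := hy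
    refine ⟨max N N', fun n hn => ?_⟩
    rw [map_add, hN n (le_of_max_le_left hn), hN' n (le_of_max_le_right hn), add_zero]
  | mem m x hx => exact ⟨m + 1, fun n hn => conv_pow_eq_zero_of_mem hc h0 hn hx⟩

theorem one_add_mul_geomConv
    (hc : ∀ n, ∀ x ∈ F n, comul (R := K) x ∈ tensorGrading F F n)
    (h0 : ∀ x ∈ F 0, φ x = 0) (ht : ⨆ n, F n = ⊤) (h) : 1 + φ * geomConv φ h = geomConv φ h := by
  refine WithConv.ext (LinearMap.ext fun x => ?_)
  have hx : x ∈ ⨆ g, F g := ht ▸ Submodule.mem_top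
  induction hx using Submodule.iSup_induction' with
  | zero => simp
  | add x y _ _ hx hy => rw [map_add, hx, hy, map_add]
  | mem m x hx =>
    have h1 : (φ * geomConv φ h) x = (φ * ∑ n ∈ Finset.range (m + 1), φ ^ n) x := by
      refine conv_apply_eq_of_mem (hc m x hx) fun i j hij a ha b hb => ?_
      rw [geomConv_apply (N := m + 1) fun n hn => conv_pow_eq_zero_of_mem hc h0 (by omega) hb]
      simp [LinearMap.sum_apply]
    change (1 : WithConv (C →ₗ[K] A)) x + (φ * geomConv φ h) x = geomConv φ h x
    -- Here the series is cut one term later than in `h1`, because multiplication by `φ` shifts it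
    -- by one; the sums then agree term by term.
    rw [h1, geomConv_apply (N := m + 1 + 1) fun n hn =>
      conv_pow_eq_zero_of_mem hc h0 (by omega) hx, Finset.mul_sum,
      Finset.sum_range_succ' _ (m + 1), add_comm, pow_zero]
    simp [LinearMap.sum_apply, pow_succ']

end

/-- The conclusion of conilpotence that is used: convolution by a linear map that kills the
distinguished element is locally nilpotent. -/
theorem IsConilpotent.pow_eq_zero {u : C} (hu : IsConilpotent K u) {φ : WithConv (C →ₗ[K] A)}
    (hφ : φ u = 0) (x : C) : ∃ N, ∀ n, N ≤ n → (φ ^ n) x = 0 := by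
  obtain ⟨F, ht, hc, h0⟩ := hu
  refine exists_pow_eq_zero hc (fun x hx => ?_) ht x
  obtain ⟨c, rfl⟩ := Submodule.mem_span_singleton.1 (h0 hx)
  rw [map_smul, hφ, smul_zero]

theorem IsConilpotent.one_add_mul_geomConv {u : C} (hu : IsConilpotent K u)
    {φ : WithConv (C →ₗ[K] A)} (hφ : φ u = 0) :
    1 + φ * geomConv φ (hu.pow_eq_zero hφ) = geomConv φ (hu.pow_eq_zero hφ) := by
  obtain ⟨F, ht, hc, h0⟩ := id hu
  refine _root_.one_add_mul_geomConv hc (fun x hx => ?_) ht _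
  obtain ⟨c, rfl⟩ := Submodule.mem_span_singleton.1 (h0 hx)
  rw [map_smul, hφ, smul_zero]

/-- The difference `D` of two solutions satisfies `D = φ * D`, hence vanishes. -/
theorem IsConilpotent.eq_of_eq_add_mul {u : C} (hu : IsConilpotent K u)
    {φ Y Y' Z : WithConv (C →ₗ[K] A)} (hφ : φ u = 0) (h : Y = Z + φ * Y)
    (h' : Y' = Z + φ * Y') : Y = Y' := by
  obtain ⟨F, ht, hc, h0⟩ := id hu
  refine sub_eq_zero.1 (eq_zero_of_eq_conv_mul hc (φ := φ) (fun x hx => ?_) ht ?_)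
  · obtain ⟨c, rfl⟩ := Submodule.mem_span_singleton.1 (h0 hx)
    rw [map_smul, hφ, smul_zero]
  · rw [mul_sub]
    nth_rw 1 [h, h']
    abel

/-- The equation of the series directly makes it a right inverse of `1 - φ`. On the other side
uniqueness is used: `geomConv φ * (1 - φ)` and `1` both solve `Y = (1 - φ) + φ * Y`. -/
theorem IsConilpotent.geomConv_mul {u : C} (hu : IsConilpotent K u)
    {φ : WithConv (C →ₗ[K] A)} (hφ : φ u = 0) :
    geomConv φ (hu.pow_eq_zero hφ) * (1 - φ) = 1 := by
  have h := hu.one_add_mul_geomConv hφ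
  refine hu.eq_of_eq_add_mul (Z := 1 - φ) hφ ?_ (by rw [mul_one]; abel)
  rw [← mul_assoc]
  nth_rw 1 [← h]
  rw [add_mul, one_mul]

theorem IsConilpotent.mul_geomConv {u : C} (hu : IsConilpotent K u)
    {φ : WithConv (C →ₗ[K] A)} (hφ : φ u = 0) :
    (1 - φ) * geomConv φ (hu.pow_eq_zero hφ) = 1 := by
  have h := hu.one_add_mul_geomConv hφ
  rw [sub_mul, one_mul]
  nth_rw 1 [← h]
  abel

end Convolution

/-! ## Infinitesimal bialgebras -/

section ConvHom

variable {K : Type*} [Field K] {C D : Type*} [AddCommGroup C] [Module K C] [Coalgebra K C]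
  [AddCommGroup D] [Module K D] [Coalgebra K D]
variable {A B : Type*} [Ring A] [Algebra K A] [Ring B] [Algebra K B]

/-- Composition with an algebra morphism, as a morphism of convolution algebras. -/
def convPost (C : Type*) [AddCommGroup C] [Module K C] [Coalgebra K C] (h : A →ₐ[K] B) :
    WithConv (C →ₗ[K] A) →+* WithConv (C →ₗ[K] B) where
  toFun f := toConv (h.toLinearMap ∘ₗ f.ofConv)
  map_zero' := WithConv.ext (LinearMap.comp_zero _)
  map_add' _ _ := WithConv.ext (LinearMap.comp_add _ _ _)
  map_one' := WithConv.ext (LinearMap.ext fun _ => h.commutes _)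
  map_mul' _ _ := WithConv.ext (LinearMap.algHom_comp_convMul_distrib h _ _)

theorem convPost_apply (h : A →ₐ[K] B) (f : WithConv (C →ₗ[K] A)) (x : C) :
    convPost C h f x = h (f x) := rfl

/-- Composition with a coalgebra morphism, as a morphism of convolution algebras. -/
def convPre (A : Type*) [Ring A] [Algebra K A] (g : D →ₗc[K] C) :
    WithConv (C →ₗ[K] A) →+* WithConv (D →ₗ[K] A) where
  toFun f := toConv (f.ofConv ∘ₗ g.toLinearMap)
  map_zero' := WithConv.ext (LinearMap.zero_comp _)
  map_add' _ _ := WithConv.ext (LinearMap.add_comp _ _ _)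
  map_one' := WithConv.ext (LinearMap.ext fun x => congrArg (algebraMap K A)
    (LinearMap.congr_fun g.counit_comp x))
  map_mul' _ _ := WithConv.ext (LinearMap.convMul_comp_coalgHom_distrib _ _ g)

theorem convPre_apply (g : D →ₗc[K] C) (f : WithConv (C →ₗ[K] A)) (x : D) :
    convPre A g f x = f (g x) := rfl

end ConvHom

/-- Conilpotent unital infinitesimal bialgebras: the coproduct of a product is
`Δ(xy) = (x ⊗ 1)Δ(y) + Δ(x)(1 ⊗ y) - x ⊗ y`. -/
class InfBialgebra (K A : Type*) [Field K] [Ring A] [Algebra K A] [Coalgebra K A] : Prop where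
  counit_one : counit (R := K) (1 : A) = 1
  counit_mul : ∀ x y : A, counit (R := K) (x * y) = counit (R := K) x * counit (R := K) y
  comul_one : comul (R := K) (1 : A) = 1 ⊗ₜ 1
  comul_mul : ∀ x y : A, comul (R := K) (x * y) =
    (x ⊗ₜ 1) * comul (R := K) y + comul (R := K) x * (1 ⊗ₜ y) - x ⊗ₜ y
  conilpotent : IsConilpotent K (1 : A)

namespace InfBialgebra

section

variable (K A : Type*) [Field K] [Ring A] [Algebra K A] [Coalgebra K A]

/-- The identity, as an element of the convolution algebra. -/
def convId : WithConv (A →ₗ[K] A) := toConv LinearMap.id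

variable {K A}

theorem convId_apply (x : A) : convId K A x = x := rfl

theorem one_sub_convId_one [InfBialgebra K A] : (1 - convId K A) (1 : A) = 0 := by
  change algebraMap K A (counit (R := K) (1 : A)) - 1 = 0
  rw [counit_one, map_one, sub_self]

variable (K A) [InfBialgebra K A]

/-- The convolution inverse of the identity. -/
noncomputable def convInv : WithConv (A →ₗ[K] A) :=
  geomConv (1 - convId K A) (conilpotent.pow_eq_zero one_sub_convId_one)

theorem convInv_mul : convInv K A * convId K A = 1 := by
  have := (conilpotent (K := K) (A := A)).geomConv_mul one_sub_convId_one
  rwa [sub_sub_cancel] at this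

theorem mul_convInv : convId K A * convInv K A = 1 := by
  have := (conilpotent (K := K) (A := A)).mul_geomConv one_sub_convId_one
  rwa [sub_sub_cancel] at this

/-- The idempotent that projects onto the primitive elements. -/
noncomputable def idem : WithConv (A →ₗ[K] A) := 1 - convInv K A

/-- This is the fixed point equation of the identity. Composed with a morphism of coalgebras `g`
into `A`, it says that `g` solves `Y = 1 + (e ∘ g) * Y`, which is how such morphisms are compared
later. -/
theorem convId_eq : convId K A = 1 + idem K A * convId K A := by
  rw [idem, sub_mul, convInv_mul, one_mul]
  abel

theorem convId_mul_idem : convId K A * idem K A = convId K A - 1 := by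
  rw [idem, mul_sub, mul_convInv, mul_one]

variable {K A}

theorem one_apply (x : A) : (1 : WithConv (A →ₗ[K] A)) x = counit (R := K) x • (1 : A) :=
  Algebra.algebraMap_eq_smul_one _

theorem idem_one : idem K A (1 : A) = 0 := by
  have h := congrArg (fun f : WithConv (A →ₗ[K] A) => f 1) (convInv_mul K A)
  rw [conv_apply_of_comul_eq_tmul comul_one, convId_apply, mul_one] at h
  change (1 : WithConv (A →ₗ[K] A)) (1 : A) - convInv K A 1 = 0
  rw [h, sub_self]

/-- The hypothesis says that `1 - f` is a left inverse of the identity, and inverses are unique. -/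
theorem idem_eq_of_convInv {f : WithConv (A →ₗ[K] A)} (h : convId K A = 1 + f * convId K A) :
    idem K A = f := by
  have h1 : (1 - f) * convId K A = 1 := by
    rw [sub_mul, one_mul]
    nth_rw 1 [h]
    abel
  have := left_inv_eq_right_inv h1 (mul_convInv K A)
  rw [idem, ← this]
  abel

/-- The inverse of the identity is the geometric series of `1 - Id = -J`. Subtracting it from `1`
cancels the term of degree zero and leaves `J - J ⋆ J + ⋯`. -/
theorem idem_apply_eq_finsum (x : A) :
    idem K A x = ∑ᶠ n : ℕ, (-1 : K) ^ n • ((convId K A - 1) ^ (n + 1)) x := by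
  have hφ := one_sub_convId_one (K := K) (A := A)
  obtain ⟨N, hN⟩ := conilpotent.pow_eq_zero hφ x
  have hpow : ∀ n, (1 - convId K A) ^ n = (-1 : K) ^ n • (convId K A - 1) ^ n := fun n => by
    rw [← smul_pow, neg_smul, one_smul, neg_sub]
  have h1 : ∀ n, (-1 : K) ^ n • ((convId K A - 1) ^ (n + 1)) x =
      -((1 - convId K A) ^ (n + 1)) x := fun n => by
    rw [hpow, pow_succ (-1 : K), ofConv_smul, LinearMap.smul_apply]
    simp
  have h2 : convInv K A x = ∑ n ∈ Finset.range (N + 1), ((1 - convId K A) ^ n) x :=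
    geomConv_apply fun n hn => hN n (by omega)
  rw [finsum_eq_sum_of_support_subset (s := Finset.range N)]
  · simp only [h1]
    change (1 : WithConv (A →ₗ[K] A)) x - convInv K A x = _
    rw [h2, Finset.sum_range_succ' _ N, pow_zero, Finset.sum_neg_distrib]
    abel
  · intro n hn
    simp only [Finset.coe_range, Set.mem_Iio]
    by_contra h'
    exact hn (by simp only [h1, hN (n + 1) (by omega), neg_zero])

/-- This is the relation for `Δ(xy)` transported to convolution algebras. It allows `Δ` to be
applied to equations between convolution products. -/
theorem comul_conv {C : Type*} [AddCommGroup C] [Module K C] [Coalgebra K C]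
    (f g : WithConv (C →ₗ[K] A)) :
    toConv (comul ∘ₗ (f * g).ofConv) =
      convPost C Algebra.TensorProduct.includeLeft f * toConv (comul ∘ₗ g.ofConv) +
        toConv (comul ∘ₗ f.ofConv) * convPost C Algebra.TensorProduct.includeRight g -
        convPost C Algebra.TensorProduct.includeLeft f *
          convPost C (Algebra.TensorProduct.includeRight : A →ₐ[K] A ⊗[K] A) g := by
  refine WithConv.ext (LinearMap.ext fun c => ?_)
  simp only [LinearMap.comp_apply, LinearMap.convMul_apply, ofConv_sub, ofConv_add,
    LinearMap.sub_apply, LinearMap.add_apply]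
  generalize comul (R := K) c = X
  induction X with
  | zero => simp
  | add X Y hX hY =>
    simp only [map_add, hX, hY]
    abel
  | tmul a b =>
    simp only [TensorProduct.map_tmul, LinearMap.mul'_apply, comul_mul, LinearMap.comp_apply]
    simp [convPost]

theorem comul_eq_conv : toConv (comul (R := K) (A := A)) =
    convPost A Algebra.TensorProduct.includeLeft (convId K A) *
      convPost A Algebra.TensorProduct.includeRight (convId K A) := by
  refine WithConv.ext (LinearMap.ext fun c => ?_)
  rw [LinearMap.convMul_apply]
  change comul (R := K) c = _
  generalize comul (R := K) c = X
  induction X with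
  | zero => simp
  | add X Y hX hY => simp only [map_add, ← hX, ← hY]
  | tmul a b => simp [convPost, convId]

theorem comul_comp_one {C : Type*} [AddCommGroup C] [Module K C] [Coalgebra K C] :
    toConv (comul ∘ₗ (1 : WithConv (C →ₗ[K] A)).ofConv) = 1 := by
  refine WithConv.ext (LinearMap.ext fun c => ?_)
  change comul (R := K) (algebraMap K A (counit c)) = algebraMap K (A ⊗[K] A) (counit c)
  rw [Algebra.algebraMap_eq_smul_one, map_smul, comul_one, Algebra.algebraMap_eq_smul_one,
    Algebra.TensorProduct.one_def]

/-- Let `i₁`, `i₂` be the two inclusions `A → A ⊗ A`, so that `Δ = i₁ * i₂`. Applying `Δ` to `Id⁻¹ *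
Id = 1` gives `1 = i₂ + (Δ ∘ Id⁻¹) * i₂ - (i₁ ∘ Id⁻¹) * i₂`. Multiplying on the right by `i₂ ∘ Id⁻¹`
yields `Δ ∘ Id⁻¹ = i₁ ∘ Id⁻¹ + i₂ ∘ Id⁻¹ - 1`, so the values of `1 - Id⁻¹` are primitive. -/
theorem comul_idem (x : A) :
    comul (R := K) (idem K A x) = idem K A x ⊗ₜ 1 + 1 ⊗ₜ idem K A x := by
  have h := comul_conv (convInv K A) (convId K A)
  set i₁ : A →ₐ[K] A ⊗[K] A := Algebra.TensorProduct.includeLeft with hi₁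
  set i₂ : A →ₐ[K] A ⊗[K] A := Algebra.TensorProduct.includeRight with hi₂
  have h1 : toConv (comul ∘ₗ (convId K A).ofConv) = toConv (comul (R := K) (A := A)) := rfl
  rw [convInv_mul, comul_comp_one, h1, comul_eq_conv, ← mul_assoc, ← map_mul, convInv_mul,
    map_one, one_mul] at h
  have h2 := congrArg (fun f => f * convPost A i₂ (convInv K A)) h
  simp only [sub_mul, add_mul, mul_assoc] at h2
  rw [← map_mul, mul_convInv, map_one, mul_one, mul_one, one_mul] at h2
  have h3 : comul (R := K) (convInv K A x) =
      convInv K A x ⊗ₜ[K] (1 : A) + (1 : A) ⊗ₜ[K] convInv K A x -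
        (1 : WithConv (A →ₗ[K] A ⊗[K] A)) x := by
    have h4 : toConv (comul ∘ₗ (convInv K A).ofConv) =
        convPost A i₁ (convInv K A) + convPost A i₂ (convInv K A) - 1 := by
      rw [h2]
      abel
    exact congrArg (fun f : WithConv (A →ₗ[K] A ⊗[K] A) => f x) h4
  have h5 : comul (R := K) ((1 : WithConv (A →ₗ[K] A)) x) =
      (1 : WithConv (A →ₗ[K] A ⊗[K] A)) x :=
    congrArg (fun f : WithConv (A →ₗ[K] A ⊗[K] A) => f x) comul_comp_one
  change comul (R := K) ((1 : WithConv (A →ₗ[K] A)) x - convInv K A x) =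
    ((1 : WithConv (A →ₗ[K] A)) x - convInv K A x) ⊗ₜ[K] (1 : A) +
      (1 : A) ⊗ₜ[K] ((1 : WithConv (A →ₗ[K] A)) x - convInv K A x)
  rw [map_sub, h3, h5, TensorProduct.sub_tmul, TensorProduct.tmul_sub, one_apply,
    ← TensorProduct.smul_tmul', TensorProduct.tmul_smul, LinearMap.convOne_apply,
    Algebra.algebraMap_eq_smul_one, Algebra.TensorProduct.one_def]
  abel

/-- Applying the counit to the left factor of `Δ(p)` gives `c(p) 1 + p = p`. -/
theorem counit_eq_zero_of_primitive {p : A}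
    (hp : comul (R := K) p = p ⊗ₜ 1 + 1 ⊗ₜ p) : counit (R := K) p = 0 := by
  have h := Coalgebra.rTensor_counit_comul (R := K) p
  rw [hp, map_add, LinearMap.rTensor_tmul, LinearMap.rTensor_tmul, counit_one, add_eq_right] at h
  have h2 := congrArg (fun z => counit (R := K) (TensorProduct.lid K A z)) h
  simpa [counit_one] using h2

theorem counit_idem (x : A) : counit (R := K) (idem K A x) = 0 :=
  counit_eq_zero_of_primitive (comul_idem x)

/-- Evaluate `Id * e = Id - 1` at `xy` and expand `Δ(xy)`. The part with `Δ(y)` already gives `xy`,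
so the other two cancel: with `f(x) = e(xy)`, one gets `(Id * f)(x) = x e(y)`. Convolution by `Id⁻¹`
on the left turns `x` into `c(x)`. -/
theorem idem_mul (x : A) {y : A} (hy : counit (R := K) y = 0) :
    idem K A (x * y) = counit (R := K) x • idem K A y := by
  set f : WithConv (A →ₗ[K] A) := toConv ((idem K A).ofConv ∘ₗ LinearMap.mulRight K y) with hf
  set g : WithConv (A →ₗ[K] A) := toConv (LinearMap.mulRight K (idem K A y)) with hg
  have h0 : ∀ z, (convId K A * idem K A) z = z - (counit (R := K) z • (1 : A)) := fun z => by
    rw [convId_mul_idem, ← one_apply]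
    rfl
  have h1 : convId K A * f = g := by
    refine WithConv.ext (LinearMap.ext fun x => ?_)
    have h2 := h0 (x * y)
    rw [counit_mul, hy, mul_zero, zero_smul, sub_zero, LinearMap.convMul_apply, comul_mul, map_sub,
      map_sub, map_add, map_add] at h2
    have h3 : LinearMap.mul' K A (TensorProduct.map (convId K A).ofConv (idem K A).ofConv
        ((x ⊗ₜ 1) * comul (R := K) y)) = x * y := by
      have h4 := h0 y
      rw [hy, zero_smul, sub_zero, LinearMap.convMul_apply] at h4
      refine Eq.trans ?_ (congrArg (x * ·) h4)
      generalize comul (R := K) y = X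
      induction X with
      | zero => simp
      | add X Y hX hY => simp only [map_add, mul_add, hX, hY]
      | tmul a b => simp [convId, mul_assoc]
    have h5 : LinearMap.mul' K A (TensorProduct.map (convId K A).ofConv (idem K A).ofConv
        (comul (R := K) x * (1 ⊗ₜ y))) = (convId K A * f) x := by
      rw [LinearMap.convMul_apply]
      generalize comul (R := K) x = X
      induction X with
      | zero => simp
      | add X Y hX hY => simp only [map_add, add_mul, hX, hY]
      | tmul a b => simp [convId, hf]
    rw [h3, h5, TensorProduct.map_tmul, LinearMap.mul'_apply] at h2
    change (convId K A * f) x = x * idem K A y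
    have h6 : x * y + (convId K A * f) x - x * idem K A y = x * y := h2
    rw [add_sub_assoc, add_eq_left, sub_eq_zero] at h6
    exact h6
  have h2 : f = convInv K A * g := by rw [← h1, ← mul_assoc, convInv_mul, one_mul]
  have h3 : (convInv K A * g) x = (convInv K A * convId K A) x * idem K A y := by
    rw [LinearMap.convMul_apply, LinearMap.convMul_apply]
    generalize comul (R := K) x = X
    induction X with
    | zero => simp
    | add X Y hX hY => simp only [map_add, add_mul, hX, hY]
    | tmul a b => simp [convId, hg, mul_assoc]
  change f x = _
  rw [h2, h3, convInv_mul, one_apply, smul_mul_assoc, one_mul]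

end

section

variable {K A B : Type*} [Field K] [Ring A] [Algebra K A] [Coalgebra K A] [InfBialgebra K A]
  [Ring B] [Algebra K B] [Coalgebra K B] [InfBialgebra K B]

/-- In the convolution algebra `Hom(A, B)`, the map `f ∘ Id⁻¹` is a left inverse of `f` because `f`
is a morphism of algebras, and `Id⁻¹ ∘ f` is a right inverse because `f` is a morphism of
coalgebras. -/
theorem idem_map (f : A →ₐ[K] B) (hc : ∀ x, counit (R := K) (f x) = counit (R := K) x)
    (hΔ : ∀ x, comul (R := K) (f x) = TensorProduct.map f.toLinearMap f.toLinearMap (comul x))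
    (x : A) : idem K B (f x) = f (idem K A x) := by
  let g : A →ₗc[K] B :=
    { f.toLinearMap with
      counit_comp := LinearMap.ext hc
      map_comp_comul := LinearMap.ext fun x => (hΔ x).symm }
  have h1 : convPost A f (convId K A) = convPre B g (convId K B) := rfl
  have h2 : convPost A f (convInv K A) * convPost A f (convId K A) = 1 := by
    rw [← map_mul, convInv_mul, map_one]
  have h3 : convPost A f (convId K A) * convPre B g (convInv K B) = 1 := by
    rw [h1, ← map_mul, mul_convInv, map_one]
  have h4 := left_inv_eq_right_inv h2 h3
  have h5 : convPost A f (idem K A) = convPre B g (idem K B) := by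
    rw [idem, idem, map_sub, map_sub, h4, map_one, map_one]
  exact (congrArg (fun F : WithConv (A →ₗ[K] B) => F x) h5).symm

end

end InfBialgebra

/-! ## The tensor algebra with the deconcatenation coproduct -/

namespace TensorAlgebra

section

variable {K : Type*} [Field K] {R : Type*} [AddCommGroup R] [Module K R]

theorem induction_left {P : TensorAlgebra K R → Prop} (one : P 1)
    (add : ∀ u v, P u → P v → P (u + v)) (smul : ∀ (c : K) u, P u → P (c • u))
    (mul : ∀ r u, P u → P (ι K r * u)) (u : TensorAlgebra K R) : P u := by
  suffices h : ∀ v, P v → P (u * v) by simpa using h 1 one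
  induction u using TensorAlgebra.induction with
  | algebraMap c => intro v hv; rw [← Algebra.smul_def]; exact smul c v hv
  | ι r => exact mul r
  | mul a b ha hb => intro v hv; rw [mul_assoc]; exact ha _ (hb _ hv)
  | add a b ha hb => intro v hv; rw [add_mul]; exact add _ _ (ha _ hv) (hb _ hv)

theorem linearMap_ext_left {N : Type*} [AddCommGroup N] [Module K N]
    {f g : TensorAlgebra K R →ₗ[K] N} (one : f 1 = g 1)
    (mul : ∀ r u, f u = g u → f (ι K r * u) = g (ι K r * u)) : f = g :=
  LinearMap.ext fun u => induction_left one (fun u v h h' => by rw [map_add, map_add, h, h'])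
    (fun c u h => by rw [map_smul, map_smul, h]) mul u

variable (K R)

/-- The action of the tensor algebra on pairs whose orbit of `(1, 1 ⊗ 1)` is the graph of
deconcatenation. -/
noncomputable def deconcAction : TensorAlgebra K R →ₐ[K]
    Module.End K (TensorAlgebra K R × (TensorAlgebra K R ⊗[K] TensorAlgebra K R)) :=
  lift K
    { toFun := fun r => LinearMap.prod (LinearMap.mulLeft K (ι K r) ∘ₗ LinearMap.fst K _ _)
        (TensorProduct.mk K _ _ 1 ∘ₗ LinearMap.mulLeft K (ι K r) ∘ₗ LinearMap.fst K _ _ +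
          LinearMap.mulLeft K (ι K r ⊗ₜ 1) ∘ₗ LinearMap.snd K _ _)
      map_add' := fun r s => LinearMap.ext fun x => Prod.ext (by simp [add_mul]) (by
        simp only [map_add, LinearMap.prod_apply, Function.prod_apply, LinearMap.add_apply,
          LinearMap.comp_apply, LinearMap.mulLeft_apply, TensorProduct.mk_apply,
          LinearMap.fst_apply, LinearMap.snd_apply, add_mul,
          TensorProduct.add_tmul, Prod.snd_add]
        abel)
      map_smul' := fun c r => LinearMap.ext fun x => Prod.ext (by simp) (by
        simp only [map_smul, LinearMap.prod_apply, Function.prod_apply, LinearMap.add_apply,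
          LinearMap.comp_apply, LinearMap.mulLeft_apply, TensorProduct.mk_apply,
          LinearMap.fst_apply, LinearMap.snd_apply, smul_mul_assoc,
          ← TensorProduct.smul_tmul', RingHom.id_apply, LinearMap.smul_apply, Prod.smul_snd,
          smul_add]) }

/-- Deconcatenation. -/
noncomputable def deconc :
    TensorAlgebra K R →ₗ[K] TensorAlgebra K R ⊗[K] TensorAlgebra K R :=
  LinearMap.snd K _ _ ∘ₗ LinearMap.applyₗ (1, 1 ⊗ₜ 1) ∘ₗ (deconcAction K R).toLinearMap

variable {K R}

/-- The recursion `Δ(ru) = 1 ⊗ ru + (r ⊗ 1) Δ(u)` refers to `u` itself besides `Δ(u)`; the first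
component keeps track of it. -/
theorem deconcAction_fst (u : TensorAlgebra K R) : (deconcAction K R u (1, 1 ⊗ₜ 1)).1 = u := by
  induction u using induction_left with
  | one => simp
  | add u v hu hv => rw [map_add, LinearMap.add_apply, Prod.fst_add, hu, hv]
  | smul c u hu => rw [map_smul, LinearMap.smul_apply, Prod.smul_fst, hu]
  | mul r u hu =>
    rw [map_mul, Module.End.mul_apply, deconcAction, lift_ι_apply]
    exact congrArg (ι K r * ·) hu

theorem deconc_one : deconc K R 1 = 1 ⊗ₜ 1 := by
  simp [deconc]

theorem deconc_ι_mul (r : R) (u : TensorAlgebra K R) :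
    deconc K R (ι K r * u) = 1 ⊗ₜ (ι K r * u) + (ι K r ⊗ₜ 1) * deconc K R u := by
  have h : deconc K R (ι K r * u) = 1 ⊗ₜ (ι K r * (deconcAction K R u (1, 1 ⊗ₜ 1)).1) +
      (ι K r ⊗ₜ 1) * deconc K R u := by
    simp only [deconc, LinearMap.comp_apply, AlgHom.toLinearMap_apply, map_mul]
    rw [LinearMap.applyₗ_apply_apply, Module.End.mul_apply]
    conv_lhs => rw [deconcAction, lift_ι_apply]
    rfl
  rwa [deconcAction_fst] at h

theorem assoc_rTensor_deconc_mul (r : R) (X : TensorAlgebra K R ⊗[K] TensorAlgebra K R) :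
    TensorProduct.assoc K _ _ _ ((deconc K R).rTensor _ ((ι K r ⊗ₜ 1) * X)) =
      1 ⊗ₜ ((ι K r ⊗ₜ 1) * X) +
        (ι K r ⊗ₜ (1 ⊗ₜ 1)) * TensorProduct.assoc K _ _ _ ((deconc K R).rTensor _ X) := by
  induction X with
  | zero => simp
  | add X Y hX hY =>
    simp only [mul_add, map_add, hX, hY, TensorProduct.tmul_add]
    abel
  | tmul a b =>
    rw [Algebra.TensorProduct.tmul_mul_tmul, LinearMap.rTensor_tmul, LinearMap.rTensor_tmul,
      deconc_ι_mul, TensorProduct.add_tmul, map_add, TensorProduct.assoc_tmul]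
    congr 1
    generalize deconc K R a = Y
    induction Y with
    | zero => simp
    | add X Y hX hY => simp only [mul_add, map_add, hX, hY, TensorProduct.add_tmul]
    | tmul c d => simp

theorem lTensor_deconc_mul (r : R) (X : TensorAlgebra K R ⊗[K] TensorAlgebra K R) :
    (deconc K R).lTensor _ ((ι K r ⊗ₜ 1) * X) =
        (ι K r ⊗ₜ (1 ⊗ₜ 1)) * (deconc K R).lTensor _ X := by
  induction X with
  | zero => simp
  | add X Y hX hY => simp only [mul_add, map_add, hX, hY]
  | tmul a b => simp [← Algebra.TensorProduct.one_def]

noncomputable instance : Coalgebra K (TensorAlgebra K R) where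
  comul := deconc K R
  counit := algebraMapInv.toLinearMap
  coassoc := by
    refine linearMap_ext_left (by simp [deconc_one]) fun r u hu => ?_
    simp only [LinearMap.comp_apply, LinearEquiv.coe_coe] at hu ⊢
    rw [deconc_ι_mul, map_add, map_add, map_add, assoc_rTensor_deconc_mul, lTensor_deconc_mul, hu,
      LinearMap.rTensor_tmul, LinearMap.lTensor_tmul, deconc_ι_mul, deconc_one,
      TensorProduct.assoc_tmul, TensorProduct.tmul_add, add_assoc]
  rTensor_counit_comp_comul := by
    refine linearMap_ext_left (by simp [deconc_one]) fun r u hu => ?_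
    simp only [LinearMap.comp_apply] at hu ⊢
    rw [deconc_ι_mul, map_add, LinearMap.rTensor_tmul, AlgHom.toLinearMap_apply, map_one,
      TensorProduct.mk_apply, add_eq_left]
    generalize deconc K R u = X
    induction X with
    | zero => simp
    | add X Y hX hY => rw [mul_add, map_add, hX, hY, add_zero]
    | tmul a b => simp [algebraMapInv]
  lTensor_counit_comp_comul := by
    refine linearMap_ext_left (by simp [deconc_one]) fun r u hu => ?_
    simp only [LinearMap.comp_apply] at hu ⊢
    have h : ∀ X : TensorAlgebra K R ⊗[K] TensorAlgebra K R,
        algebraMapInv.toLinearMap.lTensor _ ((ι K r ⊗ₜ 1) * X) =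
          (LinearMap.mulLeft K (ι K r)).rTensor K (algebraMapInv.toLinearMap.lTensor _ X) := by
      intro X
      induction X with
      | zero => simp
      | add X Y hX hY => rw [mul_add, map_add, hX, hY, map_add, map_add]
      | tmul a b => simp
    rw [deconc_ι_mul, map_add, h, hu]
    simp [algebraMapInv]

theorem comul_one : comul (R := K) (1 : TensorAlgebra K R) = 1 ⊗ₜ 1 := deconc_one

theorem comul_ι_mul (r : R) (u : TensorAlgebra K R) :
    comul (R := K) (ι K r * u) = 1 ⊗ₜ (ι K r * u) + (ι K r ⊗ₜ 1) * comul (R := K) u :=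
  deconc_ι_mul r u

theorem comul_ι (r : R) :
    comul (R := K) (ι K r) = ι K r ⊗ₜ 1 + 1 ⊗ₜ ι K r := by
  have := comul_ι_mul (K := K) r 1
  rwa [mul_one, comul_one, Algebra.TensorProduct.tmul_mul_tmul, mul_one, mul_one, add_comm] at this

theorem counit_one : counit (R := K) (1 : TensorAlgebra K R) = 1 := map_one algebraMapInv

theorem counit_mul (x y : TensorAlgebra K R) :
    counit (R := K) (x * y) = counit (R := K) x * counit (R := K) y := map_mul algebraMapInv x y

theorem counit_ι (r : R) : counit (R := K) (ι K r) = 0 := by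
  change algebraMapInv (ι K r) = 0
  simp [algebraMapInv]

theorem isConilpotent : IsConilpotent K (1 : TensorAlgebra K R) := by
  -- The words of length `n` span the `n`-th power of the space of letters, and cutting a word
  -- preserves the total length.
  refine ⟨fun n => LinearMap.range (ι K : R →ₗ[K] TensorAlgebra K R) ^ n, ?_, fun n => ?_, ?_⟩
  · rw [eq_top_iff]
    rintro u -
    induction u using induction_left with
    | one =>
      exact Submodule.mem_iSup_of_mem 0 (by rw [pow_zero]; exact Submodule.one_le.1 le_rfl)
    | add u v hu hv => exact add_mem hu hv
    | smul c u hu => exact Submodule.smul_mem _ _ hu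
    | mul r u hu =>
      induction hu using Submodule.iSup_induction' with
      | zero => simp
      | add x y _ _ hx hy => rw [mul_add]; exact add_mem hx hy
      | mem n u hu =>
        refine Submodule.mem_iSup_of_mem (n + 1) ?_
        rw [pow_succ']
        exact Submodule.mul_mem_mul ⟨r, rfl⟩ hu
  · induction n with
    | zero =>
      intro x hx
      dsimp only at hx
      rw [pow_zero, Submodule.one_eq_span, Submodule.mem_span_singleton] at hx
      obtain ⟨c, rfl⟩ := hx
      rw [map_smul, comul_one]
      have h1 : (1 : TensorAlgebra K R) ∈
          LinearMap.range (ι K : R →ₗ[K] TensorAlgebra K R) ^ 0 := by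
        rw [pow_zero]
        exact Submodule.one_le.1 le_rfl
      exact Submodule.smul_mem _ _ (tmul_mem_tensorGrading (add_zero 0) h1 h1)
    | succ n ih =>
      intro x hx
      dsimp only at hx
      rw [pow_succ'] at hx
      induction hx using Submodule.mul_induction_on' with
      | add x _ y _ hx hy => rw [map_add]; exact add_mem hx hy
      | mem_mul_mem r hr u hu =>
        obtain ⟨r, rfl⟩ := hr
        rw [comul_ι_mul]
        refine add_mem (tmul_mem_tensorGrading (zero_add (n + 1)) ?_ ?_) ?_
        · rw [pow_zero]
          exact Submodule.one_le.1 le_rfl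
        · rw [pow_succ']
          exact Submodule.mul_mem_mul ⟨r, rfl⟩ hu
        · have h := ih u hu
          generalize comul (R := K) u = X at h
          induction h using Submodule.span_induction with
          | zero => simp
          | add x y _ _ hx hy => rw [mul_add]; exact add_mem hx hy
          | smul c x _ hx => rw [mul_smul_comm]; exact Submodule.smul_mem _ _ hx
          | mem x hx =>
            obtain ⟨i, j, rfl, a, ha, b, hb, rfl⟩ := hx
            rw [Algebra.TensorProduct.tmul_mul_tmul, one_mul]
            refine tmul_mem_tensorGrading (i := i + 1) (by omega) ?_ hb
            rw [pow_succ']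
            exact Submodule.mul_mem_mul ⟨r, rfl⟩ ha
  · dsimp only
    rw [pow_zero, Submodule.one_eq_span]

instance : InfBialgebra K (TensorAlgebra K R) where
  counit_one := counit_one
  counit_mul := counit_mul
  comul_one := comul_one
  comul_mul x y := by
    induction x using induction_left with
    | one =>
      rw [one_mul, comul_one, Algebra.TensorProduct.tmul_mul_tmul, mul_one, one_mul,
        ← Algebra.TensorProduct.one_def, one_mul, add_sub_cancel_right]
    | add u v hu hv =>
      simp only [add_mul, map_add, hu, hv, TensorProduct.add_tmul]
      abel
    | smul c u hu =>
      simp only [smul_mul_assoc, map_smul, hu, ← TensorProduct.smul_tmul', smul_add, smul_sub]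
    | mul r u hu =>
      rw [mul_assoc, comul_ι_mul, hu, comul_ι_mul]
      simp only [mul_add, add_mul, mul_sub, ← mul_assoc, Algebra.TensorProduct.tmul_mul_tmul,
        one_mul, mul_one]
      abel
  conilpotent := isConilpotent

variable (K R)

/-- The projection of the tensor algebra onto the space of words of length one. -/
noncomputable def proj : TensorAlgebra K R →ₗ[K] R :=
  LinearMap.snd K K R ∘ₗ LinearMap.applyₗ (1, 0) ∘ₗ AlgHom.toLinearMap (lift K
    { toFun := fun r => LinearMap.inr K K R ∘ₗ (LinearMap.toSpanSingleton K R r) ∘ₗ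
        LinearMap.fst K K R
      map_add' := fun r s => LinearMap.ext fun x => Prod.ext (by simp) (by simp)
      map_smul' := fun c r => LinearMap.ext fun x => Prod.ext (by simp) (by
        simp [smul_comm c x.1 r]) } :
    TensorAlgebra K R →ₐ[K] Module.End K (K × R))

variable {K R}

theorem proj_one : proj K R 1 = 0 := by
  simp [proj]

theorem proj_ι_mul (r : R) (u : TensorAlgebra K R) :
    proj K R (ι K r * u) = counit (R := K) u • r := by
  rw [proj]
  simp only [LinearMap.comp_apply, AlgHom.toLinearMap_apply, map_mul, lift_ι_apply,
    LinearMap.applyₗ_apply_apply, Module.End.mul_apply]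
  simp only [LinearMap.coe_mk, AddHom.coe_mk, LinearMap.comp_apply, LinearMap.inr_apply,
    LinearMap.snd_apply, LinearMap.toSpanSingleton_apply, LinearMap.fst_apply]
  congr 1
  induction u using induction_left with
  | one => simp [counit_one]
  | add u v hu hv => rw [map_add, LinearMap.add_apply, Prod.fst_add, hu, hv, map_add]
  | smul c u hu => rw [map_smul, LinearMap.smul_apply, Prod.smul_fst, hu, map_smul]
  | mul r u hu =>
    rw [map_mul, Module.End.mul_apply, lift_ι_apply, counit_mul, counit_ι, zero_mul]
    rfl

theorem proj_ι (r : R) : proj K R (ι K r) = r := by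
  have := proj_ι_mul (K := K) r 1
  rwa [mul_one, counit_one, one_smul] at this

/-- Convolving the projection to letters with the identity cuts off the first letter of a word and
puts it back. So this map satisfies the equation `Id = 1 + f * Id` that characterizes `e`. -/
theorem idem_eq : InfBialgebra.idem K (TensorAlgebra K R) = toConv (ι K ∘ₗ proj K R) := by
  refine InfBialgebra.idem_eq_of_convInv (WithConv.ext (linearMap_ext_left ?_ fun r u _ => ?_))
  · rw [ofConv_add, LinearMap.add_apply, conv_apply_of_comul_eq_tmul comul_one]
    simp [InfBialgebra.convId, counit_one, proj_one]
  · rw [ofConv_add, LinearMap.add_apply, InfBialgebra.one_apply, counit_mul, counit_ι, zero_mul,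
      zero_smul, zero_add, LinearMap.convMul_apply, comul_ι_mul, map_add, map_add]
    have h : ∀ X : TensorAlgebra K R ⊗[K] TensorAlgebra K R,
        LinearMap.mul' K _ (TensorProduct.map (ι K ∘ₗ proj K R)
          (InfBialgebra.convId K (TensorAlgebra K R)).ofConv ((ι K r ⊗ₜ 1) * X)) =
          ι K r * TensorProduct.lid K _ ((counit (R := K)).rTensor _ X) := by
      intro X
      induction X with
      | zero => simp
      | add X Y hX hY => simp only [mul_add, map_add, hX, hY]
      | tmul a b => simp [proj_ι_mul, InfBialgebra.convId]
    rw [h, Coalgebra.rTensor_counit_comul]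
    simp [proj_one, InfBialgebra.convId]

theorem idem_apply (u : TensorAlgebra K R) :
    InfBialgebra.idem K (TensorAlgebra K R) u = ι K (proj K R u) := by
  rw [idem_eq]
  rfl

section

variable {C : Type*} [AddCommGroup C] [Module K C] [Coalgebra K C] {u : C}
  (hu : IsConilpotent K u) {φ : C →ₗ[K] R} (hφ : φ u = 0)

/-- The condition `φ u = 0` for a map with values in words of length one. -/
theorem ι_comp_apply_eq_zero {C : Type*} [AddCommGroup C] [Module K C] {u : C} {φ : C →ₗ[K] R}
    (hφ : φ u = 0) : (toConv (ι K ∘ₗ φ) : WithConv (C →ₗ[K] TensorAlgebra K R)) u = 0 := by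
  change ι K (φ u) = 0
  rw [hφ, map_zero]

/-- The morphism of coalgebras into the tensor algebra that is cogenerated by a linear map. -/
noncomputable def cogen : WithConv (C →ₗ[K] TensorAlgebra K R) :=
  geomConv (toConv (ι K ∘ₗ φ)) (hu.pow_eq_zero (ι_comp_apply_eq_zero hφ))

theorem cogen_eq : cogen hu hφ = 1 + toConv (ι K ∘ₗ φ) * cogen hu hφ :=
  (hu.one_add_mul_geomConv (ι_comp_apply_eq_zero hφ)).symm

/-- The counit is a morphism of algebras that kills letters, so it reduces the fixed point equation
to its constant term. -/
theorem counit_cogen (x : C) : counit (R := K) (cogen hu hφ x) = counit (R := K) x := by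
  have h0 : convPost C (algebraMapInv : TensorAlgebra K R →ₐ[K] K) (toConv (ι K ∘ₗ φ)) = 0 :=
    WithConv.ext (LinearMap.ext fun x => counit_ι (φ x))
  have h := congrArg (convPost C (algebraMapInv : TensorAlgebra K R →ₐ[K] K)) (cogen_eq hu hφ)
  rw [map_add, map_mul, h0, zero_mul, add_zero, map_one] at h
  exact congrArg (fun f : WithConv (C →ₗ[K] K) => f x) h

theorem convPost_mul_convPost_apply {A : Type*} [Ring A] [Algebra K A]
    (f g : WithConv (C →ₗ[K] A)) (x : C) :
    (convPost C (Algebra.TensorProduct.includeLeft : A →ₐ[K] A ⊗[K] A) f *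
      convPost C (Algebra.TensorProduct.includeRight : A →ₐ[K] A ⊗[K] A) g) x =
      TensorProduct.map f.ofConv g.ofConv (comul (R := K) x) := by
  rw [LinearMap.convMul_apply]
  generalize comul (R := K) x = X
  induction X with
  | zero => simp
  | add X Y hX hY => simp only [map_add, hX, hY]
  | tmul a b => simp [convPost]

/-- Write `Φ` for the cogenerated map and `i₁`, `i₂` for the inclusions of the two tensor factors.
Both `Δ ∘ Φ` and `(Φ ⊗ Φ) ∘ Δ = (i₁ ∘ Φ) * (i₂ ∘ Φ)` solve `Y = i₂ ∘ Φ + (i₁ ∘ ι ∘ φ) * Y`. For the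
first this uses that letters are primitive. -/
theorem comul_cogen (x : C) : comul (R := K) (cogen hu hφ x) =
    TensorProduct.map (cogen hu hφ).ofConv (cogen hu hφ).ofConv (comul x) := by
  set Φ := cogen hu hφ with hΦ
  have hfix : Φ = 1 + toConv (ι K ∘ₗ φ) * Φ := cogen_eq hu hφ
  set i₁ : TensorAlgebra K R →ₐ[K] TensorAlgebra K R ⊗[K] TensorAlgebra K R :=
    Algebra.TensorProduct.includeLeft with hi₁
  set i₂ : TensorAlgebra K R →ₐ[K] TensorAlgebra K R ⊗[K] TensorAlgebra K R :=
    Algebra.TensorProduct.includeRight with hi₂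
  have hi : convPost C i₁ (toConv (ι K ∘ₗ φ)) u = 0 := by
    rw [convPost_apply, ι_comp_apply_eq_zero hφ, map_zero]
  have h1 : (toConv (comul ∘ₗ Φ.ofConv) : WithConv (C →ₗ[K] _)) =
      convPost C i₂ Φ + convPost C i₁ (toConv (ι K ∘ₗ φ)) * toConv (comul ∘ₗ Φ.ofConv) := by
    have h2 := InfBialgebra.comul_conv (toConv (ι K ∘ₗ φ)) Φ
    have h3 : (toConv (comul ∘ₗ (toConv (ι K ∘ₗ φ)).ofConv) : WithConv (C →ₗ[K] _)) =
        convPost C i₁ (toConv (ι K ∘ₗ φ)) + convPost C i₂ (toConv (ι K ∘ₗ φ)) :=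
      WithConv.ext (LinearMap.ext fun x => comul_ι (φ x))
    have h4 : (toConv (comul ∘ₗ Φ.ofConv) : WithConv (C →ₗ[K] _)) =
        1 + toConv (comul ∘ₗ (toConv (ι K ∘ₗ φ) * Φ).ofConv) := by
      nth_rw 1 [hfix]
      rw [ofConv_add, LinearMap.comp_add, toConv_add, InfBialgebra.comul_comp_one]
    rw [← hi₁, ← hi₂, h3, add_mul, ← map_mul (convPost C i₂)] at h2
    have h5 : convPost C i₂ Φ = 1 + convPost C i₂ (toConv (ι K ∘ₗ φ) * Φ) := by
      nth_rw 1 [hfix]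
      rw [map_add, map_one]
    nth_rw 1 [h4]
    rw [h2]
    generalize convPost C i₂ (toConv (ι K ∘ₗ φ) * Φ) = Z at h5 ⊢
    generalize convPost C i₁ (toConv (ι K ∘ₗ φ)) = W
    rw [h5]
    abel
  have h5 : convPost C i₁ Φ * convPost C i₂ Φ =
      convPost C i₂ Φ + convPost C i₁ (toConv (ι K ∘ₗ φ)) *
        (convPost C i₁ Φ * convPost C i₂ Φ) := by
    nth_rw 1 [hfix]
    rw [map_add, map_one, add_mul, one_mul, map_mul, mul_assoc]
  have h6 := hu.eq_of_eq_add_mul hi h1 h5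
  rw [← convPost_mul_convPost_apply, ← hi₁, ← hi₂, ← h6]
  rfl

/-- In `φ * Φ` a word of length one arises only when the factor `Φ` contributes a constant. As `Φ`
preserves the counit, the counit axiom of `C` leaves `φ`. -/
theorem proj_cogen (x : C) : proj K R (cogen hu hφ x) = φ x := by
  have h : ∀ X : C ⊗[K] C, proj K R (LinearMap.mul' K _ (TensorProduct.map (ι K ∘ₗ φ)
      (cogen hu hφ).ofConv X)) = φ (TensorProduct.rid K C ((counit (R := K)).lTensor C X)) := by
    intro X
    induction X with
    | zero => simp
    | add X Y hX hY => simp only [map_add, hX, hY]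
    | tmul a b => simp [proj_ι_mul, counit_cogen]
  rw [cogen_eq, ofConv_add, LinearMap.add_apply, LinearMap.convMul_apply, map_add, h,
    Coalgebra.lTensor_counit_comul, LinearMap.convOne_apply, Algebra.algebraMap_eq_smul_one,
    map_smul, proj_one]
  simp

end

section

variable {A : Type*} [Ring A] [Algebra K A] [Coalgebra K A] [InfBialgebra K A]
  {E : TensorAlgebra K R →ₐ[K] A}

/-- When the first factor is primitive, the infinitesimal relation becomes the recursion of
deconcatenation, so images of words are cut like the words themselves. -/
theorem comul_algHom (hE : ∀ r, comul (R := K) (E (ι K r)) = E (ι K r) ⊗ₜ 1 + 1 ⊗ₜ E (ι K r))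
    (x : TensorAlgebra K R) :
    comul (R := K) (E x) = TensorProduct.map E.toLinearMap E.toLinearMap (comul x) := by
  induction x using induction_left with
  | one => rw [map_one, comul_one, InfBialgebra.comul_one, TensorProduct.map_tmul]; simp
  | add u v hu hv => simp only [map_add, hu, hv]
  | smul c u hu => simp only [map_smul, hu]
  | mul r u hu =>
    have h : ∀ X : TensorAlgebra K R ⊗[K] TensorAlgebra K R,
        TensorProduct.map E.toLinearMap E.toLinearMap ((ι K r ⊗ₜ 1) * X) =
          (E (ι K r) ⊗ₜ 1) * TensorProduct.map E.toLinearMap E.toLinearMap X := by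
      intro X
      induction X with
      | zero => simp
      | add X Y hX hY => simp only [mul_add, map_add, hX, hY]
      | tmul a b => simp
    rw [map_mul, InfBialgebra.comul_mul, comul_ι_mul, map_add, h, hu, hE, TensorProduct.map_tmul]
    simp only [add_mul, Algebra.TensorProduct.tmul_mul_tmul, one_mul, mul_one,
      AlgHom.toLinearMap_apply, map_one, map_mul]
    abel

theorem counit_algHom (hE : ∀ r, comul (R := K) (E (ι K r)) = E (ι K r) ⊗ₜ 1 + 1 ⊗ₜ E (ι K r))
    (x : TensorAlgebra K R) : counit (R := K) (E x) = counit (R := K) x := by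
  induction x using induction_left with
  | one => rw [map_one, counit_one, InfBialgebra.counit_one]
  | add u v hu hv => simp only [map_add, hu, hv]
  | smul c u hu => simp only [map_smul, hu]
  | mul r u hu =>
    rw [map_mul, InfBialgebra.counit_mul, counit_mul, hu, counit_ι,
      InfBialgebra.counit_eq_zero_of_primitive (hE r)]

end

end

end TensorAlgebra

/-! ## The product on the tensor algebra cogenerated by multilinear operations -/

/-- Splitting off the first block length corresponds to `φ ^ (l + 1) = φ * φ ^ l` for convolution
powers. -/
theorem Finset.Nat.sum_antidiagonalTuple_succ {N : Type*} [AddCommMonoid N] (l n : ℕ)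
    (f : (Fin (l + 1) → ℕ) → N) :
    ∑ a ∈ Finset.Nat.antidiagonalTuple (l + 1) n, f a =
      ∑ ij ∈ Finset.HasAntidiagonal.antidiagonal n,
        ∑ a ∈ Finset.Nat.antidiagonalTuple l ij.2, f (Fin.cons ij.1 a) := by
  rw [Finset.sum_sigma']
  refine Finset.sum_bij' (fun a _ => ⟨(a 0, ∑ i, a (Fin.succ i)), fun i => a i.succ⟩)
    (fun p _ => Fin.cons p.1.1 p.2) ?_ ?_ ?_ ?_ ?_
  · intro a ha
    rw [Finset.Nat.mem_antidiagonalTuple, Fin.sum_univ_succ] at ha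
    simp [ha, Finset.Nat.mem_antidiagonalTuple]
  · rintro ⟨⟨i, j⟩, a⟩ h
    simp only [Finset.mem_sigma, Finset.HasAntidiagonal.mem_antidiagonal, Finset.Nat.mem_antidiagonalTuple] at h
    simp [Finset.Nat.mem_antidiagonalTuple, Fin.sum_univ_succ, h.1, h.2]
  · intro a _
    exact Fin.cons_self_tail a
  · rintro ⟨⟨i, j⟩, a⟩ h
    simp only [Finset.mem_sigma, Finset.HasAntidiagonal.mem_antidiagonal, Finset.Nat.mem_antidiagonalTuple] at h
    obtain ⟨_, rfl⟩ := h
    simp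
  · intro a _
    exact congrArg f (Fin.cons_self_tail a).symm

theorem block_cons_zero {X : Type*} {l : ℕ} (i : ℕ) (a : Fin l → ℕ) (x : ℕ → X) :
    block (Fin.cons i a : Fin (l + 1) → ℕ) x 0 = fun s : Fin i => x s := by
  funext s
  have h : Finset.Iio (0 : Fin (l + 1)) = ∅ := by ext; simp
  simp [block, h]

theorem block_cons_succ {X : Type*} {l : ℕ} (i : ℕ) (a : Fin l → ℕ) (x : ℕ → X) (m : Fin l) :
    block (Fin.cons i a : Fin (l + 1) → ℕ) x m.succ = block a (fun s => x (i + s)) m := by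
  funext s
  have h : Finset.Iio m.succ = Finset.cons 0 ((Finset.Iio m).map (Fin.succEmb l)) (by simp) := by
    ext j
    cases j using Fin.cases <;> simp [Fin.succ_pos]
  simp only [block]
  rw [h, Finset.sum_cons, Finset.sum_map]
  simp [add_assoc]

namespace TensorAlgebra

section

variable {K : Type*} [Field K] {R : Type*} [AddCommGroup R] [Module K R]

/-- The product in the tensor algebra of the first `n` terms of a sequence. -/
noncomputable def word (K : Type*) [Field K] {R : Type*} [AddCommGroup R] [Module K R] (n : ℕ)
    (x : ℕ → R) : TensorAlgebra K R :=
  tprod K R n fun i => x i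

theorem tprod_succ (n : ℕ) (x : Fin (n + 1) → R) :
    tprod K R (n + 1) x = ι K (x 0) * tprod K R n fun i => x i.succ := by
  rw [tprod_apply, tprod_apply, List.ofFn_succ, List.prod_cons]

theorem tprod_zero (x : Fin 0 → R) : tprod K R 0 x = 1 := by
  rw [tprod_apply, List.ofFn_zero, List.prod_nil]

theorem word_zero (x : ℕ → R) : word K 0 x = 1 := tprod_zero _

theorem word_succ (n : ℕ) (x : ℕ → R) :
    word K (n + 1) x = ι K (x 0) * word K n fun s => x (s + 1) :=
  tprod_succ _ _

theorem word_cons (n : ℕ) (r : R) (x : ℕ → R) :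
    word K (n + 1) (fun s => Nat.casesOn s r x) = ι K r * word K n x :=
  tprod_succ _ _

theorem tprod_eq_word (n : ℕ) (a : Fin n → R) :
    tprod K R n a = word K n fun s => if h : s < n then a ⟨s, h⟩ else 0 := by
  simp [word]

theorem induction_word {P : TensorAlgebra K R → Prop} (add : ∀ u v, P u → P v → P (u + v))
    (smul : ∀ (c : K) u, P u → P (c • u)) (word : ∀ n x, P (word K n x))
    (u : TensorAlgebra K R) : P u := by
  have key : ∀ u : TensorAlgebra K R,
      u ∈ Submodule.span K {u : TensorAlgebra K R | ∃ n x, u = TensorAlgebra.word K n x} := by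
    intro u
    induction u using induction_left with
    | one => exact Submodule.subset_span ⟨0, 0, (word_zero _).symm⟩
    | add u v hu hv => exact add_mem hu hv
    | smul c u hu => exact Submodule.smul_mem _ _ hu
    | mul r u hu =>
      induction hu using Submodule.span_induction with
      | zero => simp
      | add x y _ _ hx hy => rw [mul_add]; exact add_mem hx hy
      | smul c x _ hx => rw [mul_smul_comm]; exact Submodule.smul_mem _ _ hx
      | mem x hx =>
        obtain ⟨n, x, rfl⟩ := hx
        exact Submodule.subset_span ⟨n + 1, _, (word_cons n r x).symm⟩
  induction key u using Submodule.span_induction with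
  | zero => simpa using smul 0 _ (word 0 0)
  | add x y _ _ hx hy => exact add _ _ hx hy
  | smul c x _ hx => exact smul _ _ hx
  | mem x hx =>
    obtain ⟨n, x, rfl⟩ := hx
    exact word n x

theorem linearMap_ext_word {N : Type*} [AddCommGroup N] [Module K N]
    {f g : TensorAlgebra K R →ₗ[K] N} (h : ∀ n x, f (word K n x) = g (word K n x)) : f = g :=
  LinearMap.ext fun u => induction_word (P := fun u => f u = g u) (fun u v h h' => by rw [map_add, map_add, h, h'])
    (fun c u h => by rw [map_smul, map_smul, h]) h u

theorem comul_word (n : ℕ) (x : ℕ → R) : comul (R := K) (word K n x) =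
    ∑ ij ∈ Finset.HasAntidiagonal.antidiagonal n, word K ij.1 x ⊗ₜ[K] word K ij.2 (fun s => x (ij.1 + s)) := by
  induction n generalizing x with
  | zero => simp [word_zero, comul_one]
  | succ n ih =>
    rw [word_succ, comul_ι_mul, ih, Finset.Nat.antidiagonal_succ, Finset.sum_cons, Finset.sum_map,
      Finset.mul_sum, word_zero, ← word_succ]
    congr 1
    · simp
    · refine Finset.sum_congr rfl fun ij _ => ?_
      rw [Algebra.TensorProduct.tmul_mul_tmul, ← word_succ, one_mul]
      simp [add_assoc, add_comm 1]

variable (M : ∀ p q : ℕ,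
  MultilinearMap K (fun _ : Fin p => R) (MultilinearMap K (fun _ : Fin q => R) R))

/-- The linear map on `T(R) ⊗ T(R)` assembled from multilinear operations. -/
noncomputable def opLin : TensorAlgebra K R ⊗[K] TensorAlgebra K R →ₗ[K] R :=
  TensorProduct.lift ((DirectSum.toModule K ℕ ((⨁ q, ⨂[K]^q R) →ₗ[K] R) fun p =>
    (DirectSum.toModule K ℕ ((⨂[K]^p R) →ₗ[K] R) fun q =>
      (PiTensorProduct.lift ((PiTensorProduct.lift (R := K) (s := fun _ : Fin q => R)
        (E := R)).toLinearMap.compMultilinearMap (M p q))).flip).flip).compl₁₂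
    (equivDirectSum (R := K) (M := R)).toLinearMap (equivDirectSum (R := K) (M := R)).toLinearMap)

theorem opLin_tprod (p q : ℕ) (a : Fin p → R) (b : Fin q → R) :
    opLin M (tprod K R p a ⊗ₜ tprod K R q b) = M p q a b := by
  have h : ∀ (n : ℕ) (a : Fin n → R), (equivDirectSum (R := K) (M := R)).toLinearMap
      (tprod K R n a) = DirectSum.lof K ℕ (fun n => ⨂[K]^n R) n (PiTensorProduct.tprod K a) :=
    fun n a => toDirectSum_tensorPower_tprod a
  rw [opLin, TensorProduct.lift.tmul, LinearMap.compl₁₂_apply, h, h, DirectSum.toModule_lof,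
    LinearMap.flip_apply, DirectSum.toModule_lof, LinearMap.flip_apply, PiTensorProduct.lift.tprod]
  exact PiTensorProduct.lift.tprod b

theorem opLin_word (p q : ℕ) (x y : ℕ → R) :
    opLin M (word K p x ⊗ₜ word K q y) = M p q (fun i => x i) fun j => y j :=
  opLin_tprod M p q _ _

variable {M}

theorem opLin_one (hM : ∀ a b, M 0 0 a b = 0) : opLin M ((1 : TensorAlgebra K R) ⊗ₜ 1) = 0 := by
  rw [← word_zero 0, opLin_word]
  exact hM _ _

variable (K R) in
theorem isConilpotent_tensor :
    IsConilpotent K ((1 : TensorAlgebra K R) ⊗ₜ[K] (1 : TensorAlgebra K R)) :=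
  isConilpotent.tmul isConilpotent

/-- The product on the tensor algebra cogenerated by multilinear operations, a morphism of
coalgebras. -/
noncomputable def starHom (hM : ∀ a b, M 0 0 a b = 0) :
    TensorAlgebra K R ⊗[K] TensorAlgebra K R →ₗc[K] TensorAlgebra K R :=
  { (cogen (isConilpotent_tensor K R) (opLin_one hM)).ofConv with
    counit_comp := LinearMap.ext (counit_cogen (isConilpotent_tensor K R) (opLin_one hM))
    map_comp_comul := LinearMap.ext fun x =>
      (comul_cogen (isConilpotent_tensor K R) (opLin_one hM) x).symm }

theorem starHom_eq (hM : ∀ a b, M 0 0 a b = 0) :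
    toConv (starHom hM).toLinearMap =
      1 + toConv (ι K ∘ₗ opLin M) * toConv (starHom hM).toLinearMap :=
  cogen_eq (isConilpotent_tensor K R) (opLin_one hM)

theorem proj_starHom (hM : ∀ a b, M 0 0 a b = 0) (X : TensorAlgebra K R ⊗[K] TensorAlgebra K R) :
    proj K R (starHom hM X) = opLin M X :=
  proj_cogen (isConilpotent_tensor K R) (opLin_one hM) X

/-- The coproduct of a pair of words cuts both of them. The `l`-th power therefore cuts them into
`l` consecutive pairs of possibly empty blocks and applies one operation to each pair, as in the
inner sums of the `B∞`-relations. -/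
theorem conv_pow_opLin_word (l i j : ℕ) (x y : ℕ → R) :
    ((toConv (ι K ∘ₗ opLin M) : WithConv (_ →ₗ[K] TensorAlgebra K R)) ^ l)
        (word K i x ⊗ₜ word K j y) =
      ∑ a ∈ Finset.Nat.antidiagonalTuple l i, ∑ b ∈ Finset.Nat.antidiagonalTuple l j,
        tprod K R l fun m => M (a m) (b m) (block a x m) (block b y m) := by
  induction l generalizing i j x y with
  | zero =>
    rw [pow_zero, LinearMap.convOne_apply, TensorProduct.counit_tmul]
    rcases i with _ | i
    · rcases j with _ | j
      · simp [word_zero, counit_one]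
      · simp [word_succ, counit_mul, counit_ι]
    · simp [word_succ, counit_mul, counit_ι]
  | succ l ih =>
    rw [pow_succ', LinearMap.convMul_apply, TensorProduct.comul_tmul, comul_word, comul_word,
      Finset.Nat.sum_antidiagonalTuple_succ]
    simp only [TensorProduct.sum_tmul, TensorProduct.tmul_sum, map_sum,
      Finset.Nat.sum_antidiagonalTuple_succ]
    rw [Finset.sum_comm]
    refine Finset.sum_congr rfl fun ij _ => ?_
    rw [Finset.sum_comm]
    refine Finset.sum_congr rfl fun kl _ => ?_
    rw [TensorProduct.AlgebraTensorModule.tensorTensorTensorComm_tmul, TensorProduct.map_tmul,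
      LinearMap.mul'_apply, ih, Finset.mul_sum]
    refine Finset.sum_congr rfl fun a _ => ?_
    rw [Finset.mul_sum]
    refine Finset.sum_congr rfl fun b _ => ?_
    rw [tprod_succ]
    simp only [block_cons_succ]
    refine congrArg₂ (· * ·) (congrArg (ι K) ?_) rfl
    refine (opLin_word M _ _ _ _).trans ?_
    change _ = M ij.1 kl.1 (block (Fin.cons ij.1 a : Fin (l + 1) → ℕ) x 0)
      (block (Fin.cons kl.1 b : Fin (l + 1) → ℕ) y 0)
    rw [block_cons_zero, block_cons_zero]

/-- With more pairs of blocks than letters, some pair consists of two empty blocks, where `M_{00} =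
0` applies. -/
theorem conv_pow_opLin_word_eq_zero (hM : ∀ a b, M 0 0 a b = 0) {l i j : ℕ} (hl : i + j < l)
    (x y : ℕ → R) :
    ((toConv (ι K ∘ₗ opLin M) : WithConv (_ →ₗ[K] TensorAlgebra K R)) ^ l)
        (word K i x ⊗ₜ word K j y) = 0 := by
  rw [conv_pow_opLin_word]
  refine Finset.sum_eq_zero fun a ha => Finset.sum_eq_zero fun b hb => ?_
  rw [Finset.Nat.mem_antidiagonalTuple] at ha hb
  have hm : ∃ m, a m = 0 ∧ b m = 0 := by
    by_contra! h
    have : ∑ m : Fin l, 1 ≤ ∑ m, (a m + b m) :=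
      Finset.sum_le_sum fun m _ => by have := h m; omega
    rw [Finset.sum_add_distrib, ha, hb] at this
    simp at this
    omega
  obtain ⟨m, hma, hmb⟩ := hm
  refine (tprod K R l).map_coord_zero m ?_
  -- The types of the blocks depend on their lengths, so the lengths are made variables before they
  -- are replaced by zero.
  have key : ∀ (p q : ℕ) (hp : p = 0) (hq : q = 0) (c : Fin p → R) (d : Fin q → R),
      M p q c d = 0 := by
    rintro _ _ rfl rfl c d
    exact hM c d
  exact key _ _ hma hmb _ _

/-- The geometric series stops at `l = i + j`, and its term `l = 0` vanishes since the words are not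
both empty. The index range is then that of the `B∞`-relations. -/
theorem starHom_word (hM : ∀ a b, M 0 0 a b = 0) {i j : ℕ} (hij : 1 ≤ i + j) (x y : ℕ → R) :
    starHom hM (word K i x ⊗ₜ word K j y) =
      ∑ l ∈ Finset.Icc 1 (i + j), ∑ a ∈ Finset.Nat.antidiagonalTuple l i,
        ∑ b ∈ Finset.Nat.antidiagonalTuple l j,
          tprod K R l fun m => M (a m) (b m) (block a x m) (block b y m) := by
  have h1 : starHom hM (word K i x ⊗ₜ word K j y) =
      ∑ l ∈ Finset.range (i + j + 1),
        ((toConv (ι K ∘ₗ opLin M) : WithConv (_ →ₗ[K] TensorAlgebra K R)) ^ l)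
          (word K i x ⊗ₜ word K j y) :=
    geomConv_apply
      (h := (isConilpotent_tensor K R).pow_eq_zero (ι_comp_apply_eq_zero (opLin_one hM)))
      fun n hn => conv_pow_opLin_word_eq_zero hM hn x y
  have h2 : Finset.Icc 1 (i + j) = Finset.Ico 1 (i + j + 1) := by
    ext
    simp only [Finset.mem_Icc, Finset.mem_Ico]
    omega
  have h3 : ((toConv (ι K ∘ₗ opLin M) : WithConv (_ →ₗ[K] TensorAlgebra K R)) ^ 0)
      (word K i x ⊗ₜ word K j y) = 0 := by
    rw [conv_pow_opLin_word]
    rcases i with _ | i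
    · obtain ⟨j, rfl⟩ : ∃ k, j = k + 1 := ⟨j - 1, by omega⟩
      simp
    · simp
  rw [h1, Finset.range_eq_Ico, Finset.sum_eq_sum_Ico_succ_bot (by omega), h3, zero_add, h2]
  exact Finset.sum_congr rfl fun l _ => conv_pow_opLin_word l i j x y

theorem proj_word (n : ℕ) (x : ℕ → R) : proj K R (word K n x) = if n = 1 then x 0 else 0 := by
  rcases n with _ | _ | n
  · simp [word_zero, proj_one]
  · simp [word_succ, word_zero, proj_ι]
  · simp [word_succ, proj_ι_mul, counit_mul, counit_ι]

variable (K R) in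
/-- The morphism of coalgebras `v ↦ 1 ⊗ v`. -/
noncomputable def oneTmulHom :
    TensorAlgebra K R →ₗc[K] TensorAlgebra K R ⊗[K] TensorAlgebra K R :=
  { TensorProduct.mk K _ _ 1 with
    counit_comp := LinearMap.ext fun v => by
      simp [TensorProduct.counit_tmul, counit_one]
    map_comp_comul := LinearMap.ext fun v => by
      simp only [LinearMap.comp_apply, TensorProduct.mk_apply, TensorProduct.comul_tmul, comul_one]
      generalize comul (R := K) v = X
      induction X with
      | zero => simp
      | add X Y hX hY => simp only [map_add, TensorProduct.tmul_add, hX, hY]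
      | tmul a b => simp }

variable (K R) in
/-- The morphism of coalgebras `v ↦ v ⊗ 1`. -/
noncomputable def tmulOneHom :
    TensorAlgebra K R →ₗc[K] TensorAlgebra K R ⊗[K] TensorAlgebra K R :=
  { (TensorProduct.mk K _ _).flip 1 with
    counit_comp := LinearMap.ext fun v => by
      simp [TensorProduct.counit_tmul, counit_one]
    map_comp_comul := LinearMap.ext fun v => by
      simp only [LinearMap.comp_apply, LinearMap.flip_apply, TensorProduct.mk_apply,
        TensorProduct.comul_tmul, comul_one]
      generalize comul (R := K) v = X
      induction X with
      | zero => simp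
      | add X Y hX hY => simp only [map_add, TensorProduct.add_tmul, hX, hY]
      | tmul a b => simp }

/-- A morphism of coalgebras into the source of `starHom` turns it into a solution of a
fixed point equation. -/
theorem convPre_starHom {C : Type*} [AddCommGroup C] [Module K C] [Coalgebra K C]
    (hM : ∀ a b, M 0 0 a b = 0) (g : C →ₗc[K] TensorAlgebra K R ⊗[K] TensorAlgebra K R) :
    convPre _ g (toConv (starHom hM).toLinearMap) =
      1 + toConv (ι K ∘ₗ opLin M ∘ₗ g.toLinearMap) *
        convPre _ g (toConv (starHom hM).toLinearMap) := by
  nth_rw 1 [starHom_eq]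
  rw [map_add, map_mul, map_one]
  rfl

end

/-! ### The tensor algebra of a `B∞`-algebra as a 2-associative algebra -/

section

variable {K : Type*} [Field K] {R : Type*} [AddCommGroup R] [Module K R] [BInfAlgebra K R]

theorem opLin_one_tmul (v : TensorAlgebra K R) :
    opLin (BInfAlgebra.M (K := K)) (1 ⊗ₜ v) = proj K R v := by
  have h : opLin (BInfAlgebra.M (K := K)) ∘ₗ TensorProduct.mk K _ _ 1 = proj K R := by
    refine linearMap_ext_word fun n x => ?_
    rw [LinearMap.comp_apply, TensorProduct.mk_apply, ← word_zero 0, opLin_word, proj_word]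
    rcases n with _ | _ | n
    · simp [BInfAlgebra.M_zero_zero]
    · simp [BInfAlgebra.M_zero_one]
    · rw [BInfAlgebra.M_zero_right (n + 1 + 1) (by omega)]
      simp
  exact LinearMap.congr_fun h v

theorem opLin_tmul_one (v : TensorAlgebra K R) :
    opLin (BInfAlgebra.M (K := K)) (v ⊗ₜ 1) = proj K R v := by
  have h : opLin (BInfAlgebra.M (K := K)) ∘ₗ (TensorProduct.mk K _ _).flip 1 = proj K R := by
    refine linearMap_ext_word fun n x => ?_
    rw [LinearMap.comp_apply, LinearMap.flip_apply, TensorProduct.mk_apply, ← word_zero 0,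
      opLin_word, proj_word]
    rcases n with _ | _ | n
    · simp [BInfAlgebra.M_zero_zero]
    · simp [BInfAlgebra.M_one_zero]
    · rw [BInfAlgebra.M_left_zero (n + 1 + 1) (by omega)]
      simp
  exact LinearMap.congr_fun h v

variable (K R) in
/-- The product `*` of the tensor algebra of a `B∞`-algebra. -/
noncomputable def starB : TensorAlgebra K R ⊗[K] TensorAlgebra K R →ₗc[K] TensorAlgebra K R :=
  starHom (M := BInfAlgebra.M (K := K)) BInfAlgebra.M_zero_zero

/-- Left multiplication by `1` and the identity both solve `Y = 1 + e * Y`: the conditions on the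
`M_{0n}` say that the projection of `1 * v` is that of `v`. -/
theorem starB_one_tmul (v : TensorAlgebra K R) : starB K R (1 ⊗ₜ v) = v := by
  have h1 := convPre_starHom (M := BInfAlgebra.M (K := K) (R := R)) BInfAlgebra.M_zero_zero
    (oneTmulHom K R)
  have h2 := InfBialgebra.convId_eq K (TensorAlgebra K R)
  rw [idem_eq] at h2
  have h3 : opLin (BInfAlgebra.M (K := K) (R := R)) ∘ₗ (oneTmulHom K R).toLinearMap =
      proj K R := LinearMap.ext opLin_one_tmul
  rw [h3] at h1
  have h4 := isConilpotent.eq_of_eq_add_mul (ι_comp_apply_eq_zero proj_one) h1 h2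
  exact congrArg (fun f : WithConv (TensorAlgebra K R →ₗ[K] TensorAlgebra K R) => f v) h4

theorem starB_tmul_one (v : TensorAlgebra K R) : starB K R (v ⊗ₜ 1) = v := by
  have h1 := convPre_starHom (M := BInfAlgebra.M (K := K) (R := R)) BInfAlgebra.M_zero_zero
    (tmulOneHom K R)
  have h2 := InfBialgebra.convId_eq K (TensorAlgebra K R)
  rw [idem_eq] at h2
  have h3 : opLin (BInfAlgebra.M (K := K) (R := R)) ∘ₗ (tmulOneHom K R).toLinearMap =
      proj K R := LinearMap.ext opLin_tmul_one
  rw [h3] at h1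
  have h4 := isConilpotent.eq_of_eq_add_mul (ι_comp_apply_eq_zero proj_one) h1 h2
  exact congrArg (fun f : WithConv (TensorAlgebra K R →ₗ[K] TensorAlgebra K R) => f v) h4

/-- For three nonempty words this is a defining relation of `B∞`-algebras, read through
`starHom_word`. The relations do not cover empty words, which are settled by the unit laws. -/
theorem opLin_starB_tmul (u v w : TensorAlgebra K R) :
    opLin (BInfAlgebra.M (K := K)) (starB K R (u ⊗ₜ v) ⊗ₜ w) =
      opLin (BInfAlgebra.M (K := K)) (u ⊗ₜ starB K R (v ⊗ₜ w)) := by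
  induction u using induction_word with
  | add u u' h h' => simp only [TensorProduct.add_tmul, map_add, h, h']
  | smul c u h => simp only [← TensorProduct.smul_tmul', map_smul, h]
  | word i x =>
    induction v using induction_word with
    | add u u' h h' => simp only [TensorProduct.add_tmul, TensorProduct.tmul_add, map_add, h, h']
    | smul c u h =>
      simp only [← TensorProduct.smul_tmul', TensorProduct.tmul_smul, map_smul, h]
    | word j y =>
      induction w using induction_word with
      | add u u' h h' => simp only [TensorProduct.tmul_add, map_add, h, h']
      | smul c u h => simp only [TensorProduct.tmul_smul, map_smul, h]
      | word k z =>
        have hproj : ∀ X, proj K R (starB K R X) = opLin (BInfAlgebra.M (K := K)) X :=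
          proj_starHom _
        rcases Nat.eq_zero_or_pos i with rfl | hi
        · rw [word_zero, starB_one_tmul, opLin_one_tmul, hproj]
        rcases Nat.eq_zero_or_pos j with rfl | hj
        · rw [word_zero, starB_one_tmul, starB_tmul_one]
        rcases Nat.eq_zero_or_pos k with rfl | hk
        · rw [word_zero, starB_tmul_one, opLin_tmul_one, hproj]
        rw [starB, starHom_word _ (by omega), starHom_word _ (by omega)]
        simp only [TensorProduct.sum_tmul, TensorProduct.tmul_sum, map_sum]
        have h := BInfAlgebra.relation (K := K) i j k hi hj hk x y z
        refine Eq.trans ?_ (h.trans ?_)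
        · refine Finset.sum_congr rfl fun l _ => Finset.sum_congr rfl fun a _ =>
            Finset.sum_congr rfl fun b _ => opLin_tprod _ _ _ _ _
        · refine Finset.sum_congr rfl fun l _ => Finset.sum_congr rfl fun a _ =>
            Finset.sum_congr rfl fun b _ => (opLin_tprod _ _ _ _ _).symm

/-- Both bracketings are morphisms of coalgebras from the triple tensor product to the tensor
algebra with the same projection to `R`, so they solve the same fixed point equation. -/
theorem starB_assoc (u v w : TensorAlgebra K R) :
    starB K R (starB K R (u ⊗ₜ v) ⊗ₜ w) = starB K R (u ⊗ₜ starB K R (v ⊗ₜ w)) := by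
  have h1 := convPre_starHom (C := TensorAlgebra K R ⊗[K] TensorAlgebra K R ⊗[K] TensorAlgebra K R)
    (M := BInfAlgebra.M (K := K) (R := R)) BInfAlgebra.M_zero_zero
    (Coalgebra.TensorProduct.map (starB K R) (CoalgHom.id K (TensorAlgebra K R)))
  have h2 := convPre_starHom (C := TensorAlgebra K R ⊗[K] TensorAlgebra K R ⊗[K] TensorAlgebra K R)
    (M := BInfAlgebra.M (K := K) (R := R)) BInfAlgebra.M_zero_zero
    ((Coalgebra.TensorProduct.map (CoalgHom.id K (TensorAlgebra K R)) (starB K R)).comp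
      (Coalgebra.TensorProduct.assoc K K (TensorAlgebra K R) (TensorAlgebra K R)
        (TensorAlgebra K R)).toCoalgHom)
  have h3 : opLin (BInfAlgebra.M (K := K) (R := R)) ∘ₗ
      (Coalgebra.TensorProduct.map (starB K R) (CoalgHom.id K (TensorAlgebra K R))).toLinearMap =
      opLin (BInfAlgebra.M (K := K) (R := R)) ∘ₗ
        ((Coalgebra.TensorProduct.map (CoalgHom.id K (TensorAlgebra K R)) (starB K R)).comp
        (Coalgebra.TensorProduct.assoc K K (TensorAlgebra K R) (TensorAlgebra K R)
        (TensorAlgebra K R)).toCoalgHom).toLinearMap :=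
    TensorProduct.ext_threefold fun u v w => opLin_starB_tmul u v w
  rw [h3] at h1
  have h0 : opLin (BInfAlgebra.M (K := K) (R := R)) (starB K R (1 ⊗ₜ 1) ⊗ₜ 1) = 0 := by
    rw [starB_one_tmul, opLin_one_tmul, proj_one]
  have h5 := (LinearMap.congr_fun h3 ((1 ⊗ₜ 1) ⊗ₜ 1)).symm.trans h0
  have h4 := ((isConilpotent_tensor K R).tmul isConilpotent).eq_of_eq_add_mul
    (ι_comp_apply_eq_zero h5) h1 h2
  exact LinearMap.congr_fun (congrArg WithConv.ofConv h4) ((u ⊗ₜ v) ⊗ₜ w)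

noncomputable instance : TwoAssocAlgebra K (TensorAlgebra K R) where
  one := 1
  star := TensorProduct.curry (starB K R).toLinearMap
  dot := LinearMap.mul K _
  star_assoc := starB_assoc
  dot_assoc := mul_assoc
  one_star := starB_one_tmul
  star_one := starB_tmul_one
  one_dot := one_mul
  dot_one := mul_one

end

end TensorAlgebra

/-! ## Coassociativity and counits for products -/

section

variable {K : Type*} [Field K] {A : Type*} [AddCommGroup A] [Module K A] [TwoAssocAlgebra K A]
  {Δ : A →ₗ[K] A ⊗[K] A} {c : A →ₗ[K] K}

/-- Together with `lTensor_star_of`: both iterated coproducts are multiplicative for the factorwise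
product `*` on the triple tensor product, so coassociativity at `x` and `y` implies it at `x * y`.
-/
theorem assoc_rTensor_star_of
    (hΔ : ∀ x y, Δ (TwoAssocAlgebra.star (K := K) x y) = tensorStar K _ (Δ x) (Δ y))
    (X Y : A ⊗[K] A) :
    TensorProduct.assoc K _ _ _ (Δ.rTensor _ (tensorStar K _ X Y)) =
      TensorProduct.map₂ TwoAssocAlgebra.star (tensorStar K _)
        (TensorProduct.assoc K _ _ _ (Δ.rTensor _ X))
        (TensorProduct.assoc K _ _ _ (Δ.rTensor _ Y)) := by
  induction X with
  | zero => simp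
  | add X X' h h' => simp only [map_add, LinearMap.add_apply, h, h']
  | tmul a b =>
    induction Y with
    | zero => simp
    | add X X' h h' => simp only [map_add, h, h']
    | tmul c d =>
      rw [tensorStar_tmul, LinearMap.rTensor_tmul, LinearMap.rTensor_tmul, LinearMap.rTensor_tmul,
        hΔ]
      generalize Δ a = X
      generalize Δ c = Y
      induction X with
      | zero => simp
      | add X X' h h' => simp only [map_add, LinearMap.add_apply, TensorProduct.add_tmul, h, h']
      | tmul p q =>
        induction Y with
        | zero => simp
        | add X X' h h' => simp only [map_add, TensorProduct.add_tmul, h, h']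
        | tmul r s => rfl

theorem lTensor_star_of
    (hΔ : ∀ x y, Δ (TwoAssocAlgebra.star (K := K) x y) = tensorStar K _ (Δ x) (Δ y))
    (X Y : A ⊗[K] A) :
    Δ.lTensor _ (tensorStar K _ X Y) =
      TensorProduct.map₂ TwoAssocAlgebra.star (tensorStar K _)
        (Δ.lTensor _ X) (Δ.lTensor _ Y) := by
  induction X with
  | zero => simp
  | add X X' h h' => simp only [map_add, LinearMap.add_apply, h, h']
  | tmul a b =>
    induction Y with
    | zero => simp
    | add X X' h h' => simp only [map_add, h, h']
    | tmul c d =>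
      rw [tensorStar_tmul, LinearMap.lTensor_tmul, hΔ]
      rfl


theorem lid_rTensor_star
    (hc : ∀ x y, c (TwoAssocAlgebra.star (K := K) x y) = c x * c y) (X Y : A ⊗[K] A) :
    TensorProduct.lid K _ (c.rTensor _ (tensorStar K _ X Y)) =
      TwoAssocAlgebra.star (K := K) (TensorProduct.lid K _ (c.rTensor _ X))
        (TensorProduct.lid K _ (c.rTensor _ Y)) := by
  induction X with
  | zero => simp
  | add X X' h h' => simp only [map_add, LinearMap.add_apply, h, h']
  | tmul a b =>
    induction Y with
    | zero => simp
    | add X X' h h' => simp only [map_add, h, h']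
    | tmul p q => simp [tensorStar_tmul, hc, smul_smul, mul_comm]

theorem rid_lTensor_star
    (hc : ∀ x y, c (TwoAssocAlgebra.star (K := K) x y) = c x * c y) (X Y : A ⊗[K] A) :
    TensorProduct.rid K _ (c.lTensor _ (tensorStar K _ X Y)) =
      TwoAssocAlgebra.star (K := K) (TensorProduct.rid K _ (c.lTensor _ X))
        (TensorProduct.rid K _ (c.lTensor _ Y)) := by
  induction X with
  | zero => simp
  | add X X' h h' => simp only [map_add, LinearMap.add_apply, h, h']
  | tmul a b =>
    induction Y with
    | zero => simp
    | add X X' h h' => simp only [map_add, h, h']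
    | tmul p q => simp [tensorStar_tmul, hc, smul_smul, mul_comm]

end

section

variable {K : Type*} [Field K] {A : Type*} [Ring A] [Algebra K A]
  {Δ : A →ₗ[K] A ⊗[K] A} {c : A →ₗ[K] K}

theorem assoc_rTensor_mul_left
    (hΔ : ∀ x y, Δ (x * y) = (x ⊗ₜ 1) * Δ y + Δ x * (1 ⊗ₜ y) - x ⊗ₜ y)
    (x : A)
    (Y : A ⊗[K] A) :
    TensorProduct.assoc K _ _ _ (Δ.rTensor _ ((x ⊗ₜ 1) * Y)) =
      (x ⊗ₜ (1 ⊗ₜ 1)) * TensorProduct.assoc K _ _ _ (Δ.rTensor _ Y) +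
        TensorProduct.assoc K _ _ _ (Δ x ⊗ₜ 1) * (1 ⊗ₜ Y) - x ⊗ₜ Y := by
  induction Y with
  | zero => simp
  | add X X' h h' =>
    simp only [mul_add, map_add, h, h', TensorProduct.tmul_add]
    abel
  | tmul a b =>
    rw [Algebra.TensorProduct.tmul_mul_tmul, one_mul, LinearMap.rTensor_tmul,
      LinearMap.rTensor_tmul, hΔ, TensorProduct.sub_tmul, TensorProduct.add_tmul, map_sub,
      map_add]
    refine congrArg₂ (· - ·) (congrArg₂ (· + ·) ?_ ?_) (TensorProduct.assoc_tmul ..)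
    · generalize Δ a = X
      induction X with
      | zero => simp
      | add X X' h h' => simp only [mul_add, map_add, TensorProduct.add_tmul, h, h']
      | tmul p q => simp
    · generalize Δ x = X
      induction X with
      | zero => simp
      | add X X' h h' => simp only [add_mul, map_add, TensorProduct.add_tmul, h, h']
      | tmul p q => simp

theorem assoc_rTensor_mul_right (y : A)
    (X : A ⊗[K] A) :
    TensorProduct.assoc K _ _ _ (Δ.rTensor _ (X * (1 ⊗ₜ y))) =
      TensorProduct.assoc K _ _ _ (Δ.rTensor _ X) * (1 ⊗ₜ (1 ⊗ₜ y)) := by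
  induction X with
  | zero => simp
  | add X X' h h' => simp only [add_mul, map_add, h, h']
  | tmul a b =>
    rw [Algebra.TensorProduct.tmul_mul_tmul, mul_one, LinearMap.rTensor_tmul,
      LinearMap.rTensor_tmul]
    generalize Δ a = X
    induction X with
    | zero => simp
    | add X X' h h' => simp only [add_mul, map_add, TensorProduct.add_tmul, h, h']
    | tmul p q => simp

theorem lTensor_mul_left (x : A)
    (Y : A ⊗[K] A) :
    Δ.lTensor _ ((x ⊗ₜ 1) * Y) = (x ⊗ₜ (1 ⊗ₜ 1)) * Δ.lTensor _ Y := by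
  induction Y with
  | zero => simp
  | add X X' h h' => simp only [mul_add, map_add, h, h']
  | tmul a b => simp [← Algebra.TensorProduct.one_def]

theorem lTensor_mul_right
    (hΔ : ∀ x y, Δ (x * y) = (x ⊗ₜ 1) * Δ y + Δ x * (1 ⊗ₜ y) - x ⊗ₜ y)
    (y : A)
    (X : A ⊗[K] A) :
    Δ.lTensor _ (X * (1 ⊗ₜ y)) =
      TensorProduct.assoc K _ _ _ (X ⊗ₜ 1) * (1 ⊗ₜ Δ y) +
        Δ.lTensor _ X * (1 ⊗ₜ (1 ⊗ₜ y)) - TensorProduct.assoc K _ _ _ (X ⊗ₜ y) := by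
  induction X with
  | zero => simp
  | add X X' h h' =>
    simp only [add_mul, map_add, h, h', TensorProduct.add_tmul]
    abel
  | tmul a b =>
    rw [Algebra.TensorProduct.tmul_mul_tmul, mul_one, LinearMap.lTensor_tmul,
      LinearMap.lTensor_tmul, hΔ, TensorProduct.tmul_sub, TensorProduct.tmul_add]
    simp

/-- Write `Δ²` for the common value of the iterated coproducts at `x` and at `y`. Both iterated
coproducts of `xy` are `(x ⊗ 1 ⊗ 1) Δ²(y) + Δ²(x) (1 ⊗ 1 ⊗ y) + (Δ(x) ⊗ 1)(1 ⊗ Δ(y)) - x ⊗ Δ(y) -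
Δ(x) ⊗ y`. -/
theorem coassoc_mul
    (hΔ : ∀ x y, Δ (x * y) = (x ⊗ₜ 1) * Δ y + Δ x * (1 ⊗ₜ y) - x ⊗ₜ y)
    {x y : A} (hx : TensorProduct.assoc K _ _ _ (Δ.rTensor _ (Δ x)) = Δ.lTensor _ (Δ x))
    (hy : TensorProduct.assoc K _ _ _ (Δ.rTensor _ (Δ y)) = Δ.lTensor _ (Δ y)) :
    TensorProduct.assoc K _ _ _ (Δ.rTensor _ (Δ (x * y))) = Δ.lTensor _ (Δ (x * y)) := by
  rw [hΔ, map_sub, map_add, map_sub, map_add, map_sub, map_add,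
    assoc_rTensor_mul_left hΔ, assoc_rTensor_mul_right, lTensor_mul_left,
    lTensor_mul_right hΔ, hx, hy, LinearMap.rTensor_tmul, LinearMap.lTensor_tmul]
  abel

theorem lid_rTensor_mul
    (hΔ : ∀ x y, Δ (x * y) = (x ⊗ₜ 1) * Δ y + Δ x * (1 ⊗ₜ y) - x ⊗ₜ y)
    (hc : ∀ x y, c (x * y) = c x * c y)
    {x y : A} (hx : TensorProduct.lid K _ (c.rTensor _ (Δ x)) = x)
    (hy : TensorProduct.lid K _ (c.rTensor _ (Δ y)) = y) :
    TensorProduct.lid K _ (c.rTensor _ (Δ (x * y))) = x * y := by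
  have h1 : ∀ Y : A ⊗[K] A, TensorProduct.lid K _ (c.rTensor _ ((x ⊗ₜ 1) * Y)) =
      c x • TensorProduct.lid K _ (c.rTensor _ Y) := by
    intro Y
    induction Y with
    | zero => simp
    | add X X' h h' => simp only [mul_add, map_add, smul_add, h, h']
    | tmul p q => simp [hc, mul_smul]
  have h2 : ∀ X : A ⊗[K] A, TensorProduct.lid K _ (c.rTensor _ (X * (1 ⊗ₜ y))) =
      TensorProduct.lid K _ (c.rTensor _ X) * y := by
    intro X
    induction X with
    | zero => simp
    | add X X' h h' => simp only [add_mul, map_add, h, h']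
    | tmul p q => simp
  rw [hΔ, map_sub, map_add, map_sub, map_add, h1, h2, hx, hy]
  simp

theorem rid_lTensor_mul
    (hΔ : ∀ x y, Δ (x * y) = (x ⊗ₜ 1) * Δ y + Δ x * (1 ⊗ₜ y) - x ⊗ₜ y)
    (hc : ∀ x y, c (x * y) = c x * c y)
    {x y : A} (hx : TensorProduct.rid K _ (c.lTensor _ (Δ x)) = x)
    (hy : TensorProduct.rid K _ (c.lTensor _ (Δ y)) = y) :
    TensorProduct.rid K _ (c.lTensor _ (Δ (x * y))) = x * y := by
  have h1 : ∀ Y : A ⊗[K] A, TensorProduct.rid K _ (c.lTensor _ ((x ⊗ₜ 1) * Y)) =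
      x * TensorProduct.rid K _ (c.lTensor _ Y) := by
    intro Y
    induction Y with
    | zero => simp
    | add X X' h h' => simp only [mul_add, map_add, h, h']
    | tmul p q => simp
  have h2 : ∀ X : A ⊗[K] A, TensorProduct.rid K _ (c.lTensor _ (X * (1 ⊗ₜ y))) =
      c y • TensorProduct.rid K _ (c.lTensor _ X) := by
    intro X
    induction X with
    | zero => simp
    | add X X' h h' => simp only [add_mul, map_add, smul_add, h, h']
    | tmul p q => simp [hc, mul_comm, mul_smul]
  rw [hΔ, map_sub, map_add, map_sub, map_add, h1, h2, hx, hy]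
  simp

end

/-! ## The free 2-associative algebra as an infinitesimal bialgebra -/

namespace FreeTwoAssoc

section

variable {K : Type u} {V : Type v} [Field K] [AddCommGroup V] [Module K V]

/-- The ring multiplication is `·`, the product that enters the convolution and the infinitesimal
relation; `*` remains an additional bilinear map. -/
instance : Ring (FreeTwoAssoc K V) :=
  { (inferInstance : AddCommGroup (FreeTwoAssoc K V)) with
    mul := fun x y => TwoAssocAlgebra.dot (K := K) x y
    one := TwoAssocAlgebra.one K
    mul_assoc := TwoAssocAlgebra.dot_assoc
    one_mul := TwoAssocAlgebra.one_dot
    mul_one := TwoAssocAlgebra.dot_one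
    left_distrib := fun x y z => map_add (TwoAssocAlgebra.dot (K := K) x) y z
    right_distrib := fun x y z => LinearMap.map_add₂ (TwoAssocAlgebra.dot (K := K)) x y z
    zero_mul := fun x => LinearMap.map_zero₂ (TwoAssocAlgebra.dot (K := K)) x
    mul_zero := fun x => map_zero (TwoAssocAlgebra.dot (K := K) x) }

instance : Algebra K (FreeTwoAssoc K V) :=
  Algebra.ofModule (fun c x y => LinearMap.map_smul₂ (TwoAssocAlgebra.dot (K := K)) c x y)
    fun c x y => map_smul (TwoAssocAlgebra.dot (K := K) x) c y

theorem dot_eq_mul (x y : FreeTwoAssoc K V) : TwoAssocAlgebra.dot (K := K) x y = x * y := rfl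

theorem one_eq : (TwoAssocAlgebra.one K : FreeTwoAssoc K V) = 1 := rfl

theorem induction {P : FreeTwoAssoc K V → Prop} (of : ∀ v, P (ι K v)) (one : P 1)
    (add : ∀ x y, P x → P y → P (x + y)) (smul : ∀ (c : K) x, P x → P (c • x))
    (star : ∀ x y, P x → P y → P (TwoAssocAlgebra.star (K := K) x y))
    (mul : ∀ x y, P x → P y → P (x * y)) (x : FreeTwoAssoc K V) : P x := by
  obtain ⟨t, rfl⟩ := Quotient.exists_rep x
  change P (mk t)
  induction t with
  | of x => exact of x
  | zero => simpa [mk_zero] using smul 0 1 one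
  | one => exact one
  | add s t h h' => exact add _ _ h h'
  | smul r t h => exact smul _ _ h
  | star s t h h' => exact star _ _ h h'
  | dot s t h h' => exact mul _ _ h h'

theorem tensorDot_eq_mul (X Y : FreeTwoAssoc K V ⊗[K] FreeTwoAssoc K V) :
    tensorDot K _ X Y = X * Y := by
  induction X with
  | zero => simp
  | add X X' h h' => rw [map_add, LinearMap.add_apply, h, h', add_mul]
  | tmul a b =>
    induction Y with
    | zero => simp
    | add X X' h h' => rw [map_add, h, h', mul_add]
    | tmul c d => rw [tensorDot_tmul, Algebra.TensorProduct.tmul_mul_tmul]; rfl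

theorem comul_mul' (x y : FreeTwoAssoc K V) : comul K V (x * y) =
    (x ⊗ₜ 1) * comul K V y + comul K V x * (1 ⊗ₜ y) - x ⊗ₜ y := by
  rw [← tensorDot_eq_mul, ← tensorDot_eq_mul]
  exact comul_dot x y

theorem counit_mul' (x y : FreeTwoAssoc K V) : counit K V (x * y) = counit K V x * counit K V y :=
  lift_dot _ x y

theorem counit_star (x y : FreeTwoAssoc K V) :
    counit K V (TwoAssocAlgebra.star (K := K) x y) = counit K V x * counit K V y :=
  lift_star _ x y

theorem counit_one' : counit K V 1 = 1 := rfl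

theorem counit_ι (x : V) : counit K V (ι K x) = 0 := rfl


noncomputable instance : Coalgebra K (FreeTwoAssoc K V) where
  comul := comul K V
  counit := counit K V
  coassoc := by
    refine LinearMap.ext fun x => ?_
    simp only [LinearMap.comp_apply, LinearEquiv.coe_coe]
    induction x using induction with
    | of v =>
      rw [comul_ι, map_add, map_add, map_add]
      simp only [LinearMap.rTensor_tmul, LinearMap.lTensor_tmul, comul_ι, comul_one,
        TensorProduct.add_tmul, TensorProduct.tmul_add, map_add, TensorProduct.assoc_tmul]
      abel
    | one => rfl
    | add x y h h' => simp only [map_add, h, h']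
    | smul c x h => simp only [map_smul, h]
    | star x y h h' =>
      rw [comul_star, assoc_rTensor_star_of comul_star, lTensor_star_of comul_star, h, h']
    | mul x y h h' => exact coassoc_mul comul_mul' h h'
  rTensor_counit_comp_comul := by
    refine LinearMap.ext fun x => ?_
    refine (TensorProduct.lid K _).injective ?_
    simp only [LinearMap.comp_apply, TensorProduct.mk_apply, TensorProduct.lid_tmul, one_smul]
    induction x using induction with
    | of v => rw [comul_ι]; simp [counit_ι, one_eq, counit_one']
    | one => rw [← one_eq, comul_one]; simp [one_eq, counit_one']
    | add x y h h' => simp only [map_add, h, h']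
    | smul c x h => simp only [map_smul, h]
    | star x y h h' => rw [comul_star, lid_rTensor_star counit_star, h, h']
    | mul x y h h' => exact lid_rTensor_mul comul_mul' counit_mul' h h'
  lTensor_counit_comp_comul := by
    refine LinearMap.ext fun x => ?_
    refine (TensorProduct.rid K _).injective ?_
    simp only [LinearMap.comp_apply, LinearMap.flip_apply, TensorProduct.mk_apply,
      TensorProduct.rid_tmul, one_smul]
    induction x using induction with
    | of v => rw [comul_ι]; simp [counit_ι, one_eq, counit_one']
    | one => rw [← one_eq, comul_one]; simp [one_eq, counit_one']
    | add x y h h' => simp only [map_add, h, h']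
    | smul c x h => simp only [map_smul, h]
    | star x y h h' => rw [comul_star, rid_lTensor_star counit_star, h, h']
    | mul x y h h' => exact rid_lTensor_mul comul_mul' counit_mul' h h'

end

end FreeTwoAssoc

/-! ## Gradings of the free 2-associative algebra -/

theorem map₂_mem_tensorGrading {K G A : Type*} [Field K] [AddCommMonoid G] [AddCommGroup A]
    [Module K A] {C : G → Submodule K A} {f : A →ₗ[K] A →ₗ[K] A}
    (hf : ∀ {i j : G} {x y : A}, x ∈ C i → y ∈ C j → f x y ∈ C (i + j)) {g h : G}
    {X Y : A ⊗[K] A} (hX : X ∈ tensorGrading C C g) (hY : Y ∈ tensorGrading C C h) :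
    TensorProduct.map₂ f f X Y ∈ tensorGrading C C (g + h) := by
  have key : tensorGrading C C g ≤ Submodule.comap (TensorProduct.map₂ f f).flip.flip
      (⨅ Z ∈ tensorGrading C C h,
        Submodule.comap (LinearMap.applyₗ Z) (tensorGrading C C (g + h))) := by
    refine tensorGrading_le fun i j hij a ha b hb => ?_
    simp only [Submodule.mem_comap, Submodule.mem_iInf]
    change ∀ Z ∈ tensorGrading C C h, TensorProduct.map₂ f f (a ⊗ₜ b) Z ∈ _
    suffices tensorGrading C C h ≤ Submodule.comap (TensorProduct.map₂ f f (a ⊗ₜ b))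
      (tensorGrading C C (g + h)) from fun Z hZ => this hZ
    refine tensorGrading_le fun i' j' hij' a' ha' b' hb' => ?_
    refine tmul_mem_tensorGrading (i := i + i') (j := j + j') ?_ (hf ha ha') (hf hb hb')
    rw [← hij, ← hij']
    abel
  have := key hX
  simp only [Submodule.mem_comap, Submodule.mem_iInf] at this
  exact this Y hY

namespace FreeTwoAssoc

section

variable {K : Type u} {V : Type v} [Field K] [AddCommGroup V] [Module K V]
variable {I G : Type*} [AddCommMonoid G]

/-- `IsMonomial b wt d x` says that `x` is obtained from the elements `b i` by iterated
multiplications, and that `d` is the total weight of the factors. -/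
inductive IsMonomial (b : I → V) (wt : I → G) : G → FreeTwoAssoc K V → Prop
  | one : IsMonomial b wt 0 1
  | of (i : I) : IsMonomial b wt (wt i) (ι K (b i))
  | star {d d' x y} : IsMonomial b wt d x → IsMonomial b wt d' y →
      IsMonomial b wt (d + d') (TwoAssocAlgebra.star (K := K) x y)
  | mul {d d' x y} : IsMonomial b wt d x → IsMonomial b wt d' y →
      IsMonomial b wt (d + d') (x * y)

variable (K)

/-- The subspace spanned by the monomials of given weight. -/
def gr (b : I → V) (wt : I → G) (d : G) : Submodule K (FreeTwoAssoc K V) :=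
  Submodule.span K {x | IsMonomial b wt d x}

variable {K} {b : I → V} {wt : I → G}

theorem IsMonomial.mem_gr {d : G} {x : FreeTwoAssoc K V} (h : IsMonomial b wt d x) :
    x ∈ gr K b wt d :=
  Submodule.subset_span h

theorem star_mem_gr {d d' : G} {x y : FreeTwoAssoc K V} (hx : x ∈ gr K b wt d)
    (hy : y ∈ gr K b wt d') : TwoAssocAlgebra.star (K := K) x y ∈ gr K b wt (d + d') := by
  have h := Submodule.apply_mem_map₂ (TwoAssocAlgebra.star (K := K) (A := FreeTwoAssoc K V)) hx hy
  rw [gr, gr, Submodule.map₂_span_span] at h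
  refine Submodule.span_mono ?_ h
  rintro _ ⟨x, hx, y, hy, rfl⟩
  exact .star hx hy

theorem mul_mem_gr {d d' : G} {x y : FreeTwoAssoc K V} (hx : x ∈ gr K b wt d)
    (hy : y ∈ gr K b wt d') : x * y ∈ gr K b wt (d + d') := by
  have h := Submodule.apply_mem_map₂ (TwoAssocAlgebra.dot (K := K) (A := FreeTwoAssoc K V)) hx hy
  rw [gr, gr, Submodule.map₂_span_span] at h
  refine Submodule.span_mono ?_ h
  rintro _ ⟨x, hx, y, hy, rfl⟩
  exact .mul hx hy

theorem one_mem_gr : (1 : FreeTwoAssoc K V) ∈ gr K b wt 0 := IsMonomial.one.mem_gr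

theorem tensorStar_mem {d d' : G} {X Y : FreeTwoAssoc K V ⊗[K] FreeTwoAssoc K V}
    (hX : X ∈ tensorGrading (gr K b wt) (gr K b wt) d)
    (hY : Y ∈ tensorGrading (gr K b wt) (gr K b wt) d') :
    tensorStar K _ X Y ∈ tensorGrading (gr K b wt) (gr K b wt) (d + d') :=
  map₂_mem_tensorGrading (f := TwoAssocAlgebra.star) (fun h h' => star_mem_gr h h') hX hY

theorem tensorDot_mem {d d' : G} {X Y : FreeTwoAssoc K V ⊗[K] FreeTwoAssoc K V}
    (hX : X ∈ tensorGrading (gr K b wt) (gr K b wt) d)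
    (hY : Y ∈ tensorGrading (gr K b wt) (gr K b wt) d') :
    tensorDot K _ X Y ∈ tensorGrading (gr K b wt) (gr K b wt) (d + d') :=
  map₂_mem_tensorGrading (f := TwoAssocAlgebra.dot) (fun h h' => mul_mem_gr h h') hX hY

theorem one_mem_gr' : (TwoAssocAlgebra.one K : FreeTwoAssoc K V) ∈ gr K b wt 0 := one_mem_gr

theorem comul_mem_of_isMonomial {d : G} {x : FreeTwoAssoc K V} (hx : IsMonomial b wt d x) :
    comul K V x ∈ tensorGrading (gr K b wt) (gr K b wt) d := by
  induction hx with
  | one => exact tmul_mem_tensorGrading (add_zero 0) one_mem_gr' one_mem_gr'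
  | of i =>
    rw [comul_ι]
    exact add_mem (tmul_mem_tensorGrading (add_zero _) (IsMonomial.of i).mem_gr one_mem_gr')
      (tmul_mem_tensorGrading (zero_add _) one_mem_gr' (IsMonomial.of i).mem_gr)
  | star hx hy h h' =>
    rw [comul_star]
    exact tensorStar_mem h h'
  | @mul d d' x y hx hy h h' =>
    rw [← dot_eq_mul, comul_dot]
    have h1 := tensorDot_mem (tmul_mem_tensorGrading (add_zero d) hx.mem_gr one_mem_gr') h'
    have h2 := tensorDot_mem h (tmul_mem_tensorGrading (zero_add d') one_mem_gr' hy.mem_gr)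
    exact sub_mem (add_mem h1 h2) (tmul_mem_tensorGrading rfl hx.mem_gr hy.mem_gr)

theorem comul_mem_tensorGrading {d : G} {x : FreeTwoAssoc K V} (hx : x ∈ gr K b wt d) :
    comul K V x ∈ tensorGrading (gr K b wt) (gr K b wt) d :=
  Submodule.span_le (p := Submodule.comap (comul K V)
    (tensorGrading (gr K b wt) (gr K b wt) d)).2 (fun _ hx => comul_mem_of_isMonomial hx) hx

theorem iSup_gr (hb : Submodule.span K (Set.range b) = ⊤) : ⨆ d, gr K b wt d = ⊤ := by
  have hbil : ∀ f : FreeTwoAssoc K V →ₗ[K] FreeTwoAssoc K V →ₗ[K] FreeTwoAssoc K V,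
      (∀ {d d' x y}, x ∈ gr K b wt d → y ∈ gr K b wt d' → f x y ∈ gr K b wt (d + d')) →
      ∀ x y, x ∈ ⨆ d, gr K b wt d → y ∈ ⨆ d, gr K b wt d → f x y ∈ ⨆ d, gr K b wt d := by
    intro f hf x y hx hy
    have := Submodule.apply_mem_map₂ f hx hy
    rw [Submodule.map₂_iSup_left] at this
    refine (iSup_le fun d => ?_ : _ ≤ ⨆ d, gr K b wt d) this
    rw [Submodule.map₂_iSup_right]
    refine iSup_le fun d' => ?_
    exact (Submodule.map₂_le.2 fun x hx y hy => hf hx hy).trans (le_iSup (gr K b wt) (d + d'))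
  rw [eq_top_iff]
  rintro x -
  induction x using induction with
  | of v =>
    have : Submodule.span K (Set.range b) ≤ (⨆ d, gr K b wt d).comap (ι K) := by
      rw [Submodule.span_le]
      rintro _ ⟨i, rfl⟩
      exact Submodule.mem_iSup_of_mem (wt i) (IsMonomial.of i).mem_gr
    exact this (hb ▸ Submodule.mem_top)
  | one => exact Submodule.mem_iSup_of_mem 0 one_mem_gr
  | add x y hx hy => exact add_mem hx hy
  | smul c x hx => exact Submodule.smul_mem _ _ hx
  | star x y hx hy => exact hbil _ star_mem_gr _ _ hx hy
  | mul x y hx hy => exact hbil TwoAssocAlgebra.dot mul_mem_gr _ _ hx hy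

/-- For general weights, degree zero does not force a monomial to be `1`, so the dichotomy is about
the monomial. It shows that `u c` preserves every such grading, and hence so does `e`. -/
theorem IsMonomial.counit_eq_zero_or {d : G} {x : FreeTwoAssoc K V} (h : IsMonomial b wt d x) :
    counit K V x = 0 ∨ x = 1 ∧ d = 0 := by
  induction h with
  | one => exact .inr ⟨rfl, rfl⟩
  | of i => exact .inl (counit_ι _)
  | star _ _ h h' =>
    rcases h with h | ⟨rfl, rfl⟩
    · exact .inl (by rw [counit_star, h, zero_mul])
    · rcases h' with h' | ⟨rfl, rfl⟩
      · exact .inl (by rw [counit_star, h', mul_zero])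
      · exact .inr ⟨TwoAssocAlgebra.one_star (K := K) (A := FreeTwoAssoc K V) _, add_zero _⟩
  | mul _ _ h h' =>
    rcases h with h | ⟨rfl, rfl⟩
    · exact .inl (by rw [counit_mul', h, zero_mul])
    · rcases h' with h' | ⟨rfl, rfl⟩
      · exact .inl (by rw [counit_mul', h', mul_zero])
      · exact .inr ⟨mul_one _, add_zero _⟩

theorem IsMonomial.eq_one {d : ℕ} {x : FreeTwoAssoc K V}
    (h : IsMonomial b (fun _ => 1) d x) (hd : d = 0) : x = 1 := by
  induction h with
  | one => rfl
  | of i => exact absurd hd one_ne_zero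
  | star _ _ h h' =>
    rw [h (by omega), h' (by omega)]
    exact TwoAssocAlgebra.one_star (K := K) (A := FreeTwoAssoc K V) _
  | mul _ _ h h' => rw [h (by omega), h' (by omega), mul_one]

instance : InfBialgebra K (FreeTwoAssoc K V) where
  counit_one := counit_one'
  counit_mul := counit_mul'
  comul_one := comul_one
  comul_mul := comul_mul'
  conilpotent := by
    -- Every vector gets weight one, so the degree counts the factors from `V` and only multiples of
    -- `1` have degree zero.
    refine ⟨gr K (id : V → V) fun _ => 1, iSup_gr (by simp),
      fun n x hx => comul_mem_tensorGrading hx, Submodule.span_le.2 fun x hx => ?_⟩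
    rw [IsMonomial.eq_one hx rfl]
    exact Submodule.mem_span_singleton_self _

theorem conv_mem_gr {f g : WithConv (FreeTwoAssoc K V →ₗ[K] FreeTwoAssoc K V)}
    (hf : ∀ d, ∀ x ∈ gr K b wt d, f x ∈ gr K b wt d)
    (hg : ∀ d, ∀ x ∈ gr K b wt d, g x ∈ gr K b wt d) {d : G} {x : FreeTwoAssoc K V}
    (hx : x ∈ gr K b wt d) : (f * g) x ∈ gr K b wt d := by
  rw [LinearMap.convMul_apply]
  have : tensorGrading (gr K b wt) (gr K b wt) d ≤
      (gr K b wt d).comap (LinearMap.mul' K _ ∘ₗ TensorProduct.map f.ofConv g.ofConv) :=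
    tensorGrading_le fun i j hij x hx y hy => hij ▸ mul_mem_gr (hf i x hx) (hg j y hy)
  exact this (comul_mem_tensorGrading hx)

theorem convId_sub_one_mem_gr {d : G} {x : FreeTwoAssoc K V} (hx : x ∈ gr K b wt d) :
    (InfBialgebra.convId K (FreeTwoAssoc K V) - 1) x ∈ gr K b wt d := by
  have h1 : gr K b wt d ≤ (gr K b wt d).comap
      (1 : WithConv (FreeTwoAssoc K V →ₗ[K] FreeTwoAssoc K V)).ofConv := by
    refine Submodule.span_le.2 fun x hx => ?_
    change (1 : WithConv (FreeTwoAssoc K V →ₗ[K] FreeTwoAssoc K V)) x ∈ gr K b wt d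
    rw [InfBialgebra.one_apply]
    rcases hx.counit_eq_zero_or with h | ⟨rfl, rfl⟩
    · change counit K V x • (1 : FreeTwoAssoc K V) ∈ _
      rw [h, zero_smul]
      exact zero_mem _
    · exact Submodule.smul_mem _ _ one_mem_gr
  exact sub_mem hx (h1 hx)

theorem idem_mem_gr {d : G} {x : FreeTwoAssoc K V} (hx : x ∈ gr K b wt d) :
    InfBialgebra.idem K (FreeTwoAssoc K V) x ∈ gr K b wt d := by
  rw [InfBialgebra.idem_apply_eq_finsum]
  refine finsum_induction (· ∈ gr K b wt d) (zero_mem _) (fun _ _ => add_mem) fun n => ?_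
  refine Submodule.smul_mem _ _ ?_
  induction n generalizing d x with
  | zero =>
    rw [zero_add, pow_one]
    exact convId_sub_one_mem_gr hx
  | succ n ih =>
    rw [pow_succ']
    exact conv_mem_gr (fun d x hx => convId_sub_one_mem_gr hx) (fun d x hx => ih hx) hx

theorem convPow_augmentation (n : ℕ) : convPow (augmentation K V) n =
    ((InfBialgebra.convId K (FreeTwoAssoc K V) - 1) ^ (n + 1)).ofConv := by
  have h : augmentation K V = (InfBialgebra.convId K (FreeTwoAssoc K V) - 1).ofConv :=
    LinearMap.ext fun x => congrArg (x - ·) (InfBialgebra.one_apply (K := K) x).symm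
  induction n with
  | zero => rw [zero_add, pow_one, convPow, h]
  | succ n ih =>
    rw [convPow, ih, h, pow_succ' _ (n + 1)]
    rfl

theorem e_eq_idem (x : FreeTwoAssoc K V) : e x = InfBialgebra.idem K (FreeTwoAssoc K V) x := by
  rw [InfBialgebra.idem_apply_eq_finsum, e]
  simp only [convPow_augmentation]

end

end FreeTwoAssoc

/-! ## Trees decorated by basis elements -/

/-- Planar trees whose leaves are decorated by elements of `X`. -/
abbrev DecTree (X : Type*) : Type _ := Σ t : PlanarTree, (Fin t.leaves → X)

namespace DecTree

variable {X : Type*}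

/-- The trivial decorated tree. -/
def leaf (x : X) : DecTree X := ⟨.leaf, fun _ => x⟩

/-- The juxtaposition of decorations. -/
def joinDec {m : ℕ} (d : Fin m → DecTree X) : Fin (∑ i, (d i).1.leaves) → X :=
  fun s => (d (finSigmaFinEquiv.symm s).1).2 (finSigmaFinEquiv.symm s).2

/-- The grafting of decorated trees. -/
def node (k : ℕ) (d : Fin (k + 2) → DecTree X) : DecTree X :=
  ⟨.node k fun i => (d i).1, joinDec d⟩

theorem joinDec_apply {m : ℕ} (d : Fin m → DecTree X) (i : Fin m) (s : Fin (d i).1.leaves) :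
    joinDec d (finSigmaFinEquiv (n := fun i => (d i).1.leaves) ⟨i, s⟩) = (d i).2 s :=
  congrArg (fun p : Σ i, Fin (d i).1.leaves => (d p.1).2 p.2)
    (Equiv.symm_apply_apply (finSigmaFinEquiv (n := fun i => (d i).1.leaves)) ⟨i, s⟩)

/-- The list of the trees whose grafting is the given tree; the trivial tree is its own child. -/
def children : DecTree X → List (DecTree X)
  | ⟨.leaf, w⟩ => [⟨.leaf, w⟩]
  | ⟨.node _ c, w⟩ => List.ofFn fun i => ⟨c i, fun s => w (finSigmaFinEquiv ⟨i, s⟩)⟩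

theorem children_leaf (x : X) : (leaf x).children = [leaf x] := rfl

theorem children_node (k : ℕ) (d : Fin (k + 2) → DecTree X) :
    (node k d).children = List.ofFn d := by
  exact congrArg List.ofFn (funext fun i => congrArg (Sigma.mk (d i).1)
    (funext fun s => joinDec_apply d i s))

theorem eq_leaf_or_eq_node : ∀ t : DecTree X, (∃ x, t = leaf x) ∨ ∃ k d, t = node k d
  | ⟨.leaf, w⟩ => .inl ⟨w (0 : Fin 1), congrArg (Sigma.mk PlanarTree.leaf)
      (funext fun s => congrArg w (Fin.fin_one_eq_zero s))⟩
  | ⟨.node k c, w⟩ => .inr ⟨k, fun i => ⟨c i, fun s => w (finSigmaFinEquiv ⟨i, s⟩)⟩,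
      congrArg (Sigma.mk (PlanarTree.node k c)) (funext fun s =>
        congrArg w (finSigmaFinEquiv.apply_symm_apply s).symm)⟩

/-- The involution on lists of trees that exchanges the list of children of a non-trivial tree
with the one-term list consisting of that tree. -/
def regroup : List (DecTree X) → List (DecTree X)
  | [] => []
  | [t] => t.children
  | a :: b :: l => [node l.length (a :: b :: l).get]

theorem regroup_ofFn (k : ℕ) (d : Fin (k + 2) → DecTree X) : regroup (List.ofFn d) = [node k d] := by
  have key : ∀ (l : List (DecTree X)) (h : l.length = k + 2),
      (∀ i, l.get (Fin.cast h.symm i) = d i) → regroup l = [node k d] := by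
    rintro (_ | ⟨a, _ | ⟨b, l⟩⟩) h hd
    · simp at h
    · simp at h
    · obtain rfl : l.length = k := by simpa using h
      exact congrArg (fun d => [node _ d]) (funext hd)
  exact key _ List.length_ofFn fun i => by
    rw [List.get_ofFn]
    rfl

theorem regroup_regroup : ∀ l : List (DecTree X), regroup (regroup l) = l
  | [] => rfl
  | [t] => by
    obtain ⟨x, rfl⟩ | ⟨k, d, rfl⟩ := t.eq_leaf_or_eq_node
    · rfl
    · change regroup (node k d).children = _
      rw [children_node, regroup_ofFn]
  | a :: b :: l => by
    change (node l.length (a :: b :: l).get).children = _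
    rw [children_node]
    exact List.ofFn_get (a :: b :: l)

theorem regroup_eq_nil {l : List (DecTree X)} (h : regroup l = []) : l = [] := by
  rw [← regroup_regroup l, h]
  rfl

/-- The multiset of the decorations. -/
def degree (t : DecTree X) : Multiset X := ∑ s, {t.2 s}

/-- The multiset of the decorations of a list of trees. -/
def listDegree (l : List (DecTree X)) : Multiset X := (l.map degree).sum

theorem listDegree_append (l l' : List (DecTree X)) :
    listDegree (l ++ l') = listDegree l + listDegree l' := by
  simp [listDegree]

theorem degree_node (k : ℕ) (d : Fin (k + 2) → DecTree X) :
    (node k d).degree = ∑ i, (d i).degree := by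
  have h := Fintype.sum_sigma fun p : Σ i, Fin (d i).1.leaves => ({(d p.1).2 p.2} : Multiset X)
  exact (Fintype.sum_equiv finSigmaFinEquiv.symm _ _ fun s => rfl).trans h

theorem listDegree_regroup : ∀ l : List (DecTree X), listDegree (regroup l) = listDegree l
  | [] => rfl
  | [t] => by
    obtain ⟨x, rfl⟩ | ⟨k, d, rfl⟩ := t.eq_leaf_or_eq_node
    · rfl
    · change listDegree (node k d).children = _
      rw [children_node, listDegree, listDegree, List.map_singleton, List.sum_singleton,
        degree_node, List.map_ofFn, List.sum_ofFn]
      rfl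
  | a :: b :: l => by
    change listDegree [node l.length (a :: b :: l).get] = _
    rw [listDegree, List.map_singleton, List.sum_singleton, degree_node, listDegree]
    conv_rhs => rw [← List.ofFn_get (a :: b :: l), List.map_ofFn, List.sum_ofFn]
    rfl

section

variable {K : Type u} {V : Type v} [Field K] [AddCommGroup V] [Module K V] (f : X → V)

/-- The two products of `2as(V)`. -/
noncomputable def product (K : Type u) (V : Type v) [Field K] [AddCommGroup V] [Module K V]
    (β : Bool) : FreeTwoAssoc K V →ₗ[K] FreeTwoAssoc K V →ₗ[K] FreeTwoAssoc K V :=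
  if β then TwoAssocAlgebra.star else TwoAssocAlgebra.dot

theorem product_assoc (β : Bool) (x y z : FreeTwoAssoc K V) :
    product K V β (product K V β x y) z = product K V β x (product K V β y z) := by
  cases β
  · exact TwoAssocAlgebra.dot_assoc x y z
  · exact TwoAssocAlgebra.star_assoc x y z

theorem one_product (β : Bool) (x : FreeTwoAssoc K V) : product K V β 1 x = x := by
  cases β
  · exact TwoAssocAlgebra.one_dot x
  · exact TwoAssocAlgebra.one_star x

theorem product_one (β : Bool) (x : FreeTwoAssoc K V) : product K V β x 1 = x := by
  cases β
  · exact TwoAssocAlgebra.dot_one x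
  · exact TwoAssocAlgebra.star_one x

theorem counit_product (β : Bool) (x y : FreeTwoAssoc K V) :
    FreeTwoAssoc.counit K V (product K V β x y) =
      FreeTwoAssoc.counit K V x * FreeTwoAssoc.counit K V y := by
  cases β
  · exact FreeTwoAssoc.counit_mul' x y
  · exact FreeTwoAssoc.counit_star x y

variable (K)

/-- The elements `t^*` and `t^•` of `2as(V)` for a tree with decorations in a family of vectors. -/
noncomputable def value (t : DecTree X) (β : Bool) : FreeTwoAssoc K V :=
  t.1.toFree β fun s => f (t.2 s)

/-- The product of the values of the trees of a list. -/
noncomputable def listValue (β : Bool) (l : List (DecTree X)) : FreeTwoAssoc K V :=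
  (l.map fun t => value K f t (!β)).foldr (fun x y => product K V β x y) 1

variable {K}

theorem iterProd_eq_foldr {A : Type*} [AddCommGroup A] [Module K A] (μ : A →ₗ[K] A →ₗ[K] A)
    (unit : A) (n : ℕ) (a : Fin n → A) :
    iterProd μ unit n a = (List.ofFn a).foldr (fun x y => μ x y) unit := by
  induction n with
  | zero => rfl
  | succ n ih => rw [iterProd_succ, ih, List.ofFn_succ, List.foldr_cons]

theorem value_leaf (x : X) (β : Bool) : value K f (leaf x) β = FreeTwoAssoc.ι K (f x) := rfl

theorem value_node (k : ℕ) (d : Fin (k + 2) → DecTree X) (β : Bool) :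
    value K f (node k d) β = listValue K f β (List.ofFn d) := by
  rw [listValue, List.map_ofFn, ← iterProd_eq_foldr]
  refine (PlanarTree.toFree_node k (fun i => (d i).1) β _).trans ?_
  refine congrArg (iterProd (K := K) _ _ (k + 2)) (funext fun i => ?_)
  exact congrArg ((d i).1.toFree (!β)) (funext fun s => congrArg f (joinDec_apply d i s))

theorem listValue_nil (β : Bool) : listValue K f β [] = 1 := rfl

theorem listValue_cons (β : Bool) (t : DecTree X) (l : List (DecTree X)) :
    listValue K f β (t :: l) = product K V β (value K f t (!β)) (listValue K f β l) := rfl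

theorem listValue_singleton (β : Bool) (t : DecTree X) :
    listValue K f β [t] = value K f t (!β) := by
  rw [listValue_cons, listValue_nil, product_one]

theorem listValue_append (β : Bool) (l l' : List (DecTree X)) :
    listValue K f β (l ++ l') = product K V β (listValue K f β l) (listValue K f β l') := by
  induction l with
  | nil => rw [List.nil_append, listValue_nil, one_product]
  | cons t l ih => rw [List.cons_append, listValue_cons, listValue_cons, ih, product_assoc]

/-- The rules `t^* = t_1^• * ⋯ * t_k^•` and `t^• = t_1^* · ⋯ · t_k^*` say that regrouping a list
exchanges the roles of the two products. This is why `·` is concatenation conjugated by `regroup`.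
-/
theorem listValue_regroup (β : Bool) : ∀ l : List (DecTree X),
    listValue K f β (regroup l) = listValue K f (!β) l
  | [] => rfl
  | [t] => by
    change listValue K f β t.children = _
    rw [listValue_singleton, Bool.not_not]
    obtain ⟨x, rfl⟩ | ⟨k, d, rfl⟩ := t.eq_leaf_or_eq_node
    · rw [children_leaf, listValue_singleton]
      rfl
    · rw [children_node, value_node]
  | a :: b :: l => by
    change listValue K f β [node l.length (a :: b :: l).get] = _
    rw [listValue_singleton, value_node]
    exact congrArg _ (List.ofFn_get (a :: b :: l))

theorem counit_value (t : PlanarTree) (w : Fin t.leaves → X) (β : Bool) :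
    FreeTwoAssoc.counit K V (value K f ⟨t, w⟩ β) = 0 := by
  induction t generalizing β with
  | leaf => rfl
  | node k c ih =>
    refine (congrArg (FreeTwoAssoc.counit K V) (PlanarTree.toFree_node k c β _)).trans ?_
    rw [iterProd_succ]
    refine (counit_product β _ _).trans ?_
    exact mul_eq_zero_of_left (ih 0 (fun s => w (finSigmaFinEquiv ⟨0, s⟩)) (!β)) _

theorem counit_listValue_cons (β : Bool) (t : DecTree X) (l : List (DecTree X)) :
    FreeTwoAssoc.counit K V (listValue K f β (t :: l)) = 0 := by
  rw [listValue_cons, counit_product, counit_value, zero_mul]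

end

end DecTree

/-! ## A model of the free 2-associative algebra -/

section

variable (K : Type*) [Field K] {S : Type*}

/-- The bilinear extension of a binary operation. -/
noncomputable def finsuppProduct (op : S → S → S) : (S →₀ K) →ₗ[K] (S →₀ K) →ₗ[K] (S →₀ K) :=
  Finsupp.linearCombination K fun a => Finsupp.lmapDomain K K (op a)

variable {K}

theorem finsuppProduct_single (op : S → S → S) (a b : S) (r s : K) :
    finsuppProduct K op (Finsupp.single a r) (Finsupp.single b s) =
      Finsupp.single (op a b) (r * s) := by
  simp [finsuppProduct, Finsupp.linearCombination_single, Finsupp.mapDomain_single]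

theorem finsuppProduct_assoc {op : S → S → S} (h : ∀ a b c, op (op a b) c = op a (op b c))
    (x y z : S →₀ K) : finsuppProduct K op (finsuppProduct K op x y) z =
      finsuppProduct K op x (finsuppProduct K op y z) := by
  induction x using Finsupp.induction_linear with
  | zero => simp
  | add x x' hx hx' => simp only [map_add, LinearMap.add_apply, hx, hx']
  | single a r =>
    induction y using Finsupp.induction_linear with
    | zero => simp
    | add x x' hx hx' => simp only [map_add, LinearMap.add_apply, hx, hx']
    | single b s =>
      induction z using Finsupp.induction_linear with
      | zero => simp
      | add x x' hx hx' => simp only [map_add, hx, hx']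
      | single c t => simp only [finsuppProduct_single, h, mul_assoc]

theorem one_finsuppProduct {op : S → S → S} {u : S} (h : ∀ a, op u a = a) (x : S →₀ K) :
    finsuppProduct K op (Finsupp.single u 1) x = x := by
  induction x using Finsupp.induction_linear with
  | zero => simp
  | add x x' hx hx' => simp only [map_add, hx, hx']
  | single a r => rw [finsuppProduct_single, h, one_mul]

theorem finsuppProduct_one {op : S → S → S} {u : S} (h : ∀ a, op a u = a) (x : S →₀ K) :
    finsuppProduct K op x (Finsupp.single u 1) = x := by
  induction x using Finsupp.induction_linear with
  | zero => simp
  | add x x' hx hx' => simp only [map_add, LinearMap.add_apply, hx, hx']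
  | single a r => rw [finsuppProduct_single, h, mul_one]

end

/-- The vector space spanned by the lists of decorated trees, as a 2-associative algebra. -/
def ForestAlgebra (K : Type u) (X : Type v) [Field K] : Type (max u v) := List (DecTree X) →₀ K

namespace ForestAlgebra

section

variable {K : Type u} {X : Type v} [Field K]

noncomputable instance : AddCommGroup (ForestAlgebra K X) :=
  inferInstanceAs (AddCommGroup (List (DecTree X) →₀ K))

noncomputable instance : Module K (ForestAlgebra K X) :=
  inferInstanceAs (Module K (List (DecTree X) →₀ K))

/-- The second product on lists of trees, conjugate to the concatenation. -/
def dotOp (l l' : List (DecTree X)) : List (DecTree X) :=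
  DecTree.regroup (DecTree.regroup l ++ DecTree.regroup l')

theorem nil_dotOp (l : List (DecTree X)) : dotOp [] l = l := DecTree.regroup_regroup l

theorem dotOp_nil (l : List (DecTree X)) : dotOp l [] = l := by
  rw [dotOp, DecTree.regroup, List.append_nil, DecTree.regroup_regroup]

noncomputable instance : TwoAssocAlgebra K (ForestAlgebra K X) where
  one := Finsupp.single [] 1
  star := finsuppProduct K (· ++ ·)
  dot := finsuppProduct K dotOp
  star_assoc := finsuppProduct_assoc List.append_assoc
  dot_assoc := finsuppProduct_assoc fun a b c => by
    simp only [dotOp, DecTree.regroup_regroup, List.append_assoc]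
  one_star := one_finsuppProduct List.nil_append
  star_one := finsuppProduct_one List.append_nil
  one_dot := one_finsuppProduct nil_dotOp
  dot_one := finsuppProduct_one dotOp_nil

variable (K) in
/-- The element given by a list of trees. -/
noncomputable def single (l : List (DecTree X)) : ForestAlgebra K X := Finsupp.single l 1

theorem star_single (l l' : List (DecTree X)) :
    TwoAssocAlgebra.star (K := K) (single K l) (single K l') = single K (l ++ l') :=
  (finsuppProduct_single _ _ _ _ _).trans (by rw [one_mul]; rfl)

theorem dot_single (l l' : List (DecTree X)) :
    TwoAssocAlgebra.dot (K := K) (single K l) (single K l') = single K (dotOp l l') :=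
  (finsuppProduct_single _ _ _ _ _).trans (by rw [one_mul]; rfl)

theorem one_eq_single : (TwoAssocAlgebra.one K : ForestAlgebra K X) = single K [] := rfl

variable {W : Type*} [AddCommGroup W] [Module K W]

/-- The linear map with given values on lists of trees. -/
noncomputable def linearLift (g : List (DecTree X) → W) : ForestAlgebra K X →ₗ[K] W :=
  Finsupp.linearCombination K g

theorem linearLift_single (g : List (DecTree X) → W) (l : List (DecTree X)) :
    linearLift (K := K) g (single K l) = g l :=
  (Finsupp.linearCombination_single K _ _).trans (one_smul _ _)

theorem linearMap_ext {f g : ForestAlgebra K X →ₗ[K] W}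
    (h : ∀ l, f (single K l) = g (single K l)) : f = g :=
  Finsupp.lhom_ext fun l r => by
    have h1 : Finsupp.single l r = r • single K l :=
      (Finsupp.smul_single_one l r).symm
    exact (congrArg f h1).trans ((map_smul f _ _).trans
      ((congrArg (r • ·) (h l)).trans ((map_smul g _ _).symm.trans (congrArg g h1).symm)))

end

end ForestAlgebra

/-! ## Decorated trees as components of the free 2-associative algebra -/

namespace TreeModule

section

variable {K : Type u} {V : Type v} [Field K] [AddCommGroup V] [Module K V]

noncomputable instance : AddCommGroup (TreeModule K V) := Module.addCommMonoidToAddCommGroup K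

variable (K) in
/-- A decorated tree, as a multilinear function of the decorations. -/
noncomputable def decMap (V : Type v) [AddCommGroup V] [Module K V] {n : ℕ} (t : PT n) :
    MultilinearMap K (fun _ : Fin n => V) (TreeModule K V) :=
  (DirectSum.lof K ℕ (fun n => (PT n →₀ K) ⊗[K] (⨂[K]^n V)) n ∘ₗ
    TensorProduct.mk K _ _ (Finsupp.single t 1)).compMultilinearMap (PiTensorProduct.tprod K)

theorem star_dec {n : ℕ} (t : PT n) (x : Fin n → V) :
    star K V (dec K t x) = t.1.toFree true fun s => x (Fin.cast t.2 s) := by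
  rw [star, dec, DirectSum.toModule_lof, TensorProduct.lift.tmul,
    Finsupp.linearCombination_single, one_smul, PiTensorProduct.lift.tprod,
    MultilinearMap.domDomCongr_apply]
  rfl

theorem linearMap_ext_basis {X : Type*} (b : Module.Basis X K V) {W : Type*} [AddCommGroup W]
    [Module K W] {f g : TreeModule K V →ₗ[K] W}
    (h : ∀ t : DecTree X, f (dec K (⟨t.1, rfl⟩ : PT t.1.leaves) fun s => b (t.2 s)) =
      g (dec K (⟨t.1, rfl⟩ : PT t.1.leaves) fun s => b (t.2 s))) : f = g := by
  refine DirectSum.linearMap_ext K fun n => TensorProduct.ext (Finsupp.lhom_ext' fun t =>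
    LinearMap.ext_ring (PiTensorProduct.ext (Module.Basis.ext_multilinear (fun _ => b) fun w => ?_)))
  obtain ⟨t, rfl⟩ := t
  exact h ⟨t, w⟩

/-- The span of the trees decorated by members of a family of vectors, the multiset of the indices
being fixed. -/
noncomputable def gr (K : Type u) {V : Type v} [Field K] [AddCommGroup V] [Module K V] {X : Type*} (f : X → V)
    (d : Multiset X) : Submodule K (TreeModule K V) :=
  Submodule.span K {y | ∃ t : DecTree X, t.degree = d ∧
    y = dec K (⟨t.1, rfl⟩ : PT t.1.leaves) fun s => f (t.2 s)}

end

end TreeModule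

namespace DecTree

section

variable {K : Type u} {V : Type v} [Field K] [AddCommGroup V] [Module K V] {X : Type w}

theorem induction {P : DecTree X → Prop} (leaf : ∀ x, P (leaf x))
    (node : ∀ k d, (∀ i, P (d i)) → P (node k d)) (t : DecTree X) : P t := by
  obtain ⟨t, w⟩ := t
  induction t with
  | leaf =>
    obtain ⟨x, h⟩ | ⟨k, d, h⟩ := eq_leaf_or_eq_node (⟨.leaf, w⟩ : DecTree X)
    · exact h ▸ leaf x
    · exact absurd (congrArg Sigma.fst h) (by simp [DecTree.node])
  | node k c ih =>
    have h : (⟨.node k c, w⟩ : DecTree X) =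
        DecTree.node k fun i => ⟨c i, fun s => w (finSigmaFinEquiv ⟨i, s⟩)⟩ :=
      congrArg (Sigma.mk (PlanarTree.node k c)) (funext fun s =>
        congrArg w (finSigmaFinEquiv.apply_symm_apply s).symm)
    rw [h]
    exact node k _ fun i => ih i _

variable (f : X → V)

theorem listValue_mul (l l' : List (DecTree X)) :
    listValue K f true l * listValue K f true l' =
      listValue K f true (ForestAlgebra.dotOp l l') := by
  rw [ForestAlgebra.dotOp, listValue_regroup, listValue_append, listValue_regroup, listValue_regroup]
  rfl

theorem listValue_star (l l' : List (DecTree X)) :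
    TwoAssocAlgebra.star (K := K) (listValue K f true l) (listValue K f true l') =
      listValue K f true (l ++ l') :=
  (listValue_append f true l l').symm

theorem isMonomial_listValue (β : Bool) (l : List (DecTree X))
    (h : ∀ t ∈ l, FreeTwoAssoc.IsMonomial f (fun i => ({i} : Multiset X)) t.degree
      (value K f t (!β))) :
    FreeTwoAssoc.IsMonomial f (fun i => ({i} : Multiset X)) (listDegree l)
      (listValue K f β l) := by
  induction l with
  | nil => exact .one
  | cons t l ih =>
    have h1 := h t List.mem_cons_self
    have h2 := ih fun t ht => h t (List.mem_cons_of_mem _ ht)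
    cases β
    · exact .mul h1 h2
    · exact .star h1 h2

theorem isMonomial_value (t : DecTree X) (β : Bool) :
    FreeTwoAssoc.IsMonomial f (fun i => ({i} : Multiset X)) t.degree (value K f t β) := by
  induction t using induction generalizing β with
  | leaf x =>
    rw [value_leaf]
    exact .of x
  | node k d ih =>
    have h : (node k d).degree = listDegree (List.ofFn d) := by
      rw [degree_node, listDegree, List.map_ofFn, List.sum_ofFn]
      rfl
    rw [value_node, h]
    refine isMonomial_listValue f β _ fun t ht => ?_
    obtain ⟨i, rfl⟩ := List.mem_ofFn.1 ht
    exact ih i _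

theorem exists_eq_listValue {d : Multiset X} {x : FreeTwoAssoc K V}
    (h : FreeTwoAssoc.IsMonomial f (fun i => ({i} : Multiset X)) d x) :
    ∃ l, listDegree l = d ∧ x = listValue K f true l := by
  induction h with
  | one => exact ⟨[], rfl, rfl⟩
  | of i => exact ⟨[leaf i], rfl, (listValue_singleton f true (leaf i)).symm⟩
  | star _ _ h h' =>
    obtain ⟨l, rfl, rfl⟩ := h
    obtain ⟨l', rfl, rfl⟩ := h'
    exact ⟨l ++ l', listDegree_append l l', listValue_star f l l'⟩
  | mul _ _ h h' =>
    obtain ⟨l, rfl, rfl⟩ := h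
    obtain ⟨l', rfl, rfl⟩ := h'
    refine ⟨ForestAlgebra.dotOp l l', ?_, listValue_mul f l l'⟩
    rw [ForestAlgebra.dotOp, listDegree_regroup, listDegree_append, listDegree_regroup, listDegree_regroup]

theorem star_dec_eq_value (t : DecTree X) :
    TreeModule.star K V (TreeModule.dec K (⟨t.1, rfl⟩ : PT t.1.leaves) fun s => f (t.2 s)) =
      value K f t true :=
  TreeModule.star_dec _ _

theorem star_mem_gr {d : Multiset X} {y : TreeModule K V} (hy : y ∈ TreeModule.gr K f d) :
    TreeModule.star K V y ∈ FreeTwoAssoc.gr K f (fun i => ({i} : Multiset X)) d := by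
  have : TreeModule.gr K f d ≤ (FreeTwoAssoc.gr K f (fun i => ({i} : Multiset X)) d).comap
      (TreeModule.star K V) := by
    refine Submodule.span_le.2 ?_
    rintro _ ⟨t, rfl, rfl⟩
    refine FreeTwoAssoc.IsMonomial.mem_gr ?_
    rw [star_dec_eq_value]
    exact isMonomial_value f t true
  exact this hy

/-- The decorated tree given by a list with one element, and zero for the other lists. -/
noncomputable def singlePart (K : Type u) [Field K] {V : Type v} [AddCommGroup V] [Module K V]
    (f : X → V) : List (DecTree X) → TreeModule K V
  | [t] => TreeModule.dec K (⟨t.1, rfl⟩ : PT t.1.leaves) fun s => f (t.2 s)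
  | _ => 0

theorem singlePart_append {l l' : List (DecTree X)} (h : l ≠ []) (h' : l' ≠ []) :
    singlePart K f (l ++ l') = 0 := by
  obtain ⟨a, l, rfl⟩ := List.exists_cons_of_ne_nil h
  obtain ⟨c, l', rfl⟩ := List.exists_cons_of_ne_nil h'
  cases l <;> rfl

end

end DecTree

/-! ### The basis of lists of trees and the projection onto the `*`-component -/

namespace FreeTwoAssoc

section

open DecTree

variable {K : Type u} {V : Type v} [Field K] [AddCommGroup V] [Module K V] {X : Type w}

/-- The morphism from the free 2-associative algebra to its model given by a basis. -/
noncomputable def toForest (b : Module.Basis X K V) : FreeTwoAssoc K V →ₗ[K] ForestAlgebra K X :=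
  lift (b.constr K fun x => ForestAlgebra.single K [leaf x])

/-- The map from the model to the free 2-associative algebra. -/
noncomputable def ofForest (f : X → V) : ForestAlgebra K X →ₗ[K] FreeTwoAssoc K V :=
  ForestAlgebra.linearLift (listValue K f true)

theorem ofForest_single (f : X → V) (l : List (DecTree X)) :
    ofForest f (ForestAlgebra.single K l) = listValue K f true l :=
  ForestAlgebra.linearLift_single _ l

theorem ofForest_star (f : X → V) (x y : ForestAlgebra K X) :
    ofForest f (TwoAssocAlgebra.star (K := K) x y) =
      TwoAssocAlgebra.star (K := K) (ofForest f x) (ofForest f y) := by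
  have : (TwoAssocAlgebra.star (K := K) (A := ForestAlgebra K X)).compr₂ (ofForest f) =
      (TwoAssocAlgebra.star (K := K)).compl₁₂ (ofForest f) (ofForest f) :=
    ForestAlgebra.linearMap_ext fun l => ForestAlgebra.linearMap_ext fun l' => by
      simp only [LinearMap.compr₂_apply, LinearMap.compl₁₂_apply, ForestAlgebra.star_single,
        ofForest_single, listValue_star]
  exact LinearMap.congr_fun₂ this x y

theorem ofForest_dot (f : X → V) (x y : ForestAlgebra K X) :
    ofForest f (TwoAssocAlgebra.dot (K := K) x y) =
      TwoAssocAlgebra.dot (K := K) (ofForest f x) (ofForest f y) := by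
  have : (TwoAssocAlgebra.dot (K := K) (A := ForestAlgebra K X)).compr₂ (ofForest f) =
      (TwoAssocAlgebra.dot (K := K)).compl₁₂ (ofForest f) (ofForest f) :=
    ForestAlgebra.linearMap_ext fun l => ForestAlgebra.linearMap_ext fun l' => by
      simp only [LinearMap.compr₂_apply, LinearMap.compl₁₂_apply, ForestAlgebra.dot_single,
        ofForest_single, dot_eq_mul, listValue_mul]
  exact LinearMap.congr_fun₂ this x y

variable (b : Module.Basis X K V)

theorem ofForest_toForest (x : FreeTwoAssoc K V) : ofForest b (toForest b x) = x := by
  have h := (existsUnique_lift (ι K : V →ₗ[K] FreeTwoAssoc K V)).unique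
    (y₁ := ofForest b ∘ₗ toForest b) (y₂ := LinearMap.id)
    ⟨?_, fun x y => ?_, fun x y => ?_, fun v => ?_⟩
    ⟨rfl, fun _ _ => rfl, fun _ _ => rfl, fun _ => rfl⟩
  · exact LinearMap.congr_fun h x
  · rw [LinearMap.comp_apply, toForest, lift_one, ForestAlgebra.one_eq_single, ofForest_single]
    rfl
  · rw [LinearMap.comp_apply, toForest, lift_star, ofForest_star]
    rfl
  · rw [LinearMap.comp_apply, toForest, lift_dot, ofForest_dot]
    rfl
  · have h : ofForest b ∘ₗ b.constr K (fun x => ForestAlgebra.single K [leaf x]) = ι K :=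
      b.ext fun x => by
        rw [LinearMap.comp_apply, Module.Basis.constr_basis, ofForest_single, listValue_singleton,
          value_leaf]
    exact LinearMap.congr_fun h v

theorem linearMap_ext_listValue {W : Type*} [AddCommGroup W] [Module K W]
    {f g : FreeTwoAssoc K V →ₗ[K] W}
    (h : ∀ l, f (listValue K b true l) = g (listValue K b true l)) : f = g := by
  have h1 : f ∘ₗ ofForest b = g ∘ₗ ofForest b := ForestAlgebra.linearMap_ext fun l => by
    simp only [LinearMap.comp_apply, ofForest_single, h]
  refine LinearMap.ext fun x => ?_
  rw [← ofForest_toForest b x]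
  exact LinearMap.congr_fun h1 (toForest b x)

/-- The step from trees to lists in a mutual induction: the values of the members are those for the
opposite product, so the statement for trees must be proved for both. -/
theorem toForest_listValue_of (β : Bool) (l : List (DecTree X))
    (h : ∀ t ∈ l, toForest b (value K b t (!β)) =
      ForestAlgebra.single K (if !β then regroup [t] else [t])) :
    toForest b (listValue K b β l) = ForestAlgebra.single K (if β then l else regroup l) := by
  induction l with
  | nil => cases β <;> rfl
  | cons t l ih =>
    have h1 := h t List.mem_cons_self
    have h2 := ih fun t ht => h t (List.mem_cons_of_mem _ ht)
    rw [listValue_cons]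
    cases β
    · refine (lift_dot _ _ _).trans ?_
      refine (congrArg₂ (fun x y => TwoAssocAlgebra.dot (K := K) x y) h1 h2).trans ?_
      rw [ForestAlgebra.dot_single]
      simp only [Bool.not_false, if_true, Bool.false_eq_true, if_false, ForestAlgebra.dotOp,
        regroup_regroup, List.singleton_append]
    · refine (lift_star _ _ _).trans ?_
      refine (congrArg₂ (fun x y => TwoAssocAlgebra.star (K := K) x y) h1 h2).trans ?_
      rw [ForestAlgebra.star_single]
      simp only [Bool.not_true, if_true, Bool.false_eq_true, if_false, List.singleton_append]

theorem toForest_value (t : DecTree X) (β : Bool) :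
    toForest b (value K b t β) = ForestAlgebra.single K (if β then regroup [t] else [t]) := by
  induction t using DecTree.induction generalizing β with
  | leaf x =>
    have h : (if β then regroup [leaf x] else [leaf x]) = [leaf x] := by cases β <;> rfl
    rw [h, value_leaf, toForest, lift_ι, Module.Basis.constr_basis]
  | node k d ih =>
    rw [value_node, toForest_listValue_of]
    · have h : regroup [node k d] = List.ofFn d := children_node k d
      rw [h, regroup_ofFn]
    · intro t ht
      obtain ⟨i, rfl⟩ := List.mem_ofFn.1 ht
      exact ih i _

/-- Together with `ofForest_toForest` this shows that the values of lists of trees form a basis of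
`2as(V)`. -/
theorem toForest_listValue (l : List (DecTree X)) :
    toForest b (listValue K b true l) = ForestAlgebra.single K l :=
  toForest_listValue_of b true l fun t _ => toForest_value b t _

/-- The projection onto the space of decorated trees. -/
noncomputable def toTree : FreeTwoAssoc K V →ₗ[K] TreeModule K V :=
  ForestAlgebra.linearLift (fun l => singlePart K b (regroup l)) ∘ₗ toForest b

theorem toTree_listValue (l : List (DecTree X)) :
    toTree b (listValue K b true l) = singlePart K b (regroup l) := by
  rw [toTree, LinearMap.comp_apply, toForest_listValue, ForestAlgebra.linearLift_single]

theorem toTree_star (y : TreeModule K V) : toTree b (TreeModule.star K V y) = y := by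
  have : toTree b ∘ₗ TreeModule.star K V = LinearMap.id :=
    TreeModule.linearMap_ext_basis b fun t => by
      have h : value K b t true = listValue K b true (regroup [t]) := by
        rw [listValue_regroup, listValue_singleton]
        rfl
      rw [LinearMap.comp_apply, star_dec_eq_value, h, toTree_listValue, regroup_regroup]
      rfl
  exact LinearMap.congr_fun this y

theorem toTree_one : toTree b 1 = 0 := toTree_listValue b []

/-- The product `·` of two nonempty lists regroups to a list of at least two trees, which the
projection kills; the counit terms account for the empty list. Hence the projection kills products
of two elements of the augmentation ideal. -/
theorem toTree_mul (x y : FreeTwoAssoc K V) :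
    toTree b (x * y) = counit K V x • toTree b y + counit K V y • toTree b x := by
  have h : (TwoAssocAlgebra.dot (K := K) (A := FreeTwoAssoc K V)).compr₂ (toTree b) =
      (LinearMap.lsmul K (TreeModule K V)).compl₁₂ (counit K V) (toTree b) +
        ((LinearMap.lsmul K (TreeModule K V)).compl₁₂ (counit K V) (toTree b)).flip := by
    refine linearMap_ext_listValue b fun l => linearMap_ext_listValue b fun l' => ?_
    change toTree b (listValue K b true l * listValue K b true l') =
      counit K V (listValue K b true l) • toTree b (listValue K b true l') +
        counit K V (listValue K b true l') • toTree b (listValue K b true l)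
    cases l with
    | nil => rw [listValue_nil, one_mul, toTree_one, smul_zero, add_zero, counit_one', one_smul]
    | cons t l =>
      cases l' with
      | nil => rw [listValue_nil, mul_one, toTree_one, smul_zero, zero_add, counit_one', one_smul]
      | cons t' l' =>
        rw [counit_listValue_cons, counit_listValue_cons, zero_smul, zero_smul, add_zero,
          listValue_mul, toTree_listValue, ForestAlgebra.dotOp, regroup_regroup]
        exact singlePart_append _ (fun h => List.cons_ne_nil _ _ (regroup_eq_nil h))
          (fun h => List.cons_ne_nil _ _ (regroup_eq_nil h))
  exact LinearMap.congr_fun₂ h x y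

theorem toTree_mem_gr {d : Multiset X} {x : FreeTwoAssoc K V}
    (hx : x ∈ gr K b (fun i => ({i} : Multiset X)) d) : toTree b x ∈ TreeModule.gr K b d := by
  have : gr K b (fun i => ({i} : Multiset X)) d ≤ (TreeModule.gr K b d).comap (toTree b) := by
    refine Submodule.span_le.2 fun x hx => ?_
    obtain ⟨l, rfl, rfl⟩ := exists_eq_listValue b hx
    change toTree b (listValue K b true l) ∈ TreeModule.gr K b (listDegree l)
    rw [toTree_listValue, ← listDegree_regroup]
    generalize regroup l = l
    rcases l with _ | ⟨t, _ | ⟨t', l⟩⟩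
    · exact zero_mem _
    · exact Submodule.subset_span ⟨t, by simp [listDegree], rfl⟩
    · exact zero_mem _
  exact this hx

theorem star_toTree_listValue_singleton (t : DecTree X) :
    TreeModule.star K V (toTree b (listValue K b true (regroup [t]))) =
      listValue K b true (regroup [t]) := by
  rw [toTree_listValue, regroup_regroup, listValue_regroup, listValue_singleton]
  exact star_dec_eq_value b t

/-- Concatenating two nonempty lists gives at least two terms, which are the children of a single
tree; so the result is already of the form `t^*`. -/
theorem star_toTree_star {x y : FreeTwoAssoc K V} (hx : counit K V x = 0) (hy : counit K V y = 0) :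
    TreeModule.star K V (toTree b (TwoAssocAlgebra.star (K := K) x y)) =
      TwoAssocAlgebra.star (K := K) x y := by
  -- Composing with `J`, which kills `1` and fixes the elements of counit zero, turns the claim into
  -- a bilinear identity without hypotheses, to be checked on basis elements.
  let J := augmentation K V
  have hJ : ∀ x, J x = x - counit K V x • (1 : FreeTwoAssoc K V) := fun x => rfl
  have h : ((TwoAssocAlgebra.star (K := K)).compl₁₂ J J).compr₂ (TreeModule.star K V ∘ₗ toTree b) =
      (TwoAssocAlgebra.star (K := K)).compl₁₂ J J := by
    refine linearMap_ext_listValue b fun l => linearMap_ext_listValue b fun l' => ?_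
    change TreeModule.star K V (toTree b (TwoAssocAlgebra.star (K := K) (J _) (J _))) =
      TwoAssocAlgebra.star (K := K) (J _) (J _)
    cases l with
    | nil =>
      rw [hJ, listValue_nil, counit_one', one_smul, sub_self]
      simp only [map_zero, LinearMap.zero_apply]
    | cons t l =>
      cases l' with
      | nil =>
        rw [hJ (listValue K b true []), listValue_nil, counit_one', one_smul, sub_self]
        simp only [map_zero]
      | cons t' l' =>
        rw [hJ, hJ, counit_listValue_cons, counit_listValue_cons, zero_smul, sub_zero,
          sub_zero, listValue_star]
        have h : ∃ s, t :: l ++ t' :: l' = regroup [s] := by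
          refine (?_ : ∃ s, regroup (t :: l ++ t' :: l') = [s]).imp fun s hs => by
            rw [← hs, regroup_regroup]
          cases l <;> exact ⟨_, rfl⟩
        obtain ⟨s, hs⟩ := h
        rw [hs, star_toTree_listValue_singleton]
  have h2 := LinearMap.congr_fun₂ h x y
  simp only [LinearMap.compr₂_apply, LinearMap.compl₁₂_apply, LinearMap.comp_apply, hJ, hx, hy,
    zero_smul, sub_zero] at h2
  exact h2

/-- Project `Id = 1 + e * Id` to trees. Since `c ∘ e = 0`, a product `e(x') · x''` projects to
`c(x'')` times the projection of `e(x')`, and the counit axiom leaves that of `e(x)`. -/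
theorem toTree_idem (x : FreeTwoAssoc K V) :
    toTree b (InfBialgebra.idem K (FreeTwoAssoc K V) x) = toTree b x := by
  set e := InfBialgebra.idem K (FreeTwoAssoc K V) with he
  have h1 : ∀ Y : FreeTwoAssoc K V ⊗[K] FreeTwoAssoc K V,
      toTree b (LinearMap.mul' K _ (TensorProduct.map e.ofConv LinearMap.id Y)) =
        toTree b (e (TensorProduct.rid K _ ((counit K V).lTensor _ Y))) := by
    intro Y
    induction Y with
    | zero => simp
    | add Y Y' h h' => simp only [map_add, h, h']
    | tmul x y =>
      rw [TensorProduct.map_tmul, LinearMap.mul'_apply, LinearMap.id_apply, toTree_mul,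
        LinearMap.lTensor_tmul, TensorProduct.rid_tmul, map_smul, map_smul]
      have : counit K V (e x) = 0 := InfBialgebra.counit_idem x
      rw [show counit K V (e.ofConv x) = 0 from this, zero_smul, zero_add]
  have h2 := congrArg (fun f : WithConv (FreeTwoAssoc K V →ₗ[K] FreeTwoAssoc K V) => toTree b (f x))
    (InfBialgebra.convId_eq K (FreeTwoAssoc K V))
  have h3 : (1 + e * InfBialgebra.convId K (FreeTwoAssoc K V) :
      WithConv (FreeTwoAssoc K V →ₗ[K] FreeTwoAssoc K V)) x =
        counit K V x • (1 : FreeTwoAssoc K V) +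
        LinearMap.mul' K _ (TensorProduct.map e.ofConv LinearMap.id (comul K V x)) :=
    congrArg₂ (· + ·) (InfBialgebra.one_apply x) rfl
  have h4 : TensorProduct.rid K _ ((counit K V).lTensor _ (comul K V x)) = x := by
    have := Coalgebra.lTensor_counit_comul (R := K) x
    exact (congrArg (TensorProduct.rid K _) this).trans (by simp)
  refine (h2.trans ?_).symm
  change toTree b ((1 + e * InfBialgebra.convId K (FreeTwoAssoc K V) :
    WithConv (FreeTwoAssoc K V →ₗ[K] FreeTwoAssoc K V)) x) = _
  rw [h3, map_add, map_smul, toTree_one, smul_zero, zero_add, h1, h4]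

/-- The element `x` and its component in the span of the `t^*` differ by a multiple of `1` and by
products `·` of elements of the augmentation ideal, all of which `e` kills. -/
theorem idem_star_toTree (x : FreeTwoAssoc K V) :
    InfBialgebra.idem K (FreeTwoAssoc K V) (TreeModule.star K V (toTree b x)) =
      InfBialgebra.idem K (FreeTwoAssoc K V) x := by
  set e := InfBialgebra.idem K (FreeTwoAssoc K V) with he
  have h : e.ofConv ∘ₗ TreeModule.star K V ∘ₗ toTree b = e.ofConv := by
    refine linearMap_ext_listValue b fun l => ?_
    change e (TreeModule.star K V (toTree b (listValue K b true l))) = e (listValue K b true l)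
    rw [← regroup_regroup l]
    generalize regroup l = l
    rcases l with _ | ⟨t, _ | ⟨t', l⟩⟩
    · rw [toTree_listValue]
      change e (TreeModule.star K V 0) = e 1
      rw [map_zero, he, InfBialgebra.idem_one, map_zero]
    · rw [star_toTree_listValue_singleton]
    · rw [toTree_listValue, regroup_regroup, listValue_regroup]
      change e (TreeModule.star K V 0) =
        e (value K b t true * listValue K b false (t' :: l))
      rw [map_zero, map_zero, he, InfBialgebra.idem_mul _ (counit_listValue_cons b false t' l)]
      have : Coalgebra.counit (R := K) (value K b t true) = 0 := counit_value b t.1 t.2 true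
      rw [this, zero_smul]
  exact LinearMap.congr_fun h x

end

end FreeTwoAssoc

/-! ## Operations defined by bilinear maps on tensor algebras -/

namespace TensorAlgebra

section

variable {K : Type*} [Field K] {R : Type*} [AddCommGroup R] [Module K R]

/-- The multilinear operations given by a bilinear map on the tensor algebra. -/
noncomputable def opOfBilin (B : TensorAlgebra K R →ₗ[K] TensorAlgebra K R →ₗ[K] R) (p q : ℕ) :
    MultilinearMap K (fun _ : Fin p => R) (MultilinearMap K (fun _ : Fin q => R) R) :=
  LinearMap.compMultilinearMap
    { toFun := fun u => (B u).compMultilinearMap (tprod K R q)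
      map_add' := fun u v => by
        ext
        simp
      map_smul' := fun c u => by
        ext
        simp } (tprod K R p)

theorem opOfBilin_apply (B : TensorAlgebra K R →ₗ[K] TensorAlgebra K R →ₗ[K] R) (p q : ℕ)
    (a : Fin p → R) (b : Fin q → R) :
    opOfBilin B p q a b = B (tprod K R p a) (tprod K R q b) := rfl

theorem opLin_opOfBilin (B : TensorAlgebra K R →ₗ[K] TensorAlgebra K R →ₗ[K] R)
    (u v : TensorAlgebra K R) : opLin (opOfBilin B) (u ⊗ₜ v) = B u v := by
  have h : TensorProduct.curry (opLin (opOfBilin B)) = B :=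
    linearMap_ext_word fun n x => linearMap_ext_word fun m y => by
      rw [TensorProduct.curry_apply, opLin_word, opOfBilin_apply]
      rfl
  exact LinearMap.congr_fun₂ h u v

variable {A : Type*} [Ring A] [Algebra K A] [Coalgebra K A]

/-- A bilinear product compatible with the coproduct and the counit, as a morphism of
coalgebras. -/
noncomputable def productHom (star : A →ₗ[K] A →ₗ[K] A)
    (hΔ : ∀ x y, comul (R := K) (star x y) =
      TensorProduct.map₂ star star (comul (R := K) x) (comul (R := K) y))
    (hc : ∀ x y, counit (R := K) (star x y) = counit (R := K) x * counit (R := K) y) :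
    A ⊗[K] A →ₗc[K] A :=
  { TensorProduct.lift star with
    counit_comp := TensorProduct.ext' fun x y => by
      change counit (R := K) (star x y) = _
      rw [hc, TensorProduct.counit_tmul, smul_eq_mul, mul_comm]
    map_comp_comul := TensorProduct.ext' fun x y => by
      change TensorProduct.map (TensorProduct.lift star) (TensorProduct.lift star)
        (comul (R := K) (x ⊗ₜ[K] y)) = comul (R := K) (star x y)
      rw [hΔ, TensorProduct.comul_tmul]
      generalize comul (R := K) x = X
      generalize comul (R := K) y = Y
      induction X with
      | zero => simp
      | add X X' h h' => simp only [TensorProduct.add_tmul, map_add, LinearMap.add_apply, h, h']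
      | tmul a b =>
        induction Y with
        | zero => simp
        | add X X' h h' => simp only [TensorProduct.tmul_add, map_add, h, h']
        | tmul c d => rfl }

variable [InfBialgebra K A] (s : R →ₗ[K] A)

/-- The morphism of algebras on the tensor algebra that extends `e ∘ s`. -/
noncomputable def idemLift : TensorAlgebra K R →ₐ[K] A :=
  lift K ((InfBialgebra.idem K A).ofConv ∘ₗ s)

theorem idemLift_ι (r : R) : idemLift s (ι K r) = InfBialgebra.idem K A (s r) :=
  lift_ι_apply _ _

theorem comul_idemLift_ι (r : R) : comul (R := K) (idemLift s (ι K r)) =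
    idemLift s (ι K r) ⊗ₜ 1 + 1 ⊗ₜ idemLift s (ι K r) := by
  rw [idemLift_ι]
  exact InfBialgebra.comul_idem _

theorem counit_idemLift (u : TensorAlgebra K R) :
    counit (R := K) (idemLift s u) = counit (R := K) u :=
  counit_algHom (comul_idemLift_ι s) u

/-- `idemLift` as a morphism of coalgebras. -/
noncomputable def idemLiftHom : TensorAlgebra K R →ₗc[K] A :=
  { (idemLift s).toLinearMap with
    counit_comp := LinearMap.ext (counit_idemLift s)
    map_comp_comul := LinearMap.ext fun x => (comul_algHom (comul_idemLift_ι s) x).symm }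

variable {s}

/-- If the operations on `R` come from a product on `A`, then the induced product of the tensor
algebra is compatible with the product of `A`. -/
theorem idemLift_starHom {star : A →ₗ[K] A →ₗ[K] A}
    (hΔ : ∀ x y, comul (R := K) (star x y) =
      TensorProduct.map₂ star star (comul (R := K) x) (comul (R := K) y))
    (hc : ∀ x y, counit (R := K) (star x y) = counit (R := K) x * counit (R := K) y)
    (h1 : star 1 1 = 1) {ρ : A →ₗ[K] R}
    (hρ : ∀ x, InfBialgebra.idem K A (s (ρ x)) = InfBialgebra.idem K A x)
    {M : ∀ p q : ℕ,
      MultilinearMap K (fun _ : Fin p => R) (MultilinearMap K (fun _ : Fin q => R) R)}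
    (hM : ∀ a b, M 0 0 a b = 0)
    (hMρ : ∀ u v, opLin M (u ⊗ₜ v) = ρ (star (idemLift s u) (idemLift s v)))
    (u v : TensorAlgebra K R) :
    idemLift s (starHom hM (u ⊗ₜ v)) = star (idemLift s u) (idemLift s v) := by
  let g : TensorAlgebra K R ⊗[K] TensorAlgebra K R →ₗc[K] A :=
    (productHom star hΔ hc).comp (Coalgebra.TensorProduct.map (idemLiftHom s) (idemLiftHom s))
  have hg : ∀ u v, g (u ⊗ₜ v) = star (idemLift s u) (idemLift s v) := fun u v => rfl
  -- Both sides of the claim solve `Y = 1 + (e ∘ g) * Y`. For the left side, compose the equation of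
  -- `starHom` with a morphism of algebras; for the right side, compose that of the identity of `A`
  -- with the morphism of coalgebras `g`.
  have h2 := congrArg (convPost _ (idemLift s)) (starHom_eq hM)
  rw [map_add, map_mul, map_one] at h2
  have h3 := congrArg (convPre A g) (InfBialgebra.convId_eq K A)
  rw [map_add, map_mul, map_one] at h3
  have h4 : convPost _ (idemLift s) (toConv (ι K ∘ₗ opLin M)) =
      convPre A g (InfBialgebra.idem K A) :=
    WithConv.ext (TensorProduct.ext' fun u v => by
      change idemLift s (ι K (opLin M (u ⊗ₜ v))) = InfBialgebra.idem K A (g (u ⊗ₜ v))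
      rw [idemLift_ι, hMρ, hρ, hg])
  rw [h4] at h2
  have h5 : convPre A g (InfBialgebra.idem K A) ((1 : TensorAlgebra K R) ⊗ₜ[K] 1) = 0 := by
    rw [convPre_apply, hg, map_one, h1, InfBialgebra.idem_one]
  have h6 := (isConilpotent_tensor K R).eq_of_eq_add_mul h5 h2 h3
  exact congrArg (fun f : WithConv (TensorAlgebra K R ⊗[K] TensorAlgebra K R →ₗ[K] A) =>
    f (u ⊗ₜ v)) h6

end

end TensorAlgebra

/-! ## The `B∞`-algebra of decorated trees -/

namespace TreeModule

section

variable (K : Type u) (V : Type v) [Field K] [AddCommGroup V] [Module K V]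

/-- The projection of `2as(V)` onto the space of decorated trees. -/
noncomputable def part : FreeTwoAssoc K V →ₗ[K] TreeModule K V :=
  FreeTwoAssoc.toTree (Module.Basis.ofVectorSpace K V)

/-- The morphism `s_1 ⋯ s_n ↦ e(s_1^*) · ⋯ · e(s_n^*)`. -/
noncomputable def idemStar : TensorAlgebra K (TreeModule K V) →ₐ[K] FreeTwoAssoc K V :=
  TensorAlgebra.idemLift (star K V)

/-- The bilinear map that defines the operations on decorated trees. -/
noncomputable def opBilin : TensorAlgebra K (TreeModule K V) →ₗ[K]
    TensorAlgebra K (TreeModule K V) →ₗ[K] TreeModule K V :=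
  (TwoAssocAlgebra.star.compl₁₂ (idemStar K V).toLinearMap (idemStar K V).toLinearMap).compr₂
    (part K V)

variable {K V}

/-- For every basis the projection depends on `x` only through `e(x)`, and `e` does not see the
passage from `x` to its projection for another basis. The freedom of basis is needed for `K^n`,
where degrees refer to the standard basis. -/
theorem part_eq_toTree {X : Type*} (b : Module.Basis X K V) (x : FreeTwoAssoc K V) :
    part K V x = FreeTwoAssoc.toTree b x := by
  rw [← FreeTwoAssoc.toTree_idem b, ← FreeTwoAssoc.idem_star_toTree (Module.Basis.ofVectorSpace K V),
    FreeTwoAssoc.toTree_idem b, FreeTwoAssoc.toTree_star]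
  rfl

theorem part_star (y : TreeModule K V) : part K V (star K V y) = y :=
  FreeTwoAssoc.toTree_star _ y

theorem idem_star_part (x : FreeTwoAssoc K V) :
    InfBialgebra.idem K (FreeTwoAssoc K V) (star K V (part K V x)) =
      InfBialgebra.idem K (FreeTwoAssoc K V) x :=
  FreeTwoAssoc.idem_star_toTree _ x

theorem idemStar_ι (y : TreeModule K V) : idemStar K V (TensorAlgebra.ι K y) =
    InfBialgebra.idem K (FreeTwoAssoc K V) (star K V y) :=
  TensorAlgebra.idemLift_ι _ y

theorem idemStar_tprod (n : ℕ) (a : Fin n → TreeModule K V) :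
    idemStar K V (TensorAlgebra.tprod K _ n a) =
      iterProd (K := K) TwoAssocAlgebra.dot (TwoAssocAlgebra.one K) n
        fun i => InfBialgebra.idem K (FreeTwoAssoc K V) (star K V (a i)) := by
  induction n with
  | zero =>
    rw [TensorAlgebra.tprod_zero, map_one]
    rfl
  | succ n ih =>
    rw [TensorAlgebra.tprod_succ, map_mul, iterProd_succ, ih, idemStar_ι]
    rfl

/-- Words of length at least two go to products, which project to zero; on letters, projecting
`e(y^*)` gives `y` back. -/
theorem part_idemStar (u : TensorAlgebra K (TreeModule K V)) :
    part K V (idemStar K V u) = TensorAlgebra.proj K _ u := by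
  have h : part K V ∘ₗ (idemStar K V).toLinearMap = TensorAlgebra.proj K _ := by
    refine TensorAlgebra.linearMap_ext_left ?_ fun r u _ => ?_
    · rw [LinearMap.comp_apply, AlgHom.toLinearMap_apply, map_one, TensorAlgebra.proj_one]
      exact FreeTwoAssoc.toTree_one _
    · have h1 : FreeTwoAssoc.counit K V (InfBialgebra.idem K (FreeTwoAssoc K V) (star K V r)) = 0 :=
        InfBialgebra.counit_idem _
      have h2 : FreeTwoAssoc.counit K V (idemStar K V u) = counit (R := K) u :=
        TensorAlgebra.counit_idemLift _ u
      rw [LinearMap.comp_apply, AlgHom.toLinearMap_apply, map_mul, idemStar_ι,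
        TensorAlgebra.proj_ι_mul, part, FreeTwoAssoc.toTree_mul, h1, h2, zero_smul, zero_add,
        FreeTwoAssoc.toTree_idem, FreeTwoAssoc.toTree_star]
  exact LinearMap.congr_fun h u

theorem opBilin_apply (u v : TensorAlgebra K (TreeModule K V)) : opBilin K V u v =
    part K V (TwoAssocAlgebra.star (K := K) (idemStar K V u) (idemStar K V v)) := rfl

theorem opBilin_one_left (u : TensorAlgebra K (TreeModule K V)) :
    opBilin K V 1 u = TensorAlgebra.proj K _ u := by
  rw [opBilin_apply, map_one, ← part_idemStar]
  exact congrArg (part K V) (TwoAssocAlgebra.one_star _)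

theorem opBilin_one_right (u : TensorAlgebra K (TreeModule K V)) :
    opBilin K V u 1 = TensorAlgebra.proj K _ u := by
  rw [opBilin_apply, map_one, ← part_idemStar]
  exact congrArg (part K V) (TwoAssocAlgebra.star_one _)

theorem opOfBilin_zero_zero (a b : Fin 0 → TreeModule K V) :
    TensorAlgebra.opOfBilin (opBilin K V) 0 0 a b = 0 := by
  rw [TensorAlgebra.opOfBilin_apply, TensorAlgebra.tprod_zero, TensorAlgebra.tprod_zero,
    opBilin_one_left, TensorAlgebra.proj_one]

theorem idemStar_starHom (u v : TensorAlgebra K (TreeModule K V)) :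
    idemStar K V (TensorAlgebra.starHom (opOfBilin_zero_zero (K := K) (V := V)) (u ⊗ₜ v)) =
      TwoAssocAlgebra.star (K := K) (idemStar K V u) (idemStar K V v) :=
  TensorAlgebra.idemLift_starHom FreeTwoAssoc.comul_star FreeTwoAssoc.counit_star
    (TwoAssocAlgebra.one_star (K := K) (A := FreeTwoAssoc K V) _) idem_star_part _
    (fun u v => TensorAlgebra.opLin_opOfBilin _ u v) u v

/-- Both sides are the projection of the triple product `*` of the images of `u`, `v`, `w` in
`2as(V)`. Evaluated on words, this is the `B∞`-relation for trees. -/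
theorem opBilin_starHom (u v w : TensorAlgebra K (TreeModule K V)) :
    opBilin K V (TensorAlgebra.starHom (opOfBilin_zero_zero (K := K) (V := V)) (u ⊗ₜ v)) w =
      opBilin K V u
        (TensorAlgebra.starHom (opOfBilin_zero_zero (K := K) (V := V)) (v ⊗ₜ w)) := by
  rw [opBilin_apply, opBilin_apply, idemStar_starHom, idemStar_starHom, TwoAssocAlgebra.star_assoc]

theorem proj_tprod_one (a : Fin 1 → TreeModule K V) :
    TensorAlgebra.proj K _ (TensorAlgebra.tprod K _ 1 a) = a 0 := by
  rw [TensorAlgebra.tprod_eq_word, TensorAlgebra.proj_word]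
  rfl

theorem proj_tprod_of_two_le {n : ℕ} (hn : 2 ≤ n) (a : Fin n → TreeModule K V) :
    TensorAlgebra.proj K _ (TensorAlgebra.tprod K _ n a) = 0 := by
  rw [TensorAlgebra.tprod_eq_word, TensorAlgebra.proj_word, if_neg (by omega)]

noncomputable instance : BInfAlgebra K (TreeModule K V) where
  M := TensorAlgebra.opOfBilin (opBilin K V)
  M_zero_zero := opOfBilin_zero_zero
  M_one_zero a b := by
    rw [TensorAlgebra.opOfBilin_apply, TensorAlgebra.tprod_zero, opBilin_one_right, proj_tprod_one]
  M_zero_one a b := by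
    rw [TensorAlgebra.opOfBilin_apply, TensorAlgebra.tprod_zero, opBilin_one_left, proj_tprod_one]
  M_left_zero n hn a b := by
    rw [TensorAlgebra.opOfBilin_apply, TensorAlgebra.tprod_zero, opBilin_one_right,
      proj_tprod_of_two_le hn]
  M_zero_right n hn a b := by
    rw [TensorAlgebra.opOfBilin_apply, TensorAlgebra.tprod_zero, opBilin_one_left,
      proj_tprod_of_two_le hn]
  relation i j k hi hj hk x y z := by
    have h := opBilin_starHom (TensorAlgebra.word K i x) (TensorAlgebra.word K j y)
      (TensorAlgebra.word K k z)
    rw [TensorAlgebra.starHom_word _ (by omega), TensorAlgebra.starHom_word _ (by omega)] at h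
    simp only [map_sum, LinearMap.sum_apply] at h
    exact h

theorem M_apply (p q : ℕ) (a : Fin p → TreeModule K V) (b : Fin q → TreeModule K V) :
    BInfAlgebra.M (K := K) p q a b = part K V (TwoAssocAlgebra.star (K := K)
      (idemStar K V (TensorAlgebra.tprod K _ p a)) (idemStar K V (TensorAlgebra.tprod K _ q b))) :=
  rfl

theorem idem_star_M (p q : ℕ) (a : Fin p → TreeModule K V) (b : Fin q → TreeModule K V) :
    InfBialgebra.idem K (FreeTwoAssoc K V) (star K V (BInfAlgebra.M (K := K) p q a b)) =
      InfBialgebra.idem K (FreeTwoAssoc K V) (TwoAssocAlgebra.star (K := K)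
        (idemStar K V (TensorAlgebra.tprod K _ p a))
        (idemStar K V (TensorAlgebra.tprod K _ q b))) := by
  rw [M_apply, idem_star_part]

theorem counit_idemStar_tprod {n : ℕ} (hn : 1 ≤ n) (a : Fin n → TreeModule K V) :
    FreeTwoAssoc.counit K V (idemStar K V (TensorAlgebra.tprod K _ n a)) = 0 := by
  obtain ⟨n, rfl⟩ := Nat.exists_eq_add_of_le' hn
  refine (TensorAlgebra.counit_idemLift (star K V) _).trans ?_
  rw [TensorAlgebra.tprod_succ, TensorAlgebra.counit_mul, TensorAlgebra.counit_ι, zero_mul]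

/-- Both factors have counit zero, so their product `*` lies in the span of the `t^*` and the
projection changes nothing. The bounds matter: for `M_{10}` the two sides would be `a^*` and
`e(a^*)`. -/
theorem star_M {p q : ℕ} (hp : 1 ≤ p) (hq : 1 ≤ q) (a : Fin p → TreeModule K V)
    (b : Fin q → TreeModule K V) :
    star K V (BInfAlgebra.M (K := K) p q a b) = TwoAssocAlgebra.star (K := K)
      (idemStar K V (TensorAlgebra.tprod K _ p a))
      (idemStar K V (TensorAlgebra.tprod K _ q b)) := by
  rw [M_apply]
  exact FreeTwoAssoc.star_toTree_star _ (counit_idemStar_tprod hp a) (counit_idemStar_tprod hq b)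

end

end TreeModule

/-! ## Functoriality of the tensor algebra of a `B∞`-algebra -/

namespace TensorAlgebra

section

variable {K : Type*} [Field K] {R R' : Type*} [AddCommGroup R] [Module K R] [AddCommGroup R']
  [Module K R']

/-- The morphism of tensor algebras induced by a linear map. -/
noncomputable def mapHom (f : R →ₗ[K] R') : TensorAlgebra K R →ₐ[K] TensorAlgebra K R' :=
  lift K (ι K ∘ₗ f)

theorem mapHom_ι (f : R →ₗ[K] R') (r : R) : mapHom f (ι K r) = ι K (f r) :=
  lift_ι_apply _ _

theorem mapHom_tprod (f : R →ₗ[K] R') (n : ℕ) (a : Fin n → R) :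
    mapHom f (tprod K R n a) = tprod K R' n fun i => f (a i) := by
  induction n with
  | zero => rw [tprod_zero, tprod_zero, map_one]
  | succ n ih => rw [tprod_succ, tprod_succ, map_mul, ih, mapHom_ι]

theorem mapHom_word (f : R →ₗ[K] R') (n : ℕ) (x : ℕ → R) :
    mapHom f (word K n x) = word K n fun i => f (x i) :=
  mapHom_tprod f n _

theorem proj_map (f : R →ₗ[K] R') (u : TensorAlgebra K R) :
    proj K R' (mapHom f u) = f (proj K R u) := by
  have h : proj K R' ∘ₗ (mapHom f).toLinearMap = f ∘ₗ proj K R :=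
    linearMap_ext_word fun n x => by
      simp only [LinearMap.comp_apply, AlgHom.toLinearMap_apply, mapHom_word, proj_word]
      split_ifs <;> simp
  exact LinearMap.congr_fun h u

theorem map_starB [BInfAlgebra K R] [BInfAlgebra K R'] {f : R →ₗ[K] R'}
    (hf : ∀ p q a b, f (BInfAlgebra.M (K := K) p q a b) =
      BInfAlgebra.M (K := K) p q (fun i => f (a i)) fun j => f (b j))
    (u v : TensorAlgebra K R) : mapHom f (starB K R (u ⊗ₜ v)) = starB K R' (mapHom f u ⊗ₜ mapHom f v) := by
  have h : (TensorProduct.curry (starB K R).toLinearMap).compr₂ (mapHom f).toLinearMap =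
      (TensorProduct.curry (starB K R').toLinearMap).compl₁₂ (mapHom f).toLinearMap
        (mapHom f).toLinearMap := by
    refine linearMap_ext_word fun i x => linearMap_ext_word fun j y => ?_
    change mapHom f (starB K R (word K i x ⊗ₜ word K j y)) =
      starB K R' (mapHom f (word K i x) ⊗ₜ mapHom f (word K j y))
    -- The formula on words requires a positive total length, so an empty first word is treated by
    -- the unit law.
    rcases i with _ | i
    · rw [word_zero, starB_one_tmul, map_one, starB_one_tmul]
    · rw [mapHom_word, mapHom_word, starB, starB, starHom_word _ (by omega), starHom_word _ (by omega)]
      simp only [map_sum, mapHom_tprod, hf]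
      rfl
  exact LinearMap.congr_fun₂ h u v

end

end TensorAlgebra

/-! ## The free `B∞`-algebra as the `B∞`-algebra of decorated trees -/

namespace FreeTwoAssoc

section

variable {K : Type u} {V : Type v} [Field K] [AddCommGroup V] [Module K V]

/-- Evaluate `Id = 1 + e * Id` at the primitive element `v`, using `e(1) = 0`. -/
theorem idem_ι (v : V) : InfBialgebra.idem K (FreeTwoAssoc K V) (ι K v) = ι K v := by
  have h := congrArg (fun f : WithConv (FreeTwoAssoc K V →ₗ[K] FreeTwoAssoc K V) => f (ι K v))
    (InfBialgebra.convId_eq K (FreeTwoAssoc K V))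
  have h1 : (InfBialgebra.idem K (FreeTwoAssoc K V) * InfBialgebra.convId K (FreeTwoAssoc K V))
      (ι K v) =
      InfBialgebra.idem K (FreeTwoAssoc K V) (ι K v) := by
    rw [LinearMap.convMul_apply]
    rw [show Coalgebra.comul (R := K) (ι K v) = _ from comul_ι (K := K) v, map_add, map_add, TensorProduct.map_tmul, TensorProduct.map_tmul, LinearMap.mul'_apply,
      LinearMap.mul'_apply]
    change InfBialgebra.idem K (FreeTwoAssoc K V) (ι K v) * 1 +
      InfBialgebra.idem K (FreeTwoAssoc K V) 1 * ι K v = _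
    rw [mul_one, InfBialgebra.idem_one, zero_mul, add_zero]
  have h2 : (1 : WithConv (FreeTwoAssoc K V →ₗ[K] FreeTwoAssoc K V)) (ι K v) = 0 := by
    rw [InfBialgebra.one_apply]
    exact zero_smul K _
  refine (h.trans ?_).symm
  exact (congrArg₂ (· + ·) h2 h1).trans (zero_add _)

/-! ### Morphisms from `2as(V)` to infinitesimal bialgebras with a second product -/

section

variable {B : Type*} [Ring B] [Algebra K B] [Coalgebra K B] [InfBialgebra K B]
  {star : B →ₗ[K] B →ₗ[K] B} {F : FreeTwoAssoc K V →ₐ[K] B}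

theorem counit_algHom
    (hc : ∀ x y, Coalgebra.counit (R := K) (star x y) =
      Coalgebra.counit (R := K) x * Coalgebra.counit (R := K) y)
    (hF : ∀ x y, F (TwoAssocAlgebra.star (K := K) x y) = star (F x) (F y))
    (hι : ∀ v, Coalgebra.comul (R := K) (F (ι K v)) = F (ι K v) ⊗ₜ 1 + 1 ⊗ₜ F (ι K v))
    (x : FreeTwoAssoc K V) :
    Coalgebra.counit (R := K) (F x) = Coalgebra.counit (R := K) x := by
  induction x using induction with
  | of v => exact (InfBialgebra.counit_eq_zero_of_primitive (hι v)).trans (counit_ι v).symm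
  | one => rw [map_one, InfBialgebra.counit_one, InfBialgebra.counit_one]
  | add x y h h' => simp only [map_add, h, h']
  | smul c x h => simp only [map_smul, h]
  | star x y h h' =>
    rw [hF, hc, h, h']
    exact (counit_star x y).symm
  | mul x y h h' => rw [map_mul, InfBialgebra.counit_mul, h, h', InfBialgebra.counit_mul]

theorem comul_algHom
    (hΔ : ∀ x y, Coalgebra.comul (R := K) (star x y) = TensorProduct.map₂ star star
      (Coalgebra.comul (R := K) x) (Coalgebra.comul (R := K) y))
    (hF : ∀ x y, F (TwoAssocAlgebra.star (K := K) x y) = star (F x) (F y))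
    (hι : ∀ v, Coalgebra.comul (R := K) (F (ι K v)) = F (ι K v) ⊗ₜ 1 + 1 ⊗ₜ F (ι K v))
    (x : FreeTwoAssoc K V) : Coalgebra.comul (R := K) (F x) =
    TensorProduct.map F.toLinearMap F.toLinearMap (Coalgebra.comul (R := K) x) := by
  set F' := F.toLinearMap with hF'
  have hF1 : F' 1 = 1 := map_one F
  have hFa : ∀ x, F' x = F x := fun _ => rfl
  induction x using induction with
  | of v =>
    rw [show Coalgebra.comul (R := K) (ι K v) = _ from comul_ι (K := K) v, map_add,
      TensorProduct.map_tmul, TensorProduct.map_tmul, one_eq, hF1]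
    exact hι v
  | one =>
    rw [map_one, InfBialgebra.comul_one, InfBialgebra.comul_one, TensorProduct.map_tmul, hF1]
  | add x y h h' => simp only [map_add, h, h']
  | smul c x h => simp only [map_smul, h]
  | star x y h h' =>
    rw [hF, hΔ, h, h']
    refine Eq.trans ?_ (congrArg (TensorProduct.map F' F') (comul_star x y)).symm
    change _ = TensorProduct.map F' F' (tensorStar K _ (Coalgebra.comul (R := K) x)
      (Coalgebra.comul (R := K) y))
    generalize Coalgebra.comul (R := K) x = X
    generalize Coalgebra.comul (R := K) y = Y
    induction X with
    | zero => simp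
    | add X X' h h' => simp only [map_add, LinearMap.add_apply, h, h']
    | tmul a b =>
      induction Y with
      | zero => simp
      | add X X' h h' => simp only [map_add, h, h']
      | tmul c d =>
        rw [tensorStar_tmul, TensorProduct.map_tmul, TensorProduct.map_tmul,
          TensorProduct.map_tmul]
        exact (congrArg₂ (· ⊗ₜ[K] ·) (hF a c) (hF b d)).symm
  | mul x y h h' =>
    rw [map_mul, InfBialgebra.comul_mul, InfBialgebra.comul_mul, h, h', map_sub, map_add]
    have hm : ∀ X Y, TensorProduct.map F' F' (X * Y) =
        TensorProduct.map F' F' X * TensorProduct.map F' F' Y :=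
      map_mul (Algebra.TensorProduct.map F F)
    rw [hm, hm, TensorProduct.map_tmul, TensorProduct.map_tmul, TensorProduct.map_tmul, hF1]
    rfl

theorem idem_algHom
    (hΔ : ∀ x y, Coalgebra.comul (R := K) (star x y) = TensorProduct.map₂ star star
      (Coalgebra.comul (R := K) x) (Coalgebra.comul (R := K) y))
    (hc : ∀ x y, Coalgebra.counit (R := K) (star x y) =
      Coalgebra.counit (R := K) x * Coalgebra.counit (R := K) y)
    (hF : ∀ x y, F (TwoAssocAlgebra.star (K := K) x y) = star (F x) (F y))
    (hι : ∀ v, Coalgebra.comul (R := K) (F (ι K v)) = F (ι K v) ⊗ₜ 1 + 1 ⊗ₜ F (ι K v))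
    (x : FreeTwoAssoc K V) :
    InfBialgebra.idem K B (F x) = F (InfBialgebra.idem K (FreeTwoAssoc K V) x) :=
  InfBialgebra.idem_map F (counit_algHom hc hF hι) (comul_algHom hΔ hF hι) x

end

/-! ### The morphism from `2as(V)` to the tensor algebra of a `B∞`-algebra -/

section

variable {R : Type w} [AddCommGroup R] [Module K R] [BInfAlgebra K R] (f : V →ₗ[K] R)

/-- The morphism from `2as(V)` to the tensor algebra of a `B∞`-algebra that extends a linear map. -/
noncomputable def toTensor : FreeTwoAssoc K V →ₐ[K] TensorAlgebra K R :=
  AlgHom.ofLinearMap (lift (TensorAlgebra.ι K ∘ₗ f)) (lift_one _) (lift_dot _)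

theorem toTensor_star (x y : FreeTwoAssoc K V) :
    toTensor f (TwoAssocAlgebra.star (K := K) x y) =
      TensorAlgebra.starB K R (toTensor f x ⊗ₜ toTensor f y) :=
  lift_star _ x y

theorem toTensor_ι (v : V) : toTensor f (ι K v) = TensorAlgebra.ι K (f v) := rfl

/-- The morphism respects both products and sends `V` to primitive elements, so it is compatible
with the coproducts and commutes with `e`; on the tensor algebra `e` is the projection to letters.
-/
theorem toTensor_idem (x : FreeTwoAssoc K V) :
    toTensor f (InfBialgebra.idem K (FreeTwoAssoc K V) x) =
      TensorAlgebra.ι K (TensorAlgebra.proj K R (toTensor f x)) := by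
  rw [← TensorAlgebra.idem_apply]
  refine (idem_algHom (star := TwoAssocAlgebra.star) (fun x y => ?_) (fun x y => ?_)
    (toTensor_star f) (fun v => TensorAlgebra.comul_ι (f v)) x).symm
  · refine (CoalgHomClass.map_comp_comul_apply (TensorAlgebra.starB K R) (x ⊗ₜ y)).symm.trans ?_
    rw [TensorProduct.comul_tmul]
    generalize Coalgebra.comul (R := K) x = X
    generalize Coalgebra.comul (R := K) y = Y
    induction X with
    | zero => simp
    | add X X' h h' => simp only [TensorProduct.add_tmul, map_add, LinearMap.add_apply, h, h']
    | tmul a b =>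
      induction Y with
      | zero => simp
      | add X X' h h' => simp only [TensorProduct.tmul_add, map_add, h, h']
      | tmul c d => rfl
  · refine (CoalgHomClass.counit_comp_apply (TensorAlgebra.starB K R) (x ⊗ₜ y)).trans ?_
    rw [TensorProduct.counit_tmul, smul_eq_mul, mul_comm]

end

/-! ### Functoriality of `2as(V)` -/

section

variable {W : Type w} [AddCommGroup W] [Module K W] (f : V →ₗ[K] W)

/-- The morphism of free 2-associative algebras induced by a linear map. -/
noncomputable def mapHom : FreeTwoAssoc K V →ₐ[K] FreeTwoAssoc K W :=
  AlgHom.ofLinearMap (lift (ι K ∘ₗ f)) (lift_one _) (lift_dot _)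

theorem mapHom_star (x y : FreeTwoAssoc K V) :
    mapHom f (TwoAssocAlgebra.star (K := K) x y) =
      TwoAssocAlgebra.star (K := K) (mapHom f x) (mapHom f y) :=
  lift_star _ x y

theorem idem_mapHom (x : FreeTwoAssoc K V) :
    InfBialgebra.idem K (FreeTwoAssoc K W) (mapHom f x) =
      mapHom f (InfBialgebra.idem K (FreeTwoAssoc K V) x) :=
  idem_algHom (star := TwoAssocAlgebra.star) comul_star counit_star (mapHom_star f)
    (fun v => comul_ι (f v)) x

theorem mapHom_iterProd (β : Bool) (n : ℕ) (a : Fin n → FreeTwoAssoc K V) :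
    mapHom f (iterProd (K := K) (if β then TwoAssocAlgebra.star else TwoAssocAlgebra.dot)
      (TwoAssocAlgebra.one K) n a) =
      iterProd (K := K) (if β then TwoAssocAlgebra.star else TwoAssocAlgebra.dot)
        (TwoAssocAlgebra.one K) n fun i => mapHom f (a i) := by
  induction n with
  | zero => rfl
  | succ n ih =>
    rw [iterProd_succ, iterProd_succ, ← ih]
    cases β
    · exact lift_dot _ _ _
    · exact lift_star _ _ _

theorem mapHom_toFree (t : PlanarTree) (β : Bool) (x : Fin t.leaves → V) :
    mapHom f (t.toFree β x) = t.toFree β fun s => f (x s) := by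
  induction t generalizing β with
  | leaf => rfl
  | node k c ih =>
    refine (congrArg (mapHom f) (PlanarTree.toFree_node k c β x)).trans ?_
    refine (mapHom_iterProd f β (k + 2) _).trans ?_
    refine Eq.trans ?_ (PlanarTree.toFree_node k c β fun s => f (x s)).symm
    exact congrArg _ (funext fun i => ih i (!β) _)

end

end

end FreeTwoAssoc

namespace TreeModule

section

variable {K : Type u} {V : Type v} [Field K] [AddCommGroup V] [Module K V]

/-- The trivial tree, as a linear function of its decoration. -/
noncomputable def leafMap (K : Type u) (V : Type v) [Field K] [AddCommGroup V] [Module K V] :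
    V →ₗ[K] TreeModule K V :=
  (MultilinearMap.ofSubsingleton K V (TreeModule K V) (0 : Fin 1)).symm
    (decMap K V (⟨.leaf, rfl⟩ : PT 1))

theorem leafMap_apply (v : V) :
    leafMap K V v = dec K (⟨.leaf, rfl⟩ : PT 1) fun _ => v := rfl

theorem star_leafMap (v : V) : star K V (leafMap K V v) = FreeTwoAssoc.ι K v := by
  exact star_dec (⟨.leaf, rfl⟩ : PT 1) _

/-- The morphism from the free `B∞`-algebra to decorated trees. -/
noncomputable def ofFree (K : Type u) (V : Type v) [Field K] [AddCommGroup V] [Module K V] :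
    FreeBInf K V →ₗ[K] TreeModule K V :=
  FreeBInf.lift (leafMap K V)

theorem idemStar_starB (u v : TensorAlgebra K (TreeModule K V)) :
    idemStar K V (TensorAlgebra.starB K _ (u ⊗ₜ v)) =
      TwoAssocAlgebra.star (K := K) (idemStar K V u) (idemStar K V v) :=
  idemStar_starHom u v

/-- The image in `2as(V)` of the tensor algebra of the free `B∞`-algebra is closed under both
products and contains `V`, so it is everything. If a tensor `u` maps to `y^*`, its component of
length one is a preimage of `y`, by `part_idemStar`. -/
theorem ofFree_surjective : Function.Surjective (ofFree K V) := by
  let E := (idemStar K V).comp (TensorAlgebra.mapHom (ofFree K V))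
  have hE : ∀ x, x ∈ E.range := by
    intro x
    induction x using FreeTwoAssoc.induction with
    | of v =>
      refine ⟨TensorAlgebra.ι K (FreeBInf.ι K v), ?_⟩
      change idemStar K V (TensorAlgebra.mapHom (ofFree K V) (TensorAlgebra.ι K _)) = _
      rw [TensorAlgebra.mapHom_ι, idemStar_ι, ofFree, FreeBInf.lift_ι, star_leafMap,
        FreeTwoAssoc.idem_ι]
    | one => exact one_mem _
    | add x y hx hy => exact add_mem hx hy
    | smul c x hx => exact Subalgebra.smul_mem _ hx c
    | star x y hx hy =>
      obtain ⟨u, rfl⟩ := hx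
      obtain ⟨v, rfl⟩ := hy
      refine ⟨TensorAlgebra.starB K _ (u ⊗ₜ v), ?_⟩
      change idemStar K V (TensorAlgebra.mapHom (ofFree K V) (TensorAlgebra.starB K _ (u ⊗ₜ v))) = _
      rw [TensorAlgebra.map_starB (f := ofFree K V) (FreeBInf.lift_M (leafMap K V)),
        idemStar_starB]
      rfl
    | mul x y hx hy => exact mul_mem hx hy
  intro y
  obtain ⟨u, hu⟩ := hE (star K V y)
  refine ⟨TensorAlgebra.proj K _ u, ?_⟩
  rw [← TensorAlgebra.proj_map, ← part_idemStar, ← part_star y, ← hu]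
  rfl

/-- The inverse of `ofFree`. -/
noncomputable def toFreeBInf (K : Type u) (V : Type v) [Field K] [AddCommGroup V] [Module K V] :
    TreeModule K V →ₗ[K] FreeBInf K V :=
  TensorAlgebra.proj K _ ∘ₗ (FreeTwoAssoc.toTensor (FreeBInf.ι K)).toLinearMap ∘ₗ star K V

theorem toFreeBInf_apply (y : TreeModule K V) : toFreeBInf K V y =
    TensorAlgebra.proj K _ (FreeTwoAssoc.toTensor (FreeBInf.ι K) (star K V y)) := rfl

/-- Two morphisms of algebras are compared on letters `y`, where `toTensor_idem` says that `e(y^*)`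
goes to the letter `toFreeBInf y`. -/
theorem toTensor_idemStar (u : TensorAlgebra K (TreeModule K V)) :
    FreeTwoAssoc.toTensor (FreeBInf.ι K) (idemStar K V u) =
      TensorAlgebra.mapHom (toFreeBInf K V) u := by
  have h : (FreeTwoAssoc.toTensor (FreeBInf.ι K)).comp (idemStar K V) =
      TensorAlgebra.mapHom (toFreeBInf K V) :=
    TensorAlgebra.hom_ext (LinearMap.ext fun y => by
      change FreeTwoAssoc.toTensor (FreeBInf.ι K) (idemStar K V (TensorAlgebra.ι K y)) =
        TensorAlgebra.mapHom (toFreeBInf K V) (TensorAlgebra.ι K y)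
      rw [idemStar_ι, FreeTwoAssoc.toTensor_idem, TensorAlgebra.mapHom_ι, toFreeBInf_apply])
  exact DFunLike.congr_fun h u

/-- The map `proj ∘ toTensor` takes the same value on `x` and on `e(x)`, and `e` ignores the
projection in the definition of `M_{pq}` on trees. What remains is the projection of a product `*`
in the tensor algebra, which is `M_{pq}` of the free `B∞`-algebra. -/
theorem toFreeBInf_M (p q : ℕ) (a : Fin p → TreeModule K V) (b : Fin q → TreeModule K V) :
    toFreeBInf K V (BInfAlgebra.M (K := K) p q a b) =
      BInfAlgebra.M (K := K) p q (fun i => toFreeBInf K V (a i)) fun j => toFreeBInf K V (b j) := by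
  have h := congrArg (fun x => TensorAlgebra.proj K _ (FreeTwoAssoc.toTensor (FreeBInf.ι K) x))
    (idem_star_M (K := K) p q a b)
  simp only [FreeTwoAssoc.toTensor_idem, TensorAlgebra.proj_ι, FreeTwoAssoc.toTensor_star,
    toTensor_idemStar, TensorAlgebra.mapHom_tprod] at h
  rw [toFreeBInf_apply, h, TensorAlgebra.starB, TensorAlgebra.proj_starHom,
    TensorAlgebra.opLin_tprod]

theorem toFreeBInf_ofFree (r : FreeBInf K V) : toFreeBInf K V (ofFree K V r) = r := by
  have h := (FreeBInf.existsUnique_lift (FreeBInf.ι K : V →ₗ[K] FreeBInf K V)).unique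
    (y₁ := toFreeBInf K V ∘ₗ ofFree K V) (y₂ := LinearMap.id)
    ⟨fun p q a b => ?_, fun v => ?_⟩ ⟨fun _ _ _ _ => rfl, fun _ => rfl⟩
  · exact LinearMap.congr_fun h r
  · rw [LinearMap.comp_apply, ofFree, FreeBInf.lift_M, toFreeBInf_M]
    rfl
  · rw [LinearMap.comp_apply, ofFree, FreeBInf.lift_ι, toFreeBInf_apply, star_leafMap,
      FreeTwoAssoc.toTensor_ι, TensorAlgebra.proj_ι]

/-- The isomorphism between the free `B∞`-algebra and decorated trees. -/
noncomputable def freeEquiv (K : Type u) (V : Type v) [Field K] [AddCommGroup V] [Module K V] :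
    FreeBInf K V ≃ₗ[K] TreeModule K V :=
  LinearEquiv.ofBijective (ofFree K V)
    ⟨Function.LeftInverse.injective toFreeBInf_ofFree, ofFree_surjective⟩

theorem freeEquiv_ι (v : V) : freeEquiv K V (FreeBInf.ι K v) = leafMap K V v :=
  FreeBInf.lift_ι (leafMap K V) v

theorem freeEquiv_M (p q : ℕ) (a : Fin p → FreeBInf K V) (b : Fin q → FreeBInf K V) :
    freeEquiv K V (BInfAlgebra.M (K := K) p q a b) =
      BInfAlgebra.M (K := K) p q (fun i => freeEquiv K V (a i)) fun j => freeEquiv K V (b j) :=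
  FreeBInf.lift_M (leafMap K V) p q a b

theorem star_injective : Function.Injective (star K V) :=
  Function.LeftInverse.injective part_star

/-! ### Naturality in `V` -/

section

variable {W : Type w} [AddCommGroup W] [Module K W] (f : V →ₗ[K] W)

/-- The map of decorated trees induced by a linear map. -/
noncomputable def mapDec : TreeModule K V →ₗ[K] TreeModule K W :=
  part K W ∘ₗ (FreeTwoAssoc.mapHom f).toLinearMap ∘ₗ star K V

theorem mapDec_apply (y : TreeModule K V) :
    mapDec f y = part K W (FreeTwoAssoc.mapHom f (star K V y)) := rfl

theorem mapDec_dec {n : ℕ} (t : PT n) (x : Fin n → V) :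
    mapDec f (dec K t x) = dec K t fun i => f (x i) := by
  rw [mapDec_apply, star_dec, FreeTwoAssoc.mapHom_toFree, ← part_star (dec K t fun i => f (x i)),
    star_dec]

/-- The outer projection factors through `e`, which commutes with the induced morphism and ignores
the inner projection. -/
theorem part_mapHom_star_part (x : FreeTwoAssoc K V) :
    part K W (FreeTwoAssoc.mapHom f (star K V (part K V x))) =
      part K W (FreeTwoAssoc.mapHom f x) := by
  have h : ∀ x, part K W x = part K W (InfBialgebra.idem K (FreeTwoAssoc K W) x) := fun x =>
    (FreeTwoAssoc.toTree_idem _ x).symm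
  rw [h, FreeTwoAssoc.idem_mapHom, idem_star_part, ← FreeTwoAssoc.idem_mapHom, ← h]

theorem mapHom_idemStar (u : TensorAlgebra K (TreeModule K V)) :
    FreeTwoAssoc.mapHom f (idemStar K V u) =
      idemStar K W (TensorAlgebra.mapHom (mapDec f) u) := by
  have h : (FreeTwoAssoc.mapHom f).comp (idemStar K V) =
      (idemStar K W).comp (TensorAlgebra.mapHom (mapDec f)) :=
    TensorAlgebra.hom_ext (LinearMap.ext fun y => by
      change FreeTwoAssoc.mapHom f (idemStar K V (TensorAlgebra.ι K y)) =
        idemStar K W (TensorAlgebra.mapHom (mapDec f) (TensorAlgebra.ι K y))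
      rw [idemStar_ι, ← FreeTwoAssoc.idem_mapHom, TensorAlgebra.mapHom_ι, idemStar_ι,
        mapDec_apply, idem_star_part])
  exact DFunLike.congr_fun h u

theorem mapDec_M (p q : ℕ) (a : Fin p → TreeModule K V) (b : Fin q → TreeModule K V) :
    mapDec f (BInfAlgebra.M (K := K) p q a b) =
      BInfAlgebra.M (K := K) p q (fun i => mapDec f (a i)) fun j => mapDec f (b j) := by
  rw [mapDec_apply, M_apply, part_mapHom_star_part, FreeTwoAssoc.mapHom_star, mapHom_idemStar,
    mapHom_idemStar, TensorAlgebra.mapHom_tprod, TensorAlgebra.mapHom_tprod, M_apply]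

/-- Both sides are `B∞`-morphisms out of a free algebra with the same values on `V`. This transports
computations with generic variables in `K^n` to arbitrary vectors. -/
theorem freeEquiv_lift_ι (r : FreeBInf K V) :
    freeEquiv K W (FreeBInf.lift (FreeBInf.ι K ∘ₗ f) r) = mapDec f (freeEquiv K V r) := by
  have h := (FreeBInf.existsUnique_lift (leafMap K W ∘ₗ f)).unique
    (y₁ := (freeEquiv K W).toLinearMap ∘ₗ FreeBInf.lift (FreeBInf.ι K ∘ₗ f))
    (y₂ := mapDec f ∘ₗ (freeEquiv K V).toLinearMap)
    ⟨fun p q a b => ?_, fun v => freeEquiv_ι (f v)⟩ ⟨fun p q a b => ?_, fun v => ?_⟩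
  · exact LinearMap.congr_fun h r
  · simp only [LinearMap.comp_apply, LinearEquiv.coe_coe, FreeBInf.lift_M, freeEquiv_M]
  · simp only [LinearMap.comp_apply, LinearEquiv.coe_coe, freeEquiv_M, mapDec_M]
  · change mapDec f (freeEquiv K V (FreeBInf.ι K v)) = leafMap K W (f v)
    rw [freeEquiv_ι, leafMap_apply, leafMap_apply]
    exact mapDec_dec f (⟨.leaf, rfl⟩ : PT 1) _

end

end

end TreeModule

/-! ## Multilinear maps on spanning sets -/

theorem mapsTo_span_of_multilinear {K R N I : Type*} [Field K] [AddCommGroup R] [Module K R]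
    [AddCommGroup N] [Module K N] [Finite I] (f : MultilinearMap K (fun _ : I => R) N) {S : Set R}
    {W : Submodule K N} (h : ∀ a, (∀ i, a i ∈ S) → f a ∈ W) (a : I → R)
    (ha : ∀ i, a i ∈ Submodule.span K S) : f a ∈ W := by
  classical
  have := Fintype.ofFinite I
  -- The arguments are moved from `S` to its span one index at a time; `T` is the set of indices
  -- where this has been done.
  have key : ∀ (T : Finset I) (a : I → R), (∀ i ∈ T, a i ∈ Submodule.span K S) →
      (∀ i, i ∉ T → a i ∈ S) → f a ∈ W := by
    intro T
    induction T using Finset.induction_on with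
    | empty => exact fun a _ ha => h a fun i => ha i (Finset.notMem_empty i)
    | insert j T hj ih =>
      intro a ha ha'
      have hu : ∀ x ∈ Submodule.span K S, f (Function.update a j x) ∈ W := by
        intro x hx
        induction hx using Submodule.span_induction with
        | mem x hx =>
          refine ih _ (fun i hi => ?_) fun i hi => ?_
          · rw [Function.update_of_ne (fun e : i = j => hj (e ▸ hi))]
            exact ha i (Finset.mem_insert_of_mem hi)
          · by_cases e : i = j
            · subst e
              rwa [Function.update_self]
            · rw [Function.update_of_ne e]
              exact ha' i (by simp [e, hi])
        | zero =>
          rw [MultilinearMap.map_update_zero]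
          exact zero_mem _
        | add x y _ _ hx hy =>
          rw [MultilinearMap.map_update_add]
          exact add_mem hx hy
        | smul c x _ hx =>
          rw [MultilinearMap.map_update_smul]
          exact Submodule.smul_mem _ _ hx
      rw [← Function.update_eq_self j a]
      exact hu _ (ha j (Finset.mem_insert_self j T))
  exact key Finset.univ a (fun i _ => ha i) fun i hi => absurd (Finset.mem_univ i) hi

theorem DecTree.degree_eq_map {X : Type*} (t : DecTree X) :
    t.degree = Finset.univ.val.map t.2 := by
  rw [degree, ← Multiset.sum_map_singleton (Finset.univ.val.map t.2), Multiset.map_map]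
  rfl

namespace FreeBInf

section

variable {K : Type u} [Field K] {n : ℕ}

/-- Needed to show that multilinear trees come from multilinear operations: a preimage in the free
algebra can be split into monomials of known degrees. -/
theorem exists_isBInfMonomial_span (r : FreeBInf K (Fin n → K)) :
    r ∈ Submodule.span K {r | ∃ d, IsBInfMonomial K (genericVar K n) d r} := by
  set W := Submodule.span K {r | ∃ d, IsBInfMonomial K (genericVar K n) d r} with hW
  obtain ⟨t, rfl⟩ := mk_surjective r
  induction t with
  | of x =>
    change ι K x ∈ W
    rw [pi_eq_sum_univ' x, map_sum]
    refine Submodule.sum_mem _ fun i _ => ?_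
    rw [map_smul]
    refine Submodule.smul_mem _ _ (Submodule.subset_span ⟨{i}, ?_⟩)
    exact IsBInfMonomial.var (x := genericVar K n) i
  | zero => exact zero_mem _
  | add s t h h' => exact add_mem h h'
  | smul c t h => exact Submodule.smul_mem _ _ h
  | op p q a b ha hb =>
    rw [mk_op]
    change BInfAlgebra.M (K := K) p q (fun i => mk (a i)) (fun j => mk (b j)) ∈ W
    refine mapsTo_span_of_multilinear (BInfAlgebra.M (K := K) p q (fun i => mk (a i)))
      (fun b' hb' => ?_) _ hb
    let ev : MultilinearMap K (fun _ : Fin q => FreeBInf K (Fin n → K)) (FreeBInf K (Fin n → K))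
        →ₗ[K] FreeBInf K (Fin n → K) :=
      { toFun := fun g => g b', map_add' := fun _ _ => rfl, map_smul' := fun _ _ => rfl }
    refine mapsTo_span_of_multilinear
      (ev.compMultilinearMap (BInfAlgebra.M (K := K) p q)) (fun a' ha' => ?_) _ ha
    choose d hd using ha'
    choose d' hd' using hb'
    exact Submodule.subset_span ⟨_, .op p q d d' a' b' hd hd'⟩

end

end FreeBInf

/-! ## Corollas -/

namespace PlanarTree

section

variable {K : Type u} {V : Type v} [Field K] [AddCommGroup V] [Module K V]

theorem toFree_corolla : ∀ {n : ℕ} (hn : 1 ≤ n) (x : Fin (corolla n).leaves → V),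
    ((corolla n).toFree false : MultilinearMap K _ _) x =
      iterProd (K := K) TwoAssocAlgebra.dot (TwoAssocAlgebra.one K) n
        fun i => FreeTwoAssoc.ι K (x (Fin.cast (leaves_corolla hn).symm i))
  | 1, _, x => by
    rw [iterProd_succ, iterProd_zero, TwoAssocAlgebra.dot_one]
    rfl
  | k + 2, hn, x => by
    refine (toFree_node k (fun _ => leaf) false x).trans ?_
    refine congrArg (iterProd (K := K) _ _ (k + 2)) (funext fun i => ?_)
    refine congrArg (fun j => FreeTwoAssoc.ι K (x j)) (Fin.ext ?_)
    refine (finSigmaFinEquiv_apply (n := fun _ : Fin (k + 2) => 1) ⟨i, 0⟩).trans ?_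
    simp

theorem star_dec_gammaTree {p q : ℕ} (hp : 1 ≤ p) (hq : 1 ≤ q) (x : Fin p → V) (y : Fin q → V) :
    TreeModule.star K V (TreeModule.dec K (gammaTree hp hq) (Fin.append x y)) =
      TwoAssocAlgebra.star (K := K)
        (iterProd (K := K) TwoAssocAlgebra.dot (TwoAssocAlgebra.one K) p
          fun i => FreeTwoAssoc.ι K (x i))
        (iterProd (K := K) TwoAssocAlgebra.dot (TwoAssocAlgebra.one K) q
          fun j => FreeTwoAssoc.ι K (y j)) := by
  rw [TreeModule.star_dec]
  refine (toFree_node 0 ![corolla p, corolla q] true _).trans ?_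
  rw [iterProd_succ, iterProd_succ, iterProd_zero]
  refine (congrArg _ (TwoAssocAlgebra.star_one (K := K) _)).trans ?_
  refine congrArg₂ (fun a b => TwoAssocAlgebra.star (K := K) a b) ?_ ?_
  · refine (toFree_corolla hp _).trans ?_
    refine congrArg (iterProd (K := K) _ _ p) (funext fun i => congrArg (FreeTwoAssoc.ι K) ?_)
    refine Eq.trans (congrArg (Fin.append x y) (Fin.ext ?_)) (Fin.append_left x y i)
    refine (finSigmaFinEquiv_apply (n := fun i : Fin 2 => (![corolla p, corolla q] i).leaves)
      ⟨0, _⟩).trans ?_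
    simp
  · refine (toFree_corolla hq _).trans ?_
    refine congrArg (iterProd (K := K) _ _ q) (funext fun i => congrArg (FreeTwoAssoc.ι K) ?_)
    refine Eq.trans (congrArg (Fin.append x y) (Fin.ext ?_)) (Fin.append_right x y i)
    refine (finSigmaFinEquiv_apply (n := fun i : Fin 2 => (![corolla p, corolla q] i).leaves)
      ⟨1, _⟩).trans ?_
    simp [leaves_corolla hp]

end

end PlanarTree

namespace TreeModule

section

variable {K : Type u} {V : Type v} [Field K] [AddCommGroup V] [Module K V]

/-- Since `e(v) = v`, the formula of `star_M` reads `(x_1 · … · x_p) * (y_1 · … · y_q)`, which is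
the value of `γ_{pq}` with these decorations. -/
theorem M_leafMap {p q : ℕ} (hp : 1 ≤ p) (hq : 1 ≤ q) (x : Fin p → V) (y : Fin q → V) :
    BInfAlgebra.M (K := K) p q (fun i => leafMap K V (x i)) (fun j => leafMap K V (y j)) =
      dec K (gammaTree hp hq) (Fin.append x y) := by
  refine star_injective ?_
  rw [star_M hp hq, idemStar_tprod, idemStar_tprod, PlanarTree.star_dec_gammaTree]
  simp only [star_leafMap, FreeTwoAssoc.idem_ι]

end

/-! ## The operad of `B∞`-algebras -/

section

variable (K : Type u) [Field K] (n : ℕ)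

/-- The map `t ⊗ σ ↦ (t; x_{σ⁻¹(1)} ⋯ x_{σ⁻¹(n)})`. -/
noncomputable def labelled : (PT n →₀ K) ⊗[K] MonoidAlgebra K (Equiv.Perm (Fin n)) →ₗ[K]
    TreeModule K (Fin n → K) :=
  TensorProduct.lift (Finsupp.linearCombination K fun t =>
    (Finsupp.linearCombination K fun σ : Equiv.Perm (Fin n) =>
      dec K t fun i => Pi.single (σ.symm i) (1 : K)) ∘ₗ
        (MonoidAlgebra.coeffLinearEquiv K).toLinearMap)

/-- The multilinear part of a tensor, as an element of the group algebra. -/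
noncomputable def labelPart : (⨂[K]^n (Fin n → K)) →ₗ[K]
    MonoidAlgebra K (Equiv.Perm (Fin n)) :=
  PiTensorProduct.lift (∑ σ : Equiv.Perm (Fin n),
    ((MultilinearMap.mkPiAlgebra K (Fin n) K).compLinearMap
      fun i => LinearMap.proj (σ.symm i)).smulRight (MonoidAlgebra.single σ (1 : K)))

/-- The multilinear part of a linear combination of decorated trees. -/
noncomputable def multilinearPart : TreeModule K (Fin n → K) →ₗ[K]
    (PT n →₀ K) ⊗[K] MonoidAlgebra K (Equiv.Perm (Fin n)) :=
  LinearMap.lTensor _ (labelPart K n) ∘ₗ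
    DirectSum.component K ℕ (fun m => (PT m →₀ K) ⊗[K] (⨂[K]^m (Fin n → K))) n

variable {K n}

theorem labelled_tmul (t : PT n) (σ : Equiv.Perm (Fin n)) :
    labelled K n (Finsupp.single t 1 ⊗ₜ MonoidAlgebra.single σ 1) =
      dec K t fun i => Pi.single (σ.symm i) (1 : K) := by
  rw [labelled, TensorProduct.lift.tmul, Finsupp.linearCombination_single, one_smul]
  refine (Finsupp.linearCombination_single K (1 : K) σ).trans ?_
  rw [one_smul]

/-- At most one summand is nonzero. The sum also covers a `w` that is not a permutation, where it is
zero. -/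
theorem labelPart_tprod (w : Fin n → Fin n) :
    labelPart K n (PiTensorProduct.tprod K fun i => Pi.single (w i) (1 : K)) =
      ∑ σ : Equiv.Perm (Fin n), if w = σ.symm then MonoidAlgebra.single σ (1 : K) else 0 := by
  classical
  rw [labelPart, PiTensorProduct.lift.tprod, sum_apply]
  refine Finset.sum_congr rfl fun σ _ => ?_
  rw [MultilinearMap.smulRight_apply, MultilinearMap.compLinearMap_apply,
    MultilinearMap.mkPiAlgebra_apply]
  split_ifs with h
  · rw [Finset.prod_eq_one, one_smul]
    intro i _
    rw [LinearMap.proj_apply, h, Pi.single_eq_same]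
  · obtain ⟨i, hi⟩ := Function.ne_iff.1 h
    rw [Finset.prod_eq_zero (Finset.mem_univ i), zero_smul]
    rw [LinearMap.proj_apply, Pi.single_eq_of_ne hi.symm]

theorem multilinearPart_dec (t : PT n) (w : Fin n → Fin n) :
    multilinearPart K n (dec K t fun i => Pi.single (w i) (1 : K)) =
      Finsupp.single t 1 ⊗ₜ
        ∑ σ : Equiv.Perm (Fin n), if w = σ.symm then MonoidAlgebra.single σ (1 : K) else 0 := by
  rw [multilinearPart, LinearMap.comp_apply, dec, DirectSum.component.lof_self,
    LinearMap.lTensor_tmul, labelPart_tprod]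

theorem multilinearPart_dec_symm (t : PT n) (σ : Equiv.Perm (Fin n)) :
    multilinearPart K n (dec K t fun i => Pi.single (σ.symm i) (1 : K)) =
      Finsupp.single t 1 ⊗ₜ MonoidAlgebra.single σ (1 : K) := by
  classical
  rw [multilinearPart_dec]
  refine congrArg _ ((Finset.sum_congr rfl fun τ _ => ?_).trans
    (Finset.sum_ite_eq Finset.univ σ fun τ => MonoidAlgebra.single τ (1 : K))) |>.trans ?_
  · refine if_congr ⟨fun h => ?_, fun h => by rw [h]⟩ rfl rfl
    exact Equiv.symm_bijective.injective (DFunLike.coe_injective h)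
  · rw [if_pos (Finset.mem_univ σ)]

theorem multilinearPart_dec_of_ne {m : ℕ} (h : m ≠ n) (t : PT m) (x : Fin m → Fin n → K) :
    multilinearPart K n (dec K t x) = 0 := by
  rw [multilinearPart, LinearMap.comp_apply, dec, DirectSum.component.of, dif_neg h, map_zero]

theorem tensor_ext {N : Type*} [AddCommMonoid N] [Module K N]
    {f g : (PT n →₀ K) ⊗[K] MonoidAlgebra K (Equiv.Perm (Fin n)) →ₗ[K] N}
    (h : ∀ (t : PT n) (σ : Equiv.Perm (Fin n)),
      f (Finsupp.single t 1 ⊗ₜ MonoidAlgebra.single σ 1) =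
        g (Finsupp.single t 1 ⊗ₜ MonoidAlgebra.single σ 1)) : f = g := by
  refine TensorProduct.ext (Finsupp.lhom_ext' fun t => LinearMap.ext_ring (LinearMap.ext fun x => ?_))
  have key : ((TensorProduct.mk K _ _).compr₂ f (Finsupp.single t 1)) ∘ₗ
      (MonoidAlgebra.coeffLinearEquiv K).symm.toLinearMap =
        ((TensorProduct.mk K _ _).compr₂ g (Finsupp.single t 1)) ∘ₗ
      (MonoidAlgebra.coeffLinearEquiv K).symm.toLinearMap :=
    Finsupp.lhom_ext' fun σ => LinearMap.ext_ring (h t σ)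
  exact LinearMap.congr_fun key x.coeff

theorem multilinearPart_labelled
    (x : (PT n →₀ K) ⊗[K] MonoidAlgebra K (Equiv.Perm (Fin n))) :
    multilinearPart K n (labelled K n x) = x := by
  have h : multilinearPart K n ∘ₗ labelled K n = LinearMap.id := tensor_ext fun t σ => by
    rw [LinearMap.comp_apply, labelled_tmul, multilinearPart_dec_symm]
    rfl
  exact LinearMap.congr_fun h x

/-- The standard basis of `K^n`, as a family. -/
abbrev stdFamily (K : Type u) [Field K] (n : ℕ) (i : Fin n) : Fin n → K := Pi.single i 1

theorem labelled_multilinearPart {y : TreeModule K (Fin n → K)}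
    (hy : y ∈ gr K (stdFamily K n) Finset.univ.val) :
    labelled K n (multilinearPart K n y) = y := by
  have h : gr K (stdFamily K n) Finset.univ.val ≤
      LinearMap.eqLocus (labelled K n ∘ₗ multilinearPart K n) LinearMap.id := by
    refine Submodule.span_le.2 ?_
    rintro _ ⟨⟨t, w⟩, ht, rfl⟩
    have ht' : (Finset.univ.val.map w : Multiset (Fin n)) = Finset.univ.val := by
      rw [← ht, DecTree.degree_eq_map]
    have hc := congrArg Multiset.card ht'
    simp only [Multiset.card_map, Finset.card_val, Finset.card_univ, Fintype.card_fin] at hc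
    have hw : Function.Surjective w := fun i => by
      have : i ∈ (Finset.univ.val.map w : Multiset (Fin n)) := ht' ▸ Finset.mem_univ i
      obtain ⟨s, -, hs⟩ := Multiset.mem_map.1 this
      exact ⟨s, hs⟩
    subst hc
    -- Since `labelled` puts the label `σ⁻¹(i)` on the leaf `i`, the group element that belongs to
    -- the labelling `w` is its inverse.
    let σ := (Equiv.ofBijective w (Finite.injective_iff_surjective.2 hw |>.bijective_of_finite))
    exact (congrArg (labelled K t.leaves) (multilinearPart_dec_symm (⟨t, rfl⟩ : PT t.leaves)
      σ.symm)).trans (labelled_tmul _ _)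
  exact h hy

theorem multilinearPart_eq_zero {d : Multiset (Fin n)} (hd : d ≠ Finset.univ.val)
    {y : TreeModule K (Fin n → K)} (hy : y ∈ gr K (stdFamily K n) d) :
    multilinearPart K n y = 0 := by
  have h : gr K (stdFamily K n) d ≤ LinearMap.ker (multilinearPart K n) := by
    refine Submodule.span_le.2 ?_
    rintro _ ⟨⟨t, w⟩, ht, rfl⟩
    by_cases hn : t.leaves = n
    · subst hn
      refine (multilinearPart_dec (⟨t, rfl⟩ : PT t.leaves) w).trans ?_
      rw [Finset.sum_eq_zero, TensorProduct.tmul_zero]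
      intro σ _
      rw [if_neg]
      rintro rfl
      refine hd (ht.symm.trans ?_)
      rw [DecTree.degree_eq_map]
      have := congrArg Finset.val (Finset.map_univ_equiv σ.symm)
      rwa [Finset.map_val] at this
    · exact multilinearPart_dec_of_ne hn _ _
  exact h hy

theorem idemStar_tprod_mem_gr {V : Type v} [AddCommGroup V] [Module K V] {X : Type*} {f : X → V}
    {m : ℕ} {d : Fin m → Multiset X} {a : Fin m → TreeModule K V} (ha : ∀ i, a i ∈ gr K f (d i)) :
    idemStar K V (TensorAlgebra.tprod K _ m a) ∈
      FreeTwoAssoc.gr K f (fun i => ({i} : Multiset X)) (∑ i, d i) := by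
  induction m with
  | zero =>
    rw [TensorAlgebra.tprod_zero, map_one, Finset.univ_eq_empty, Finset.sum_empty]
    exact FreeTwoAssoc.one_mem_gr
  | succ m ih =>
    rw [TensorAlgebra.tprod_succ, map_mul, Fin.sum_univ_succ, idemStar_ι]
    exact FreeTwoAssoc.mul_mem_gr (FreeTwoAssoc.idem_mem_gr (DecTree.star_mem_gr f (ha 0)))
      (ih fun i => ha i.succ)

/-- All ingredients of the operations on trees, namely `e`, both products and the projection,
preserve the grading by multisets of labels. For the projection this requires the standard basis. -/
theorem freeEquiv_mem_gr {d : Multiset (Fin n)} {r : FreeBInf K (Fin n → K)}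
    (h : IsBInfMonomial K (genericVar K n) d r) :
    freeEquiv K (Fin n → K) r ∈ gr K (stdFamily K n) d := by
  induction h with
  | var i =>
    refine Submodule.subset_span ⟨DecTree.leaf i, ?_, freeEquiv_ι _⟩
    exact Fin.sum_univ_one _
  | op p q d d' a b _ _ ha hb =>
    rw [freeEquiv_M, M_apply, part_eq_toTree (Pi.basisFun K (Fin n))]
    have hb' : ⇑(Pi.basisFun K (Fin n)) = stdFamily K n := by
      funext i
      exact Pi.basisFun_apply K (Fin n) i
    have := FreeTwoAssoc.toTree_mem_gr (Pi.basisFun K (Fin n)) (d := ∑ i, d i + ∑ j, d' j)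
      (x := TwoAssocAlgebra.star (K := K)
        (idemStar K _ (TensorAlgebra.tprod K _ p fun i => freeEquiv K _ (a i)))
        (idemStar K _ (TensorAlgebra.tprod K _ q fun i => freeEquiv K _ (b i))))
    rw [hb'] at this
    exact this (FreeTwoAssoc.star_mem_gr (idemStar_tprod_mem_gr ha) (idemStar_tprod_mem_gr hb))

theorem freeEquiv_mem_gr_univ {μ : FreeBInf K (Fin n → K)} (hμ : μ ∈ BInfOperad K n) :
    freeEquiv K (Fin n → K) μ ∈ gr K (stdFamily K n) Finset.univ.val := by
  have : BInfOperad K n ≤ (gr K (stdFamily K n) Finset.univ.val).comap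
      (freeEquiv K (Fin n → K)).toLinearMap :=
    Submodule.span_le.2 fun r hr => freeEquiv_mem_gr hr
  exact this hμ

/-- On a monomial, extracting the multilinear part and putting it back is the identity if every
generator occurs exactly once, and zero otherwise. As monomials span, the result always lies in the
span of the multilinear ones. -/
theorem labelled_multilinearPart_mem (r : FreeBInf K (Fin n → K)) :
    (freeEquiv K (Fin n → K)).symm
      (labelled K n (multilinearPart K n (freeEquiv K (Fin n → K) r))) ∈ BInfOperad K n := by
  have h : Submodule.span K {r | ∃ d, IsBInfMonomial K (genericVar K n) d r} ≤
      (BInfOperad K n).comap ((freeEquiv K (Fin n → K)).symm.toLinearMap ∘ₗ labelled K n ∘ₗ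
        multilinearPart K n ∘ₗ (freeEquiv K (Fin n → K)).toLinearMap) := by
    refine Submodule.span_le.2 ?_
    rintro r ⟨d, hr⟩
    change (freeEquiv K (Fin n → K)).symm
      (labelled K n (multilinearPart K n (freeEquiv K (Fin n → K) r))) ∈ BInfOperad K n
    by_cases hd : d = Finset.univ.val
    · subst hd
      rw [labelled_multilinearPart (freeEquiv_mem_gr hr), LinearEquiv.symm_apply_apply]
      exact Submodule.subset_span hr
    · rw [multilinearPart_eq_zero hd (freeEquiv_mem_gr hr), map_zero, map_zero]
      exact zero_mem _
  exact h (FreeBInf.exists_isBInfMonomial_span r)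

theorem freeEquiv_symm_labelled_mem
    (x : (PT n →₀ K) ⊗[K] MonoidAlgebra K (Equiv.Perm (Fin n))) :
    (freeEquiv K (Fin n → K)).symm (labelled K n x) ∈ BInfOperad K n := by
  have := labelled_multilinearPart_mem ((freeEquiv K (Fin n → K)).symm (labelled K n x))
  rwa [LinearEquiv.apply_symm_apply, multilinearPart_labelled] at this

variable (K n) in
/-- The isomorphism between the space of `n`-ary operations of `B∞`-algebras and
`K[PT_n] ⊗ K[S_n]`. -/
noncomputable def operadEquiv :
    BInfOperad K n ≃ₗ[K] (PT n →₀ K) ⊗[K] MonoidAlgebra K (Equiv.Perm (Fin n)) :=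
  LinearEquiv.ofLinearMap
    (multilinearPart K n ∘ₗ (freeEquiv K (Fin n → K)).toLinearMap ∘ₗ (BInfOperad K n).subtype)
    (((freeEquiv K (Fin n → K)).symm.toLinearMap ∘ₗ labelled K n).codRestrict _
      freeEquiv_symm_labelled_mem)
    (LinearMap.ext fun x => by
      change multilinearPart K n (freeEquiv K (Fin n → K)
        ((freeEquiv K (Fin n → K)).symm (labelled K n x))) = x
      rw [LinearEquiv.apply_symm_apply, multilinearPart_labelled])
    (LinearMap.ext fun μ => Subtype.ext (by
      change (freeEquiv K (Fin n → K)).symm (labelled K n (multilinearPart K n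
        (freeEquiv K (Fin n → K) μ))) = μ
      rw [labelled_multilinearPart (freeEquiv_mem_gr_univ μ.2), LinearEquiv.symm_apply_apply]))

theorem operadEquiv_apply (μ : BInfOperad K n) :
    operadEquiv K n μ = multilinearPart K n (freeEquiv K (Fin n → K) μ) := rfl

theorem freeEquiv_operadEquiv_symm
    (x : (PT n →₀ K) ⊗[K] MonoidAlgebra K (Equiv.Perm (Fin n))) :
    freeEquiv K (Fin n → K) ((operadEquiv K n).symm x) = labelled K n x :=
  LinearEquiv.apply_symm_apply _ _

/-- Evaluation at vectors `x_i` is induced by the linear map `K^n → V` that sends the standard basis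
to the `x_i`, so naturality applies. -/
theorem freeEquiv_eval {V : Type v} [AddCommGroup V] [Module K V] (x : Fin n → V) (t : PT n)
    (σ : Equiv.Perm (Fin n)) :
    freeEquiv K V (BInfOperad.eval (fun i => FreeBInf.ι K (x i))
      ((operadEquiv K n).symm (Finsupp.single t 1 ⊗ₜ MonoidAlgebra.single σ 1))) =
        dec K t fun i => x (σ.symm i) := by
  have h : Fintype.linearCombination K (fun i => FreeBInf.ι K (x i)) =
      FreeBInf.ι K ∘ₗ Fintype.linearCombination K x :=
    LinearMap.ext fun c => by simp [Fintype.linearCombination_apply]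
  rw [BInfOperad.eval, LinearMap.comp_apply, h, freeEquiv_lift_ι, Submodule.subtype_apply,
    freeEquiv_operadEquiv_symm, labelled_tmul, mapDec_dec]
  simp only [Fintype.linearCombination_apply_single, one_smul]

/-- Acting by `τ` is evaluation at the permuted generators. The leaf `i` of `t ⊗ σ` then carries the
label `τ⁻¹(σ⁻¹(i)) = (στ)⁻¹(i)`, which is right multiplication by `τ`. -/
theorem operadEquiv_perm (τ : Equiv.Perm (Fin n)) (μ : BInfOperad K n) :
    operadEquiv K n (BInfOperad.perm τ μ) = LinearMap.lTensor (PT n →₀ K)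
      (LinearMap.mulRight K (MonoidAlgebra.single τ (1 : K))) (operadEquiv K n μ) := by
  have h : (operadEquiv K n).toLinearMap ∘ₗ BInfOperad.perm τ ∘ₗ
      (operadEquiv K n).symm.toLinearMap = LinearMap.lTensor (PT n →₀ K)
        (LinearMap.mulRight K (MonoidAlgebra.single τ (1 : K))) := tensor_ext fun t σ => by
    change multilinearPart K n (freeEquiv K (Fin n → K)
      (BInfOperad.eval (fun i => FreeBInf.ι K (Pi.single (τ.symm i) (1 : K)))
        ((operadEquiv K n).symm (Finsupp.single t 1 ⊗ₜ MonoidAlgebra.single σ 1)))) = _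
    rw [freeEquiv_eval, LinearMap.lTensor_tmul, LinearMap.mulRight_apply,
      MonoidAlgebra.single_mul_single, one_mul]
    exact multilinearPart_dec_symm t (σ * τ)
  have := LinearMap.congr_fun h (operadEquiv K n μ)
  simpa only [LinearMap.comp_apply, LinearEquiv.coe_coe, LinearEquiv.symm_apply_apply] using this

theorem operadEquiv_gen {p q : ℕ} (hp : 1 ≤ p) (hq : 1 ≤ q) :
    operadEquiv K (p + q) (BInfOperad.gen K p q) =
      Finsupp.single (gammaTree hp hq) 1 ⊗ₜ MonoidAlgebra.single 1 1 := by
  have h : freeEquiv K (Fin (p + q) → K) (BInfOperad.gen K p q) =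
      dec K (gammaTree hp hq) fun i => Pi.single i (1 : K) := by
    refine (freeEquiv_M p q _ _).trans ?_
    refine Eq.trans ?_ ((M_leafMap hp hq (fun i => Pi.single (Fin.castAdd q i) (1 : K))
      fun j => Pi.single (Fin.natAdd p j) (1 : K)).trans ?_)
    · rfl
    · refine congrArg _ (funext fun i => ?_)
      induction i using Fin.addCases with
      | left i => rw [Fin.append_left]
      | right j => rw [Fin.append_right]
  rw [operadEquiv_apply, h]
  exact multilinearPart_dec_symm _ 1

end

end TreeModule

theorem theorem6p4 (K : Type u) [Field K] :
    ∃ Φ : ∀ n : ℕ, BInfOperad K n ≃ₗ[K]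
        (PT n →₀ K) ⊗[K] MonoidAlgebra K (Equiv.Perm (Fin n)),
      (∀ (n : ℕ) (τ : Equiv.Perm (Fin n)) (μ : BInfOperad K n),
        Φ n (BInfOperad.perm τ μ) =
          LinearMap.lTensor (PT n →₀ K)
            (LinearMap.mulRight K (MonoidAlgebra.single τ (1 : K))) (Φ n μ)) ∧
      (∀ (p q : ℕ) (hp : 1 ≤ p) (hq : 1 ≤ q),
        Φ (p + q) (BInfOperad.gen K p q) =
          Finsupp.single (gammaTree hp hq) 1 ⊗ₜ[K] MonoidAlgebra.single 1 1) ∧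
      ∀ (V : Type v) [AddCommGroup V] [Module K V],
        Function.Injective (TreeModule.star K V) ∧
        ∃ Ψ : FreeBInf K V ≃ₗ[K] TreeModule K V,
          (∀ x : V, Ψ (FreeBInf.ι K x) =
            TreeModule.dec K (⟨PlanarTree.leaf, rfl⟩ : PT 1) (fun _ => x)) ∧
          (∀ (n : ℕ) (t : PT n) (σ : Equiv.Perm (Fin n)) (x : Fin n → V),
            Ψ (BInfOperad.eval (fun i => FreeBInf.ι K (x i))
                ((Φ n).symm (Finsupp.single t 1 ⊗ₜ[K] MonoidAlgebra.single σ 1))) =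
              TreeModule.dec K t (fun i => x (σ.symm i))) ∧
          (∀ (p q : ℕ) (hp : 1 ≤ p) (hq : 1 ≤ q) (x : Fin p → V) (y : Fin q → V),
            Ψ (BInfAlgebra.M (K := K) p q (fun i => FreeBInf.ι K (x i))
                (fun j => FreeBInf.ι K (y j))) =
              TreeModule.dec K (gammaTree hp hq) (Fin.append x y)) ∧
          (∀ (p q : ℕ), 1 ≤ p → 1 ≤ q →
            ∀ (s : Fin p → TreeModule K V) (t : Fin q → TreeModule K V),
              TreeModule.star K V
                  (Ψ (BInfAlgebra.M (K := K) p q (fun i => Ψ.symm (s i))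
                    (fun j => Ψ.symm (t j)))) =
                TwoAssocAlgebra.star (K := K)
                  (iterProd (K := K) TwoAssocAlgebra.dot (TwoAssocAlgebra.one K) p
                    (fun i => FreeTwoAssoc.e (TreeModule.star K V (s i))))
                  (iterProd (K := K) TwoAssocAlgebra.dot (TwoAssocAlgebra.one K) q
                    (fun j => FreeTwoAssoc.e (TreeModule.star K V (t j))))) := by
  refine ⟨TreeModule.operadEquiv K, fun n => TreeModule.operadEquiv_perm,
    fun p q hp hq => TreeModule.operadEquiv_gen hp hq, fun V _ _ =>
    ⟨TreeModule.star_injective, TreeModule.freeEquiv K V, TreeModule.freeEquiv_ι,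
      fun n t σ x => TreeModule.freeEquiv_eval x t σ, fun p q hp hq x y => ?_,
      fun p q hp hq s t => ?_⟩⟩
  · rw [TreeModule.freeEquiv_M, ← TreeModule.M_leafMap hp hq]
    simp only [TreeModule.freeEquiv_ι]
  · rw [TreeModule.freeEquiv_M]
    simp only [LinearEquiv.apply_symm_apply, FreeTwoAssoc.e_eq_idem]
    rw [TreeModule.star_M hp hq, TreeModule.idemStar_tprod, TreeModule.idemStar_tprod]
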